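/- Let $d\ge 1$, let $\Omega\subset\mathbb R^d$ be a bounded open set (in particular, any bounded Lipschitz domain with $d\in\{1,2,3\}$), $T>0$, $Q=\Omega\times(0,T)$, $\Sigma=\partial\Omega\times(0,T)$, $\omega=2\pi/T$, $\lambda>0$, $y_d\in L^2(Q)$, and let $\sigma,\nu:\Omega\to\mathbb R$ be measurable with $0<\underline\sigma\le\sigma\le\overline\sigma$ and $0<\underline\nu\le\nu\le\overline\nu$. Write $\|\cdot\|$ for the norm of $L^2(Q)$, and $\nabla$, $\nabla\cdot$ for the weak gradient and divergence in $x$. Spaces. $H^{1,0}(Q)=\{u\in L^2(Q):\nabla u\in[L^2(Q)]^d\}$; $H^{1,0}_0(Q)$ consists of the $u\in H^{1,0}(Q)$ with $u=0$ on $\Sigma$, i.e. it is the closure in $H^{1,0}(Q)$ of the restrictions to $Q$ of $C_c^\infty(\Omega\times\mathbb R)$; $H^{1,1}_{0,per}(Q)=\{u\in H^{1,0}_0(Q):\partial_t u\in L^2(Q),\ u(0)=u(T)\}$; $H(\mathrm{div},Q)=\{\boldsymbol\tau\in[L^2(Q)]^d:\nabla\cdot\boldsymbol\tau\in L^2(Q)\}$.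 For $u\in L^2(Q)$ and $k\ge1$ put $u_k^c=\frac2T\int_0^Tu(\cdot,t)\cos(k\omega t)\,dt$, $u_k^s=\frac2T\int_0^Tu(\cdot,t)\sin(k\omega t)\,dt$, $\boldsymbol u_k=(u_k^c,u_k^s)$, $\boldsymbol u_k^\perp=(-u_k^s,u_k^c)$, and let $H^{1,1/2}_{0,per}(Q)=\{u\in H^{1,0}_0(Q):\sum_{k\ge1}k\omega\|\boldsymbol u_k\|_{L^2(\Omega)}^2<\infty\}$. For $u,v\in H^{1,1/2}_{0,per}(Q)$ let $$b_\sigma(u,v)=\int_Q\sigma\,\partial_t^{1/2}u\,\partial_t^{1/2}v^\perp\,dx\,dt:=\frac T2\sum_{k\ge1}k\omega\int_\Omega\sigma\,\boldsymbol u_k\cdot\boldsymbol v_k^\perp\,dx .$$ Problem I. For $v\in L^2(Q)$, the state $y(v)\in H^{1,1/2}_{0,per}(Q)$ is the weak solution of $\sigma\partial_ty-\nabla\cdot(\nu\nabla y)=v$ in $Q$, $y=0$ on $\Sigma$, $y(0)=y(T)$, i.e. $\int_Q\nu\nabla y\cdot\nabla q\,dx\,dt+b_\sigma(y,q)=\int_Qvq\,dx\,dt$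 for all $q\in H^{1,1/2}_{0,per}(Q)$. Minimize $\mathcal J(y(v),v)=\frac12\|y(v)-y_d\|^2+\frac\lambda2\|v\|^2$ over $v\in L^2(Q)$. The optimality system is: find $y,p\in H^{1,1/2}_{0,per}(Q)$ such that, for all $z,q\in H^{1,1/2}_{0,per}(Q)$, $$\int_Q(yz-\nu\nabla p\cdot\nabla z)\,dx\,dt+b_\sigma(p,z)=\int_Qy_dz\,dx\,dt,\qquad \int_Q(\nu\nabla y\cdot\nabla q+\lambda^{-1}pq)\,dx\,dt+b_\sigma(y,q)=0.$$ Minorant. Let $\underline{\mu_1}=\frac1{\sqrt2}\min\{\underline\nu,\underline\sigma\}$, and let $C_F>0$ be a Friedrichs constant, i.e. $\|u\|\le C_F\|\nabla u\|$ for all $u\in H^{1,0}_0(Q)$. For $\eta,\zeta\in H^{1,1}_{0,per}(Q)$ and $\boldsymbol\tau,\boldsymbol\rho\in H(\mathrm{div},Q)$ put $R_1=\sigma\partial_t\eta-\nabla\cdot\boldsymbol\tau+\lambda^{-1}\zeta$, $R_2=\boldsymbol\tau-\nu\nabla\eta$, $R_3=\eta-y_d+\nabla\cdot\boldsymbol\rho+\sigma\partial_t\zeta$,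 $R_4=\boldsymbol\rho-\nu\nabla\zeta$ and $$\begin{aligned}\mathcal J^\ominus(\eta,\zeta,\boldsymbol\tau,\boldsymbol\rho)={}&\tfrac12\|\eta-y_d\|^2+\tfrac1{2\lambda}\|\zeta\|^2-\int_Q\big(\nu\nabla\eta\cdot\nabla\zeta+\sigma\,\partial_t\eta\,\zeta+\lambda^{-1}\zeta^2\big)\,dx\,dt\\&-\frac{C_F^2}{\underline{\mu_1}^2\lambda}\big(C_F\|R_3\|+\|R_4\|\big)^2-\frac1{\underline{\mu_1}}\big(C_F\|R_1\|+\|R_2\|\big)\big(C_F\|R_3\|+\|R_4\|\big).\end{aligned}$$ Theorem. A Friedrichs constant exists. Problem I has an optimal pair $(y,u)=(y(u),u)$, and it is unique (up to equality almost everywhere). A pair $(y,u)$ is optimal if and only if there is a $p=p(u)$ such that $(y,p)$ solves the optimality system and $u=-\lambda^{-1}p$. In this case $y(u),p(u)\in H^{1,1}_{0,per}(Q)$ and $\nu\nabla y(u),\nu\nabla p(u)\in H(\mathrm{div},Q)$, and for every Friedrichs constant $C_F$ $$\sup_{\substack{\eta,\zeta\in H^{1,1}_{0,per}(Q)\\ \boldsymbol\tau,\boldsymbol\rho\in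 H(\mathrm{div},Q)}}\mathcal J^\ominus(\eta,\zeta,\boldsymbol\tau,\boldsymbol\rho)=\mathcal J(y(u),u),$$ and the supremum is attained at $\eta=y(u)$, $\zeta=p(u)$, $\boldsymbol\tau=\nu\nabla y(u)$, $\boldsymbol\rho=\nu\nabla p(u)$. -/

import Mathlib

open MeasureTheory Set
open scoped ContDiff

noncomputable section

namespace TimePeriodic

/-- The space `ℝ^d` with its Euclidean norm. -/
abbrev Sp (d : ℕ) : Type := EuclideanSpace ℝ (Fin d)

variable {d : ℕ}

/-- The space-time cylinder `Q = Ω × (0,T)`. -/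
def cyl (Ω : Set (Sp d)) (T : ℝ) : Set (Sp d × ℝ) := Ω ×ˢ Ioo 0 T

/-- Lebesgue measure on `Q`. -/
def muQ (Ω : Set (Sp d)) (T : ℝ) : Measure (Sp d × ℝ) := volume.restrict (cyl Ω T)

/-- `f ∈ L²(Q)` (scalar- or vector-valued). -/
def MemL2 {F : Type*} [NormedAddCommGroup F] (Ω : Set (Sp d)) (T : ℝ)
    (f : Sp d × ℝ → F) : Prop :=
  MemLp f 2 (muQ Ω T)

/-- The norm `‖f‖` of `L²(Q)`; it is only applied to functions in `L²(Q)`. -/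
def normQ {F : Type*} [NormedAddCommGroup F] (Ω : Set (Sp d)) (T : ℝ)
    (f : Sp d × ℝ → F) : ℝ :=
  Real.sqrt (∫ z, ‖f z‖ ^ 2 ∂(muQ Ω T))

/-! ### Weak derivatives on `Q` -/

/-- Test functions `φ ∈ C_c^∞(Q)`. -/
def IsTest (Ω : Set (Sp d)) (T : ℝ) (φ : Sp d × ℝ → ℝ) : Prop :=
  ContDiff ℝ ∞ φ ∧ HasCompactSupport φ ∧ tsupport φ ⊆ cyl Ω T

/-- The classical spatial gradient of a differentiable function of `(x,t)`. -/
def gradX (φ : Sp d × ℝ → ℝ) (z : Sp d × ℝ) : Sp d :=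
  WithLp.toLp 2 fun i => fderiv ℝ φ z (EuclideanSpace.single i 1, 0)

/-- The classical time derivative of a differentiable function of `(x,t)`. -/
def derivT (φ : Sp d × ℝ → ℝ) (z : Sp d × ℝ) : ℝ :=
  fderiv ℝ φ z (0, 1)

/-- `g ∈ [L²(Q)]^d` is the weak spatial gradient of `u` on `Q`. -/
def IsWeakGrad (Ω : Set (Sp d)) (T : ℝ) (u : Sp d × ℝ → ℝ) (g : Sp d × ℝ → Sp d) : Prop :=
  MemL2 Ω T g ∧ ∀ φ, IsTest Ω T φ → ∀ i : Fin d,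
    ∫ z, u z * gradX φ z i ∂(muQ Ω T) = - ∫ z, g z i * φ z ∂(muQ Ω T)

/-- `g ∈ L²(Q)` is the weak time derivative of `u` on `Q`. -/
def IsWeakDt (Ω : Set (Sp d)) (T : ℝ) (u g : Sp d × ℝ → ℝ) : Prop :=
  MemL2 Ω T g ∧ ∀ φ, IsTest Ω T φ →
    ∫ z, u z * derivT φ z ∂(muQ Ω T) = - ∫ z, g z * φ z ∂(muQ Ω T)

/-- `g ∈ L²(Q)` is the weak spatial divergence of `τ` on `Q`. -/
def IsWeakDiv (Ω : Set (Sp d)) (T : ℝ) (τ : Sp d × ℝ → Sp d) (g : Sp d × ℝ → ℝ) : Prop :=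
  MemL2 Ω T g ∧ ∀ φ, IsTest Ω T φ →
    ∫ z, inner ℝ (τ z) (gradX φ z) ∂(muQ Ω T) = - ∫ z, g z * φ z ∂(muQ Ω T)

open Classical in
/-- The weak spatial gradient `∇u` (unique almost everywhere; `0` if there is none in `L²`). -/
def weakGrad (Ω : Set (Sp d)) (T : ℝ) (u : Sp d × ℝ → ℝ) : Sp d × ℝ → Sp d :=
  if h : ∃ g, IsWeakGrad Ω T u g then h.choose else 0

open Classical in
/-- The weak time derivative `∂ₜu` (unique almost everywhere; `0` if there is none in `L²`). -/
def weakDt (Ω : Set (Sp d)) (T : ℝ) (u : Sp d × ℝ → ℝ) : Sp d × ℝ → ℝ :=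
  if h : ∃ g, IsWeakDt Ω T u g then h.choose else 0

open Classical in
/-- The weak spatial divergence `∇·τ` (unique almost everywhere; `0` if there is none in `L²`). -/
def weakDiv (Ω : Set (Sp d)) (T : ℝ) (τ : Sp d × ℝ → Sp d) : Sp d × ℝ → ℝ :=
  if h : ∃ g, IsWeakDiv Ω T τ g then h.choose else 0

/-! ### Function spaces -/

/-- `u ∈ H^{1,0}(Q)`. -/
def MemH10 (Ω : Set (Sp d)) (T : ℝ) (u : Sp d × ℝ → ℝ) : Prop :=
  MemL2 Ω T u ∧ ∃ g, IsWeakGrad Ω T u g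

/-- `u ∈ H^{1,0}_0(Q)`, that is `u ∈ H^{1,0}(Q)` and `u = 0` on `Σ = ∂Ω × (0,T)`: in the norm of
`H^{1,0}(Q)` the function `u` is a limit of smooth functions that vanish near `∂Ω × ℝ`. -/
def MemH10Zero (Ω : Set (Sp d)) (T : ℝ) (u : Sp d × ℝ → ℝ) : Prop :=
  MemH10 Ω T u ∧ ∀ ε : ℝ, 0 < ε → ∃ φ : Sp d × ℝ → ℝ,
    ContDiff ℝ ∞ φ ∧ HasCompactSupport φ ∧ tsupport φ ⊆ Ω ×ˢ univ ∧
    normQ Ω T (fun z => u z - φ z) < ε ∧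
    normQ Ω T (fun z => weakGrad Ω T u z - gradX φ z) < ε

/-- `u(0) = u(T)` in `Ω`: for almost every `x` the function `u(x,·)` has a continuous
representative on `[0,T]` with equal values at the two end points. -/
def PeriodicInTime (Ω : Set (Sp d)) (T : ℝ) (u : Sp d × ℝ → ℝ) : Prop :=
  ∀ᵐ x ∂(volume.restrict Ω), ∃ v : ℝ → ℝ, ContinuousOn v (Icc 0 T) ∧
    (∀ᵐ t ∂(volume.restrict (Ioo 0 T)), u (x, t) = v t) ∧ v 0 = v T

/-- `u ∈ H^{1,1}_{0,per}(Q)`. -/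
def MemH11ZeroPer (Ω : Set (Sp d)) (T : ℝ) (u : Sp d × ℝ → ℝ) : Prop :=
  MemH10Zero Ω T u ∧ (∃ g, IsWeakDt Ω T u g) ∧ PeriodicInTime Ω T u

/-- `τ ∈ H(div,Q)`. -/
def MemHdiv (Ω : Set (Sp d)) (T : ℝ) (τ : Sp d × ℝ → Sp d) : Prop :=
  MemL2 Ω T τ ∧ ∃ g, IsWeakDiv Ω T τ g

/-- The frequency `ω = 2π/T`. -/
def freq (T : ℝ) : ℝ := 2 * Real.pi / T

/-- The Fourier coefficient `u_k^c` in time (used for `k ≥ 1`). -/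
def coefC (T : ℝ) (u : Sp d × ℝ → ℝ) (k : ℕ) (x : Sp d) : ℝ :=
  2 / T * ∫ t in (0 : ℝ)..T, u (x, t) * Real.cos (k * freq T * t)

/-- The Fourier coefficient `u_k^s` in time (used for `k ≥ 1`). -/
def coefS (T : ℝ) (u : Sp d × ℝ → ℝ) (k : ℕ) (x : Sp d) : ℝ :=
  2 / T * ∫ t in (0 : ℝ)..T, u (x, t) * Real.sin (k * freq T * t)

/-- `‖∂ₜ^{1/2} u‖ < ∞`: the series `∑ k ω ‖u_k‖²` converges (the term `k = 0` vanishes). -/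
def HasHalfDt (Ω : Set (Sp d)) (T : ℝ) (u : Sp d × ℝ → ℝ) : Prop :=
  Summable fun k : ℕ =>
    (k : ℝ) * freq T * ∫ x in Ω, (coefC T u k x ^ 2 + coefS T u k x ^ 2)

/-- `u ∈ H^{1,1/2}_{0,per}(Q)`. -/
def MemHhalfZeroPer (Ω : Set (Sp d)) (T : ℝ) (u : Sp d × ℝ → ℝ) : Prop :=
  MemH10Zero Ω T u ∧ HasHalfDt Ω T u

/-- The form `∫_Q σ ∂ₜ^{1/2}u ∂ₜ^{1/2}v^⊥ = (T/2) ∑_{k≥1} k ω ⟨σ u_k, v_k^⊥⟩_Ω`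
with `v_k^⊥ = (-v_k^s, v_k^c)` (the term `k = 0` vanishes). -/
def halfPerp (Ω : Set (Sp d)) (T : ℝ) (σ : Sp d → ℝ) (u v : Sp d × ℝ → ℝ) : ℝ :=
  T / 2 * ∑' k : ℕ, (k : ℝ) * freq T *
    ∫ x in Ω, σ x * (coefC T u k x * (- coefS T v k x) + coefS T u k x * coefC T v k x)

/-! ### The optimal control problem -/

/-- The cost functional `𝒥(y,u)`. -/
def cost (Ω : Set (Sp d)) (T lam : ℝ) (yd y u : Sp d × ℝ → ℝ) : ℝ :=
  1 / 2 * normQ Ω T (fun z => y z - yd z) ^ 2 + lam / 2 * normQ Ω T u ^ 2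

/-- `y = y(u)`: weak solution of `σ ∂ₜy - ∇·(ν∇y) = u` in `Q`, `y = 0` on `Σ`, `y(0) = y(T)`. -/
def IsState (Ω : Set (Sp d)) (T : ℝ) (σ ν : Sp d → ℝ) (u y : Sp d × ℝ → ℝ) : Prop :=
  MemHhalfZeroPer Ω T y ∧ ∀ q, MemHhalfZeroPer Ω T q →
    ∫ z, ν z.1 * inner ℝ (weakGrad Ω T y z) (weakGrad Ω T q z) ∂(muQ Ω T)
      + halfPerp Ω T σ y q
      = ∫ z, u z * q z ∂(muQ Ω T)

/-- `u ∈ L²(Q)` is an optimal control and `y = y(u)` its state. -/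
def IsOptimal (Ω : Set (Sp d)) (T : ℝ) (σ ν : Sp d → ℝ) (lam : ℝ)
    (yd y u : Sp d × ℝ → ℝ) : Prop :=
  MemL2 Ω T u ∧ IsState Ω T σ ν u y ∧
    ∀ z v, MemL2 Ω T v → IsState Ω T σ ν v z →
      cost Ω T lam yd y u ≤ cost Ω T lam yd z v

/-- `(y,p)` solves the optimality system in weak form. -/
def SolvesKKT (Ω : Set (Sp d)) (T : ℝ) (σ ν : Sp d → ℝ) (lam : ℝ)
    (yd y p : Sp d × ℝ → ℝ) : Prop :=
  MemHhalfZeroPer Ω T y ∧ MemHhalfZeroPer Ω T p ∧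
  (∀ z, MemHhalfZeroPer Ω T z →
    ∫ s, (y s * z s - ν s.1 * inner ℝ (weakGrad Ω T p s) (weakGrad Ω T z s)) ∂(muQ Ω T)
      + halfPerp Ω T σ p z
      = ∫ s, yd s * z s ∂(muQ Ω T)) ∧
  (∀ q, MemHhalfZeroPer Ω T q →
    ∫ s, (ν s.1 * inner ℝ (weakGrad Ω T y s) (weakGrad Ω T q s)
        + lam⁻¹ * p s * q s) ∂(muQ Ω T)
      + halfPerp Ω T σ y q = 0)

/-- `C > 0` is a Friedrichs constant: `‖u‖ ≤ C ‖∇u‖` for all `u ∈ H^{1,0}_0(Q)`. -/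
def IsFriedrichsConst (Ω : Set (Sp d)) (T C : ℝ) : Prop :=
  0 < C ∧ ∀ u, MemH10Zero Ω T u → normQ Ω T u ≤ C * normQ Ω T (weakGrad Ω T u)

/-! ### The minorant -/

/-- `R₁(η,τ,v) = σ ∂ₜη - ∇·τ - v`. -/
def res1 (Ω : Set (Sp d)) (T : ℝ) (σ : Sp d → ℝ) (η : Sp d × ℝ → ℝ)
    (τ : Sp d × ℝ → Sp d) (v : Sp d × ℝ → ℝ) (z : Sp d × ℝ) : ℝ :=
  σ z.1 * weakDt Ω T η z - weakDiv Ω T τ z - v z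

/-- `R₂(η,τ) = τ - ν∇η`; also `R₄(ζ,ρ) = ρ - ν∇ζ`. -/
def resFlux (Ω : Set (Sp d)) (T : ℝ) (ν : Sp d → ℝ) (η : Sp d × ℝ → ℝ)
    (τ : Sp d × ℝ → Sp d) (z : Sp d × ℝ) : Sp d :=
  τ z - ν z.1 • weakGrad Ω T η z

/-- `R₃(ζ,ρ,η) = η - y_d + ∇·ρ + σ ∂ₜζ`. -/
def res3 (Ω : Set (Sp d)) (T : ℝ) (σ : Sp d → ℝ) (yd ζ : Sp d × ℝ → ℝ)
    (ρ : Sp d × ℝ → Sp d) (η : Sp d × ℝ → ℝ) (z : Sp d × ℝ) : ℝ :=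
  η z - yd z + weakDiv Ω T ρ z + σ z.1 * weakDt Ω T ζ z

/-- `μ₁ = min{ν₀, σ₀} / √2`, where `ν₀`, `σ₀` are the lower bounds of `ν` and `σ`. -/
def mu1 (ν₀ σ₀ : ℝ) : ℝ := 1 / Real.sqrt 2 * min ν₀ σ₀

/-- The minorant `𝒥^⊖(η,ζ,τ,ρ)`; `CF` is the Friedrichs constant and `m` stands for `μ₁`. -/
def minorant (Ω : Set (Sp d)) (T : ℝ) (σ ν : Sp d → ℝ) (lam CF m : ℝ)
    (yd η ζ : Sp d × ℝ → ℝ) (τ ρ : Sp d × ℝ → Sp d) : ℝ :=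
  1 / 2 * normQ Ω T (fun z => η z - yd z) ^ 2 + 1 / (2 * lam) * normQ Ω T ζ ^ 2
  - ∫ z, (ν z.1 * inner ℝ (weakGrad Ω T η z) (weakGrad Ω T ζ z)
      + σ z.1 * weakDt Ω T η z * ζ z + lam⁻¹ * ζ z ^ 2) ∂(muQ Ω T)
  - CF ^ 2 / (m ^ 2 * lam) *
      (CF * normQ Ω T (res3 Ω T σ yd ζ ρ η) + normQ Ω T (resFlux Ω T ν ζ ρ)) ^ 2
  - 1 / m *
      (CF * normQ Ω T (res1 Ω T σ η τ (fun z => - lam⁻¹ * ζ z)) + normQ Ω T (resFlux Ω T ν η τ)) *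
      (CF * normQ Ω T (res3 Ω T σ yd ζ ρ η) + normQ Ω T (resFlux Ω T ν ζ ρ))

end TimePeriodic

end

open TimePeriodic

open Filter Topology
open scoped RealInnerProductSpace ENNReal

noncomputable section

/-! Everything reduces to one solution of the optimality system whose time derivatives lie in L²(Q).
The coefficients σ, ν depend on x only, so the time derivative commutes with multiplication by them
and is skew with respect to both weights. It is replaced by `truncDt`, the derivative of the first N
Fourier modes in time: a bounded skew operator on L²(Q) that commutes with these multiplications and
preserves the energy space, a closed set of pairs (u, ∇u). For fixed N the coupled system is
coercive (`exists_coupled_solution`). Testing with the solution bounds ∇y and ∇p uniformly in N;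
testing with the truncated derivative of the solution kills the diffusion term, by skewness, and
bounds the truncated derivatives in L². Weak limits give `exists_regular_solution`.

The derivative found in this way is known through its Fourier coefficients (`IsPeriodicDt`).
Parseval turns b_σ(u,v) into ∫ σ ∂ₜu v, and slicing in x shows that the coefficient relations amount
to a weak time derivative in L² together with u(0) = u(T).

If (y,p) solves the optimality system, the cost of any admissible pair (z,v) equals the cost of (y,
-p/λ) plus ½‖z-y‖² + λ/2‖v+p/λ‖² (`SolvesKKT.cost_eq`). Optimality, uniqueness of the optimal pair
and uniqueness for the optimality system all follow, so every weak solution agrees almost everywhere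
with the regular one and inherits its regularity.

The first line of the minorant is the Lagrangian at (η,ζ). With e = y-η and f = p-ζ, its expansion
around (y,p) is the optimal value minus the adjoint residual applied to e, minus ½‖e‖² and
1/(2λ)‖f‖². The residual costs at most (C_F‖R₃‖+‖R₄‖)‖∇e‖; the error equation of the state gives
ν₀‖∇e‖ ≤ λ⁻¹C_F‖f‖ + C_F‖R₁‖+‖R₂‖; and Young's inequality absorbs ‖f‖ into 1/(2λ)‖f‖². What remains
is dominated by the two penalty terms (`lagrangian_sub_residuals_le`). At the exact solution the
residuals vanish and the state equation tested with p reduces the Lagrangian to the cost. -/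

namespace TimePeriodic

/-! ### Hilbert space core: coercive systems, weak limits, the Lagrangian -/

section Abstract

variable {V H G : Type*}
  [NormedAddCommGroup V] [InnerProductSpace ℝ V]
  [NormedAddCommGroup H] [InnerProductSpace ℝ H]
  [NormedAddCommGroup G] [InnerProductSpace ℝ G]

/-- A bounded sequence in a Hilbert space converges weakly along a free ultrafilter. -/
theorem exists_weak_limit [CompleteSpace H] (u : ℕ → H) {C : ℝ} (hu : ∀ n, ‖u n‖ ≤ C) :
    ∃ a : H, ∀ w : H, Tendsto (fun n => ⟪u n, w⟫) (hyperfilter ℕ : Filter ℕ) (𝓝 ⟪a, w⟫) := by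
  have hb : ∀ n w, |⟪u n, w⟫| ≤ C * ‖w‖ := fun n w =>
    (abs_real_inner_le_norm _ _).trans (mul_le_mul_of_nonneg_right (hu n) (norm_nonneg w))
  -- Along an ultrafilter every bounded real sequence converges, so no subsequence is extracted; the
  -- limits are linear in w, and Riesz represents them.
  have hlim : ∀ w : H, ∃ r : ℝ, Tendsto (fun n => ⟪u n, w⟫) (hyperfilter ℕ : Filter ℕ) (𝓝 r) := by
    intro w
    have hc : IsCompact (Icc (-(C * ‖w‖)) (C * ‖w‖)) := isCompact_Icc
    have := hc.ultrafilter_le_nhds ((hyperfilter ℕ).map fun n => ⟪u n, w⟫) ?_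
    · obtain ⟨r, -, hr⟩ := this
      exact ⟨r, hr⟩
    · rw [le_principal_iff]
      exact Filter.mem_map.2 (Filter.Eventually.of_forall fun n => abs_le.1 (hb n w))
  choose ℓ hℓ using hlim
  let L : H →ₗ[ℝ] ℝ :=
    { toFun := ℓ
      map_add' := fun x y => tendsto_nhds_unique (hℓ (x + y)) <| by
        simpa only [inner_add_right] using (hℓ x).add (hℓ y)
      map_smul' := fun c x => tendsto_nhds_unique (hℓ (c • x)) <| by
        simpa only [inner_smul_right, RingHom.id_apply, smul_eq_mul] using (hℓ x).const_mul c }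
  have hL : ∀ w, ‖L w‖ ≤ C * ‖w‖ := fun w =>
    le_of_tendsto (hℓ w).norm (Filter.Eventually.of_forall fun n => hb n w)
  refine ⟨(InnerProductSpace.toDual ℝ H).symm (L.mkContinuous C hL), fun w => ?_⟩
  rw [InnerProductSpace.toDual_symm_apply]
  exact hℓ w

theorem tendsto_inner_map [CompleteSpace H] [CompleteSpace G] {ι : Type*} {l : Filter ι} (A : H →L[ℝ] G) (u : ι → H) (a : H)
    (h : ∀ w, Tendsto (fun n => ⟪u n, w⟫) l (𝓝 ⟪a, w⟫)) (w : G) :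
    Tendsto (fun n => ⟪A (u n), w⟫) l (𝓝 ⟪A a, w⟫) := by
  simpa only [ContinuousLinearMap.adjoint_inner_right] using h (ContinuousLinearMap.adjoint A w)

/-- Lax–Milgram on V × V. The form `B` is minus the first equation tested with the second component,
plus `lam` times the second equation tested with the first. With these signs and weights the
coupling terms cancel on the diagonal and K drops out by skewness, which leaves only the two
diffusion terms. -/
theorem exists_coupled_solution [CompleteSpace V] (j : V →L[ℝ] H) (gr : V →L[ℝ] G) (M : G →L[ℝ] G) (K : H →L[ℝ] H)
    {ν₀ C lam : ℝ} (hν₀ : 0 < ν₀) (hlam : 0 < lam)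
    (hM : ∀ x, ν₀ * ‖x‖ ^ 2 ≤ ⟪M x, x⟫) (hK : ∀ h, ⟪K h, h⟫ = 0)
    (hC : 0 < C) (hV : ∀ v, ‖v‖ ≤ C * ‖gr v‖) (b : H) :
    ∃ y p : V,
      (∀ z, ⟪j y, j z⟫ - ⟪M (gr p), gr z⟫ + ⟪K (j p), j z⟫ = ⟪b, j z⟫) ∧
      (∀ q, ⟪M (gr y), gr q⟫ + lam⁻¹ * ⟪j p, j q⟫ + ⟪K (j y), j q⟫ = 0) := by
  let X := WithLp 2 (V × V)
  let P1 : X →L[ℝ] V := WithLp.fstL 2 ℝ V V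
  let P2 : X →L[ℝ] V := WithLp.sndL 2 ℝ V V
  let f (a c : X →L[ℝ] H) : X →L[ℝ] X →L[ℝ] ℝ := (innerSL ℝ).bilinearComp a c
  let g (a c : X →L[ℝ] G) : X →L[ℝ] X →L[ℝ] ℝ := (innerSL ℝ).bilinearComp a c
  let B : X →L[ℝ] X →L[ℝ] ℝ :=
    g (M.comp (gr.comp P2)) (gr.comp P2) - f (K.comp (j.comp P2)) (j.comp P2)
      - f (j.comp P1) (j.comp P2) + lam • g (M.comp (gr.comp P1)) (gr.comp P1)
      + f (j.comp P2) (j.comp P1) + lam • f (K.comp (j.comp P1)) (j.comp P1)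
  have hB : ∀ x x' : X, B x x' = ⟪M (gr x.snd), gr x'.snd⟫ - ⟪K (j x.snd), j x'.snd⟫
      - ⟪j x.fst, j x'.snd⟫ + lam * ⟪M (gr x.fst), gr x'.fst⟫ + ⟪j x.snd, j x'.fst⟫
      + lam * ⟪K (j x.fst), j x'.fst⟫ := fun x x' => rfl
  have hco : IsCoercive B := by
    -- The quotient ν₀ / C² comes from ‖v‖ ≤ C‖gr v‖; `min 1 lam` accounts for the weights 1 and
    -- `lam` of the two equations.
    refine ⟨min 1 lam * ν₀ / C ^ 2, by positivity, fun x => ?_⟩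
    have h1 : B x x = ⟪M (gr x.snd), gr x.snd⟫ + lam * ⟪M (gr x.fst), gr x.fst⟫ := by
      rw [hB, hK, hK, real_inner_comm (j x.fst) (j x.snd)]; ring
    have h2 : ∀ v : V, ν₀ / C ^ 2 * ‖v‖ ^ 2 ≤ ⟪M (gr v), gr v⟫ := fun v => by
      refine le_trans ?_ (hM (gr v))
      have : ‖v‖ ^ 2 ≤ C ^ 2 * ‖gr v‖ ^ 2 := by
        rw [← mul_pow]; exact pow_le_pow_left₀ (norm_nonneg _) (hV v) 2
      calc ν₀ / C ^ 2 * ‖v‖ ^ 2 ≤ ν₀ / C ^ 2 * (C ^ 2 * ‖gr v‖ ^ 2) := by gcongr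
        _ = ν₀ * ‖gr v‖ ^ 2 := by field_simp
    have h3 : ‖x‖ * ‖x‖ = ‖x.fst‖ ^ 2 + ‖x.snd‖ ^ 2 := by
      rw [← sq, WithLp.prod_norm_sq_eq_of_L2]
    have h4 := h2 x.fst
    have h5 := h2 x.snd
    have hm1 : min 1 lam ≤ 1 := min_le_left _ _
    have hm2 : min 1 lam ≤ lam := min_le_right _ _
    have hc : 0 ≤ ν₀ / C ^ 2 := by positivity
    rw [mul_assoc, h3, h1]
    calc min 1 lam * ν₀ / C ^ 2 * (‖x.fst‖ ^ 2 + ‖x.snd‖ ^ 2)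
        = min 1 lam * (ν₀ / C ^ 2 * ‖x.snd‖ ^ 2) + min 1 lam * (ν₀ / C ^ 2 * ‖x.fst‖ ^ 2) := by
          ring
      _ ≤ 1 * (ν₀ / C ^ 2 * ‖x.snd‖ ^ 2) + lam * (ν₀ / C ^ 2 * ‖x.fst‖ ^ 2) := by gcongr
      _ ≤ _ := by rw [one_mul]; gcongr
  let F : X →L[ℝ] ℝ := -((innerSL ℝ b).comp (j.comp P2))
  let f₀ : X := (InnerProductSpace.toDual ℝ X).symm F
  let x := hco.continuousLinearEquivOfBilin.symm f₀
  have hx : ∀ w : X, B x w = -⟪b, j w.snd⟫ := fun w => by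
    rw [← hco.continuousLinearEquivOfBilin_apply]
    change ⟪hco.continuousLinearEquivOfBilin (hco.continuousLinearEquivOfBilin.symm f₀), w⟫ = _
    rw [ContinuousLinearEquiv.apply_symm_apply, InnerProductSpace.toDual_symm_apply]
    rfl
  refine ⟨x.fst, x.snd, fun z => ?_, fun q => ?_⟩
  · have h := hx (WithLp.toLp 2 (0, z))
    rw [hB] at h
    have h0 : ∀ a : H, ⟪a, j 0⟫ = 0 := fun a => by rw [map_zero, inner_zero_right]
    have h0' : ∀ a : G, ⟪a, gr 0⟫ = 0 := fun a => by rw [map_zero, inner_zero_right]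
    have e1 : (WithLp.toLp 2 ((0 : V), z)).fst = 0 := rfl
    have e2 : (WithLp.toLp 2 ((0 : V), z)).snd = z := rfl
    rw [e1, e2, h0, h0, h0'] at h
    linarith
  · have h := hx (WithLp.toLp 2 (q, 0))
    rw [hB] at h
    have h0 : ∀ a : H, ⟪a, j 0⟫ = 0 := fun a => by rw [map_zero, inner_zero_right]
    have h0' : ∀ a : G, ⟪a, gr 0⟫ = 0 := fun a => by rw [map_zero, inner_zero_right]
    have e1 : (WithLp.toLp 2 (q, (0 : V))).fst = q := rfl
    have e2 : (WithLp.toLp 2 (q, (0 : V))).snd = 0 := rfl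
    rw [e1, e2, h0, h0, h0, h0'] at h
    have h' : lam * (⟪M (gr x.fst), gr q⟫ + lam⁻¹ * ⟪j x.snd, j q⟫ + ⟪K (j x.fst), j q⟫) = 0 := by
      rw [mul_add, mul_add, ← mul_assoc, mul_inv_cancel₀ hlam.ne']
      linarith
    exact (mul_eq_zero.1 h').resolve_left hlam.ne'

/-- The optimality system with a skew operator that is a limit of bounded skew operators. -/
theorem exists_coupled_solution_limit [CompleteSpace V] [CompleteSpace H] [CompleteSpace G]
    (j : V →L[ℝ] H) (gr : V →L[ℝ] G) (M : G →L[ℝ] G)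
    (S : H →L[ℝ] H) (D : ℕ → H →L[ℝ] H) (D' : ℕ → G →L[ℝ] G)
    {σ₀ ν₀ C lam : ℝ} (hσ₀ : 0 < σ₀) (hν₀ : 0 < ν₀) (hlam : 0 < lam)
    (hM : ∀ x, ν₀ * ‖x‖ ^ 2 ≤ ⟪M x, x⟫) (hS : ∀ h, σ₀ * ‖h‖ ^ 2 ≤ ⟪S h, h⟫)
    (hD : ∀ n h k, ⟪D n h, k⟫ = - ⟪h, D n k⟫)
    (hSD : ∀ n h, ⟪S (D n h), h⟫ = 0) (hMD : ∀ n x, ⟪M x, D' n x⟫ = 0)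
    (hDV : ∀ n v, ∃ w : V, j w = D n (j v) ∧ gr w = D' n (gr v))
    (hC : 0 < C) (hV : ∀ v, ‖v‖ ≤ C * ‖gr v‖) (hj : ∀ v, ‖j v‖ ≤ ‖v‖) (b : H) :
    ∃ (y p : V) (gy gp : H),
      (∀ z, ⟪j y, j z⟫ - ⟪M (gr p), gr z⟫ + ⟪S gp, j z⟫ = ⟪b, j z⟫) ∧
      (∀ q, ⟪M (gr y), gr q⟫ + lam⁻¹ * ⟪j p, j q⟫ + ⟪S gy, j q⟫ = 0) ∧
      (∀ e e', (∀ᶠ n in atTop, D n e = e') → ⟪gy, e⟫ = - ⟪j y, e'⟫ ∧ ⟪gp, e⟫ = - ⟪j p, e'⟫) := by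
  have hex := fun n => exists_coupled_solution (lam := lam) j gr M (S.comp (D n)) hν₀ hlam hM
    (hSD n) hC hV b
  choose y p h1 h2 using hex
  simp only [ContinuousLinearMap.comp_apply] at h1 h2
  -- Energy estimate: the first equation is tested with p and the second with y. The skew terms
  -- vanish, and eliminating ⟨j y, j p⟩ leaves two nonnegative terms against b.
  have hsum : ∀ n, ν₀ * ‖gr (p n)‖ ^ 2 + lam * (ν₀ * ‖gr (y n)‖ ^ 2)
      ≤ ‖b‖ * (C * ‖gr (p n)‖) := fun n => by
    have e1 := h1 n (p n)
    have e2 := h2 n (y n)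
    rw [hSD] at e1 e2
    have e3 := hM (gr (p n))
    have e4 := mul_le_mul_of_nonneg_left (hM (gr (y n))) hlam.le
    have e5 : lam * ⟪M (gr (y n)), gr (y n)⟫ = - ⟪j (p n), j (y n)⟫ := by
      have : lam * (⟪M (gr (y n)), gr (y n)⟫ + lam⁻¹ * ⟪j (p n), j (y n)⟫) = 0 := by
        rw [← add_zero (⟪M (gr (y n)), gr (y n)⟫ + _), e2, mul_zero]
      rw [mul_add, ← mul_assoc, mul_inv_cancel₀ hlam.ne'] at this
      linarith
    have e6 : -⟪b, j (p n)⟫ ≤ ‖b‖ * (C * ‖gr (p n)‖) :=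
      (neg_le_abs _).trans <| (abs_real_inner_le_norm _ _).trans <|
        mul_le_mul_of_nonneg_left ((hj _).trans (hV _)) (norm_nonneg _)
    rw [real_inner_comm (j (y n))] at e5
    linarith
  have hp : ∀ n, ‖gr (p n)‖ ≤ ‖b‖ * C / ν₀ := fun n => by
    rw [le_div_iff₀ hν₀]
    rcases (norm_nonneg (gr (p n))).eq_or_lt with h0 | h0
    · rw [← h0, zero_mul]; positivity
    · have : 0 ≤ lam * (ν₀ * ‖gr (y n)‖ ^ 2) := by positivity
      have := hsum n
      nlinarith
  have hy : ∀ n, ‖gr (y n)‖ ≤ Real.sqrt (‖b‖ * (C * (‖b‖ * C / ν₀)) / (lam * ν₀)) := fun n => by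
    refine Real.le_sqrt_of_sq_le ?_
    rw [le_div_iff₀ (by positivity)]
    have a1 : 0 ≤ ν₀ * ‖gr (p n)‖ ^ 2 := by positivity
    have a2 : ‖b‖ * (C * ‖gr (p n)‖) ≤ ‖b‖ * (C * (‖b‖ * C / ν₀)) := by
      have := hp n
      gcongr
    have := hsum n
    linarith
  set Cp := C * (‖b‖ * C / ν₀)
  set Cy := C * Real.sqrt (‖b‖ * (C * (‖b‖ * C / ν₀)) / (lam * ν₀))
  have hp' : ∀ n, ‖p n‖ ≤ Cp := fun n => (hV _).trans (mul_le_mul_of_nonneg_left (hp n) hC.le)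
  have hy' : ∀ n, ‖y n‖ ≤ Cy := fun n => (hV _).trans (mul_le_mul_of_nonneg_left (hy n) hC.le)
  -- Used with h a truncated time derivative: coercivity of S turns an equation tested with h itself
  -- into a norm bound.
  have key : ∀ (h c : H) (r : ℝ), ⟪S h, h⟫ = ⟪c, h⟫ → ‖c‖ ≤ r → ‖h‖ ≤ r / σ₀ := fun h c r e hr => by
    rw [le_div_iff₀ hσ₀]
    have h1 := hS h
    have h2 := real_inner_le_norm c h
    rcases (norm_nonneg h).eq_or_lt with h0 | h0
    · rw [← h0, zero_mul]; exact (norm_nonneg c).trans hr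
    · refine le_trans ?_ hr
      rw [e] at h1
      nlinarith
  -- The test function is the truncated derivative of p, which lies in V by `hDV`; the diffusion
  -- term disappears by `hMD`.
  have hDp : ∀ n, ‖D n (j (p n))‖ ≤ (‖b‖ + Cy) / σ₀ := fun n => by
    obtain ⟨w, hw1, hw2⟩ := hDV n (p n)
    have e := h1 n w
    rw [hw1, hw2, hMD] at e
    refine key _ (b - j (y n)) _ ?_ ((norm_sub_le _ _).trans ?_)
    · rw [inner_sub_left]; linarith
    · have := (hj _).trans (hy' n)
      linarith
  have hDy : ∀ n, ‖D n (j (y n))‖ ≤ lam⁻¹ * Cp / σ₀ := fun n => by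
    obtain ⟨w, hw1, hw2⟩ := hDV n (y n)
    have e := h2 n w
    rw [hw1, hw2, hMD] at e
    refine key _ (-(lam⁻¹ • j (p n))) _ ?_ ?_
    · rw [inner_neg_left, inner_smul_left]
      simp only [conj_trivial]
      linarith
    · rw [norm_neg, norm_smul, Real.norm_of_nonneg (by positivity)]
      exact mul_le_mul_of_nonneg_left ((hj _).trans (hp' n)) (by positivity)
  obtain ⟨y₀, hy₀⟩ := exists_weak_limit y hy'
  obtain ⟨p₀, hp₀⟩ := exists_weak_limit p hp'
  obtain ⟨gy, hgy⟩ := exists_weak_limit _ hDy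
  obtain ⟨gp, hgp⟩ := exists_weak_limit _ hDp
  refine ⟨y₀, p₀, gy, gp, fun z => ?_, fun q => ?_, fun e e' he => ⟨?_, ?_⟩⟩
  · refine tendsto_nhds_unique (((tendsto_inner_map j y y₀ hy₀ (j z)).sub
      (tendsto_inner_map (M.comp gr) p p₀ hp₀ (gr z))).add (tendsto_inner_map S _ gp hgp (j z))) ?_
    refine tendsto_const_nhds.congr fun n => ?_
    exact (h1 n z).symm
  · refine tendsto_nhds_unique (((tendsto_inner_map (M.comp gr) y y₀ hy₀ (gr q)).add
      ((tendsto_inner_map j p p₀ hp₀ (j q)).const_mul lam⁻¹)).add (tendsto_inner_map S _ gy hgy (j q))) ?_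
    refine tendsto_const_nhds.congr fun n => ?_
    exact (h2 n q).symm
  -- By skewness ⟨D n (j y), e⟩ = -⟨j y, D n e⟩. Since D n e is eventually the fixed vector e', weak
  -- convergence of y suffices.
  · refine tendsto_nhds_unique (hgy e) (((tendsto_inner_map j y y₀ hy₀ e').neg).congr' ?_)
    filter_upwards [Nat.hyperfilter_le_atTop he] with n hn
    rw [hD, ← hn]
  · refine tendsto_nhds_unique (hgp e) (((tendsto_inner_map j p p₀ hp₀ e').neg).congr' ?_)
    filter_upwards [Nat.hyperfilter_le_atTop he] with n hn
    rw [hD, ← hn]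

/-- Expansion of the Lagrangian around its saddle point. -/
theorem lagrangian_expansion (j : V →L[ℝ] H) (gr : V →L[ℝ] G) (M : G →L[ℝ] G)
    (S : H →L[ℝ] H) {lam : ℝ} (hlam : 0 < lam)
    (hMs : ∀ x x', ⟪M x, x'⟫ = ⟪M x', x⟫) {y p η ζ : V} {gy gη gζ b : H}
    (h2 : ∀ q, ⟪M (gr y), gr q⟫ + lam⁻¹ * ⟪j p, j q⟫ + ⟪S gy, j q⟫ = 0)
    (hζy : ⟪S gζ, j y⟫ = - ⟪S gy, j ζ⟫) (hζη : ⟪S gζ, j η⟫ = - ⟪S gη, j ζ⟫) :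
    1 / 2 * ‖j η - b‖ ^ 2 + 1 / (2 * lam) * ‖j ζ‖ ^ 2
      - (⟪M (gr η), gr ζ⟫ + ⟪S gη, j ζ⟫ + lam⁻¹ * ‖j ζ‖ ^ 2)
      - (1 / 2 * ‖j y - b‖ ^ 2 + 1 / (2 * lam) * ‖j p‖ ^ 2)
      = -(⟪j η - b, j (y - η)⟫ + ⟪S gζ, j (y - η)⟫ - ⟪M (gr ζ), gr (y - η)⟫)
        - 1 / 2 * ‖j (y - η)‖ ^ 2 - 1 / (2 * lam) * ‖j (p - ζ)‖ ^ 2 := by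
  have hl : 1 / (2 * lam) = 1 / 2 * lam⁻¹ := by field_simp
  rw [hl]
  simp only [← real_inner_self_eq_norm_sq, map_sub, inner_sub_left, inner_sub_right]
  rw [real_inner_comm (j y) (j η), real_inner_comm (j y) b, real_inner_comm (j η) b,
    real_inner_comm (j p) (j ζ), hMs (gr η) (gr ζ)]
  -- The state equation tested with ζ and skewness of the derivative suffice; stationarity with
  -- respect to the state variable is not used, the first-order term in η - y remains as the adjoint
  -- residual.
  have h := h2 ζ
  rw [hMs] at h
  linear_combination hζy - hζη - h

/-- Here E, e, f stand for the norms of the gradient of the state error, of the state error and of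
the adjoint error; M1, M2 bound the residuals. After inserting the bound on E, the product M2·f is
split by Young's inequality so that its f²-part is exactly 1/(2 lam)·f². -/
theorem saddle_scalar_bound {ν₀ C lam m M1 M2 E f e L r : ℝ} (hν₀ : 0 < ν₀) (hlam : 0 < lam)
    (hm : 0 < m) (hmν : Real.sqrt 2 * m ≤ ν₀)
    (hM1 : 0 ≤ M1) (hM2 : 0 ≤ M2) (hE : ν₀ * E ≤ lam⁻¹ * C * f + M1)
    (hr : -r ≤ M2 * E) (hL : L = -r - 1 / 2 * e ^ 2 - 1 / (2 * lam) * f ^ 2) :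
    L ≤ C ^ 2 / (m ^ 2 * lam) * M2 ^ 2 + 1 / m * M1 * M2 := by
  have hne : E ≤ (lam⁻¹ * C * f + M1) / ν₀ := by rwa [le_div_iff₀' hν₀]
  have hs : Real.sqrt 2 ^ 2 = 2 := Real.sq_sqrt (by norm_num)
  have hs1 : 1 ≤ Real.sqrt 2 := Real.one_le_sqrt.2 (by norm_num)
  have hmν' : m ≤ ν₀ := le_trans (by nlinarith) hmν
  have hmν2 : 2 * m ^ 2 ≤ ν₀ ^ 2 := by
    rw [← hs, ← mul_pow]; exact pow_le_pow_left₀ (by positivity) hmν 2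
  have f1 : M2 * E ≤ M2 * ((lam⁻¹ * C * f + M1) / ν₀) := mul_le_mul_of_nonneg_left hne hM2
  have f2 : M2 * M1 / ν₀ ≤ 1 / m * M1 * M2 := by
    have := mul_le_mul_of_nonneg_right (one_div_le_one_div_of_le hm hmν') (mul_nonneg hM1 hM2)
    calc M2 * M1 / ν₀ = 1 / ν₀ * (M1 * M2) := by ring
      _ ≤ _ := this
      _ = _ := by ring
  have f3 : M2 * (lam⁻¹ * C * f) / ν₀ ≤
      1 / (2 * lam) * f ^ 2 + C ^ 2 / (m ^ 2 * lam) * M2 ^ 2 := by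
    have g1 : C ^ 2 * M2 ^ 2 / (2 * ν₀ ^ 2 * lam) ≤ C ^ 2 / (m ^ 2 * lam) * M2 ^ 2 := by
      rw [div_mul_eq_mul_div]
      refine div_le_div_of_nonneg_left (by positivity) (by positivity) ?_
      nlinarith [sq_nonneg m]
    -- Completing the square in f. The remainder has the factor C²/(2ν₀²lam), at most C²/(m²lam)
    -- because 2m² ≤ ν₀².
    have g2 : 0 ≤ 1 / (2 * lam) * (f - C * M2 / ν₀) ^ 2 := by positivity
    have g3 : 1 / (2 * lam) * (f - C * M2 / ν₀) ^ 2 = 1 / (2 * lam) * f ^ 2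
        + C ^ 2 * M2 ^ 2 / (2 * ν₀ ^ 2 * lam) - M2 * (lam⁻¹ * C * f) / ν₀ := by
      field_simp
      ring
    linarith
  have f4 : M2 * ((lam⁻¹ * C * f + M1) / ν₀) =
      M2 * (lam⁻¹ * C * f) / ν₀ + M2 * M1 / ν₀ := by ring
  have f5 : 0 ≤ e ^ 2 := by positivity
  linarith

/-- The value of the Lagrangian minus the residual terms bounds the saddle value from below. -/
theorem lagrangian_sub_residuals_le (j : V →L[ℝ] H) (gr : V →L[ℝ] G) (M : G →L[ℝ] G)
    (S : H →L[ℝ] H) (Dt : V → H → Prop) {ν₀ C lam m : ℝ} (hν₀ : 0 < ν₀) (hlam : 0 < lam)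
    (hm : 0 < m) (hmν : Real.sqrt 2 * m ≤ ν₀)
    (hM : ∀ x, ν₀ * ‖x‖ ^ 2 ≤ ⟪M x, x⟫) (hMs : ∀ x x', ⟪M x, x'⟫ = ⟪M x', x⟫)
    (hDt : ∀ u g v h, Dt u g → Dt v h → ⟪S g, j v⟫ = - ⟪S h, j u⟫)
    (hC : 0 < C) (hV : ∀ v, ‖j v‖ ≤ C * ‖gr v‖)
    {y p η ζ : V} {gy gη gζ b dτ dρ : H} {τ ρ : G}
    (hy : Dt y gy) (hη : Dt η gη) (hζ : Dt ζ gζ)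
    (h2 : ∀ q, ⟪M (gr y), gr q⟫ + lam⁻¹ * ⟪j p, j q⟫ + ⟪S gy, j q⟫ = 0)
    (hτ : ∀ z, ⟪τ, gr z⟫ = - ⟪dτ, j z⟫) (hρ : ∀ z, ⟪ρ, gr z⟫ = - ⟪dρ, j z⟫) :
    1 / 2 * ‖j η - b‖ ^ 2 + 1 / (2 * lam) * ‖j ζ‖ ^ 2
      - (⟪M (gr η), gr ζ⟫ + ⟪S gη, j ζ⟫ + lam⁻¹ * ‖j ζ‖ ^ 2)
      - C ^ 2 / (m ^ 2 * lam) * (C * ‖j η - b + dρ + S gζ‖ + ‖ρ - M (gr ζ)‖) ^ 2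
      - 1 / m * (C * ‖S gη - dτ + lam⁻¹ • j ζ‖ + ‖τ - M (gr η)‖)
          * (C * ‖j η - b + dρ + S gζ‖ + ‖ρ - M (gr ζ)‖)
      ≤ 1 / 2 * ‖j y - b‖ ^ 2 + 1 / (2 * lam) * ‖j p‖ ^ 2 := by
  set R1 := S gη - dτ + lam⁻¹ • j ζ with hR1
  set R2 := τ - M (gr η) with hR2
  set R3 := j η - b + dρ + S gζ with hR3
  set R4 := ρ - M (gr ζ) with hR4
  set M1 := C * ‖R1‖ + ‖R2‖ with hM1
  set M2 := C * ‖R3‖ + ‖R4‖ with hM2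
  have hM1' : 0 ≤ M1 := by positivity
  have hM2' : 0 ≤ M2 := by positivity
  set e := y - η with he
  set f := p - ζ with hf
  have bound : ∀ (a : H) (c : G) (z : V), |⟪a, j z⟫| + |⟪c, gr z⟫| ≤ (C * ‖a‖ + ‖c‖) * ‖gr z‖ := by
    intro a c z
    have h1 := abs_real_inner_le_norm a (j z)
    have h2 := abs_real_inner_le_norm c (gr z)
    have h3 := mul_le_mul_of_nonneg_left (hV z) (norm_nonneg a)
    linarith
  -- the residuals are bounded on the state and adjoint errors
  have r1 : ∀ q, ⟪R1, j q⟫ - ⟪R2, gr q⟫ =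
      ⟪S gη, j q⟫ + lam⁻¹ * ⟪j ζ, j q⟫ + ⟪M (gr η), gr q⟫ := fun q => by
    simp only [hR1, hR2, inner_sub_left, inner_add_left, inner_smul_left, conj_trivial, hτ]
    ring
  have r2 : ∀ z, ⟪R3, j z⟫ + ⟪R4, gr z⟫ =
      ⟪j η, j z⟫ - ⟪b, j z⟫ + ⟪S gζ, j z⟫ - ⟪M (gr ζ), gr z⟫ := fun z => by
    simp only [hR3, hR4, inner_sub_left, inner_add_left, hρ]
    ring
  have b1 : -(⟪R1, j e⟫ - ⟪R2, gr e⟫) ≤ M1 * ‖gr e‖ := by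
    refine le_trans ?_ (bound R1 R2 e)
    linarith [neg_abs_le ⟪R1, j e⟫, le_abs_self ⟪R2, gr e⟫]
  have b2 : -(⟪R3, j e⟫ + ⟪R4, gr e⟫) ≤ M2 * ‖gr e‖ := by
    refine le_trans ?_ (bound R3 R4 e)
    linarith [neg_abs_le ⟪R3, j e⟫, neg_abs_le ⟪R4, gr e⟫]
  rw [r1] at b1
  rw [r2] at b2
  have hDt0 : ∀ u g, Dt u g → ⟪S g, j u⟫ = 0 := fun u g h => by
    have := hDt u g u g h h
    linarith
  have k2y := h2 y
  have k2η := h2 η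
  have n := hM (gr e)
  have fe : -⟪j f, j e⟫ ≤ ‖j f‖ * (C * ‖gr e‖) :=
    (neg_le_abs _).trans <| (abs_real_inner_le_norm _ _).trans <|
      mul_le_mul_of_nonneg_left (hV _) (norm_nonneg _)
  have c1 := hDt0 _ _ hy
  have c3 := hDt0 _ _ hη
  have c5 := hDt _ _ _ _ hη hy
  -- the error in the state equation
  have ne : ν₀ * ‖gr e‖ ≤ lam⁻¹ * C * ‖j f‖ + M1 := by
    have hge : ν₀ * ‖gr e‖ ^ 2 ≤ (lam⁻¹ * C * ‖j f‖ + M1) * ‖gr e‖ := by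
      -- The state equation for y minus the residual identity for η, both tested with e; the time
      -- derivative of e drops out because it is skew.
      have h3 : ⟪M (gr e), gr e⟫ ≤ -(lam⁻¹ * ⟪j f, j e⟫) + M1 * ‖gr e‖ := by
        refine le_trans (le_of_eq ?_) (add_le_add_right b1 _)
        simp only [he, hf, map_sub, inner_sub_left, inner_sub_right]
        linear_combination k2y - k2η - c1 - c3 + c5
      have h4 := mul_le_mul_of_nonneg_left fe (inv_nonneg.2 hlam.le)
      linarith
    -- Division by ‖gr e‖; if it vanishes, the right side is nonnegative anyway.
    rcases (norm_nonneg (gr e)).eq_or_lt with h0 | h0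
    · rw [← h0, mul_zero]; positivity
    · exact le_of_mul_le_mul_right (by linarith) h0
  have main := lagrangian_expansion j gr M S (b := b) hlam hMs h2 (hDt _ _ _ _ hζ hy)
    (hDt _ _ _ _ hζ hη)
  rw [← inner_sub_left] at b2
  have := saddle_scalar_bound hν₀ hlam hm hmν hM1' hM2' ne b2 main
  linarith

end Abstract

/-! ### Inner products and multiplication operators on L² -/

section L2

variable {α : Type*} [MeasurableSpace α] {μ : Measure α}
  {F : Type*} [NormedAddCommGroup F]

theorem inner_toLp [InnerProductSpace ℝ F] {f g : α → F} (hf : MemLp f 2 μ) (hg : MemLp g 2 μ) :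
    ⟪hf.toLp f, hg.toLp g⟫ = ∫ z, ⟪f z, g z⟫ ∂μ := by
  rw [L2.inner_def]
  refine integral_congr_ae ?_
  filter_upwards [hf.coeFn_toLp, hg.coeFn_toLp] with z h1 h2
  rw [h1, h2]

theorem inner_toLp_real {f g : α → ℝ} (hf : MemLp f 2 μ) (hg : MemLp g 2 μ) :
    ⟪hf.toLp f, hg.toLp g⟫ = ∫ z, f z * g z ∂μ := by
  rw [inner_toLp]
  refine integral_congr_ae (Eventually.of_forall fun z => ?_)
  simp [mul_comm]

theorem norm_sq_toLp [InnerProductSpace ℝ F] {f : α → F} (hf : MemLp f 2 μ) :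
    ‖hf.toLp f‖ ^ 2 = ∫ z, ‖f z‖ ^ 2 ∂μ := by
  rw [← real_inner_self_eq_norm_sq, inner_toLp]
  simp only [real_inner_self_eq_norm_sq]

variable [NormedSpace ℝ F]

/-- Multiplication by an essentially bounded function on `L²`. -/
def mulL (m : α → ℝ) (hm : MemLp m ∞ μ) : Lp F 2 μ →L[ℝ] Lp F 2 μ :=
  (ContinuousLinearMap.lsmul ℝ ℝ).holderL μ ∞ 2 2 (hm.toLp m)

theorem coeFn_mulL (m : α → ℝ) (hm : MemLp m ∞ μ) (f : Lp F 2 μ) :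
    mulL m hm f =ᵐ[μ] fun z => m z • f z := by
  filter_upwards [(ContinuousLinearMap.lsmul ℝ ℝ).coeFn_holder (r := 2) (hm.toLp m) f,
    hm.coeFn_toLp] with z h1 h2
  rw [← h2]
  exact h1

theorem memLp_bdd_smul {m : α → ℝ} (hm : MemLp m ∞ μ) {f : α → F} (hf : MemLp f 2 μ) :
    MemLp (fun z => m z • f z) 2 μ :=
  hf.smul hm

theorem mulL_toLp {m : α → ℝ} (hm : MemLp m ∞ μ) {f : α → F} (hf : MemLp f 2 μ) :
    mulL m hm (hf.toLp f) = (memLp_bdd_smul hm hf).toLp _ := by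
  refine Lp.ext ?_
  filter_upwards [coeFn_mulL m hm (hf.toLp f), hf.coeFn_toLp,
    (memLp_bdd_smul hm hf).coeFn_toLp] with z h1 h2 h3
  rw [h1, h2, h3]

end L2

section L2Inner

variable {α : Type*} [MeasurableSpace α] {μ : Measure α}
  {F : Type*} [NormedAddCommGroup F] [InnerProductSpace ℝ F]

theorem inner_mulL_comm (m : α → ℝ) (hm : MemLp m ∞ μ) (f g : Lp F 2 μ) :
    ⟪mulL m hm f, g⟫ = ⟪f, mulL m hm g⟫ := by
  rw [L2.inner_def, L2.inner_def]
  refine integral_congr_ae ?_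
  filter_upwards [coeFn_mulL m hm f, coeFn_mulL m hm g] with z h1 h2
  rw [h1, h2, real_inner_smul_left, real_inner_smul_right]

theorem le_inner_mulL (m : α → ℝ) (hm : MemLp m ∞ μ) {c : ℝ} (hc : ∀ᵐ z ∂μ, c ≤ m z)
    (f : Lp F 2 μ) : c * ‖f‖ ^ 2 ≤ ⟪mulL m hm f, f⟫ := by
  rw [← real_inner_self_eq_norm_sq, L2.inner_def, L2.inner_def, ← integral_const_mul]
  refine integral_mono_ae ((L2.integrable_inner f f).const_mul c) (L2.integrable_inner _ _) ?_
  filter_upwards [coeFn_mulL m hm f, hc] with z h1 h2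
  rw [h1, real_inner_smul_left]
  exact mul_le_mul_of_nonneg_right h2 real_inner_self_nonneg

end L2Inner

/-! ### Functions of product form on Q and integrals over time slices -/

section Cylinder

variable {d : ℕ} {Ω : Set (Sp d)} {T : ℝ}

theorem muQ_eq_prod (Ω : Set (Sp d)) (T : ℝ) :
    muQ Ω T = (volume.restrict Ω).prod (volume.restrict (Ioo 0 T)) := by
  rw [muQ, cyl, Measure.prod_restrict, Measure.volume_eq_prod]

instance [IsFiniteMeasure ((volume : Measure (Sp d)).restrict Ω)] :
    IsFiniteMeasure (muQ Ω T) := by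
  rw [muQ_eq_prod]; infer_instance

theorem normQ_eq_norm_toLp {F : Type*} [NormedAddCommGroup F] [InnerProductSpace ℝ F]
    {f : Sp d × ℝ → F} (hf : MemL2 Ω T f) :
    normQ Ω T f = ‖MemLp.toLp f hf‖ := by
  rw [normQ, ← norm_sq_toLp hf, Real.sqrt_sq (norm_nonneg _)]

theorem memLp_top_snd (Ω : Set (Sp d)) (T : ℝ) (e : C(ℝ, ℝ)) :
    MemLp (fun z : Sp d × ℝ => e z.2) ∞ (muQ Ω T) := by
  obtain ⟨C, hC⟩ := (isCompact_Icc (a := (0 : ℝ)) (b := T)).exists_bound_of_continuousOn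
    e.continuous.continuousOn
  refine memLp_top_of_bound ?_ C ?_
  · exact (e.continuous.comp continuous_snd).aestronglyMeasurable
  · rw [muQ_eq_prod]
    have : ∀ᵐ t ∂(volume.restrict (Ioo 0 T)), ‖e t‖ ≤ C := by
      filter_upwards [ae_restrict_mem measurableSet_Ioo] with t ht
      exact hC t (Ioo_subset_Icc_self ht)
    exact Measure.quasiMeasurePreserving_snd.ae this

theorem memLp_top_fst {m : Sp d → ℝ} (hm : MemLp m ∞ (volume.restrict Ω)) :
    MemLp (fun z : Sp d × ℝ => m z.1) ∞ (muQ Ω T) := by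
  rw [muQ_eq_prod]
  exact hm.comp_fst _

variable {F : Type*} [NormedAddCommGroup F]

theorem memLp_comp_fst {a : Sp d → F} (ha : MemLp a 2 (volume.restrict Ω)) :
    MemLp (fun z : Sp d × ℝ => a z.1) 2 (muQ Ω T) := by
  rw [muQ_eq_prod]
  exact ha.comp_fst _

theorem memL2_fst_smul [NormedSpace ℝ F] {a : Sp d → F} (ha : MemLp a 2 (volume.restrict Ω))
    (e : C(ℝ, ℝ)) :
    MemLp (fun z : Sp d × ℝ => e z.2 • a z.1) 2 (muQ Ω T) := by
  refine memLp_bdd_smul (memLp_top_snd Ω T e) (memLp_comp_fst ha)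

variable [InnerProductSpace ℝ F]

theorem ae_fst {p : Sp d → Prop} (h : ∀ᵐ x ∂(volume.restrict Ω), p x) :
    ∀ᵐ z ∂(muQ Ω T), p z.1 := by
  rw [muQ_eq_prod]
  exact Measure.quasiMeasurePreserving_fst.ae h

variable (Ω T F) in
/-- The map `a ↦ a(x)` from `L²(Ω)` to `L²(Q)`. -/
def fstLin : Lp F 2 (volume.restrict Ω) →ₗ[ℝ] Lp F 2 (muQ Ω T) where
  toFun a := MemLp.toLp _ (memLp_comp_fst (T := T) (Lp.memLp a))
  map_add' a b := by
    rw [← MemLp.toLp_add]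
    refine MemLp.toLp_congr _ _ ?_
    filter_upwards [ae_fst (Lp.coeFn_add a b)] with z hz
    exact hz
  map_smul' c a := by
    rw [RingHom.id_apply, ← MemLp.toLp_const_smul]
    refine MemLp.toLp_congr _ _ ?_
    filter_upwards [ae_fst (Lp.coeFn_smul c a)] with z hz
    exact hz

theorem norm_fstLin_le (a : Lp F 2 (volume.restrict Ω)) :
    ‖fstLin Ω T F a‖ ≤ Real.sqrt (volume.real (Ioo 0 T)) * ‖a‖ := by
  refine (sq_le_sq₀ (norm_nonneg _) (by positivity)).1 ?_
  rw [mul_pow, Real.sq_sqrt measureReal_nonneg]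
  have h : ‖fstLin Ω T F a‖ ^ 2 = ∫ z, ‖a z.1‖ ^ 2 ∂(muQ Ω T) :=
    norm_sq_toLp (memLp_comp_fst (T := T) (Lp.memLp a))
  have h2 : ‖a‖ ^ 2 = ∫ x, ‖a x‖ ^ 2 ∂(volume.restrict Ω) := by
    rw [← real_inner_self_eq_norm_sq a, L2.inner_def]
    simp only [real_inner_self_eq_norm_sq]
  rw [h, h2, muQ_eq_prod, integral_fun_fst (fun x => ‖a x‖ ^ 2), smul_eq_mul,
    measureReal_restrict_apply_univ]

variable (Ω T F) in
/-- The map `a ↦ a(x) e(t)` from `L²(Ω)` to `L²(Q)`. -/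
def tensL (e : C(ℝ, ℝ)) : Lp F 2 (volume.restrict Ω) →L[ℝ] Lp F 2 (muQ Ω T) :=
  (mulL _ (memLp_top_snd Ω T e)).comp ((fstLin Ω T F).mkContinuous _ norm_fstLin_le)

theorem coeFn_tensL (e : C(ℝ, ℝ)) (a : Lp F 2 (volume.restrict Ω)) :
    tensL Ω T F e a =ᵐ[muQ Ω T] fun z => e z.2 • a z.1 := by
  have h := memLp_comp_fst (T := T) (Lp.memLp a)
  filter_upwards [coeFn_mulL _ (memLp_top_snd Ω T e) (h.toLp _), h.coeFn_toLp] with z h1 h2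
  rw [← h2]
  exact h1

theorem tensL_toLp (e : C(ℝ, ℝ)) {a : Sp d → F} (ha : MemLp a 2 (volume.restrict Ω)) :
    tensL Ω T F e (ha.toLp a) = (memL2_fst_smul ha e).toLp _ := by
  refine Lp.ext ?_
  filter_upwards [coeFn_tensL (T := T) e (ha.toLp a), ae_fst ha.coeFn_toLp,
    (memL2_fst_smul (T := T) ha e).coeFn_toLp] with z h1 h2 h3
  rw [h1, h2, h3]

/-- The integral of `u(x,·)` against `e` over `(0,T)`. -/
def coefE (T : ℝ) (e : ℝ → ℝ) (u : Sp d × ℝ → F) (x : Sp d) : F :=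
  ∫ t in Ioo 0 T, e t • u (x, t)

theorem inner_tensL_tensL (e e' : C(ℝ, ℝ)) (a b : Lp F 2 (volume.restrict Ω)) :
    ⟪tensL Ω T F e a, tensL Ω T F e' b⟫ = (∫ t in Ioo 0 T, e t * e' t) * ⟪a, b⟫ := by
  have h := integral_prod_mul (μ := volume.restrict Ω) (ν := volume.restrict (Ioo 0 T))
    (fun x => ⟪a x, b x⟫) (fun t => e t * e' t)
  rw [← muQ_eq_prod] at h
  rw [L2.inner_def, L2.inner_def, mul_comm, ← h]
  refine integral_congr_ae ?_
  filter_upwards [coeFn_tensL (T := T) e a, coeFn_tensL (T := T) e' b] with z h1 h2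
  rw [h1, h2, real_inner_smul_left, real_inner_smul_right]
  ring

theorem tensL_mulL {m : Sp d → ℝ} (hm : MemLp m ∞ (volume.restrict Ω)) (e : C(ℝ, ℝ))
    (a : Lp F 2 (volume.restrict Ω)) :
    tensL Ω T F e (mulL m hm a) = mulL _ (memLp_top_fst hm) (tensL Ω T F e a) := by
  refine Lp.ext ?_
  filter_upwards [coeFn_tensL (T := T) e (mulL m hm a), ae_fst (coeFn_mulL m hm a),
    coeFn_mulL _ (memLp_top_fst (T := T) hm) (tensL Ω T F e a), coeFn_tensL (T := T) e a]
    with z h1 h2 h3 h4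
  rw [h1, h2, h3, h4, smul_comm]

/-- Pointwise slices make sense for L² classes only through Fubini: two representatives agree on
almost every slice. -/
theorem coefE_congr_ae (e : ℝ → ℝ) {u v : Sp d × ℝ → F} (h : u =ᵐ[muQ Ω T] v) :
    coefE T e u =ᵐ[volume.restrict Ω] coefE T e v := by
  rw [muQ_eq_prod] at h
  filter_upwards [Measure.ae_ae_of_ae_prod h] with x hx
  refine integral_congr_ae ?_
  filter_upwards [hx] with t ht
  rw [ht]

variable [IsFiniteMeasure ((volume : Measure (Sp d)).restrict Ω)]

theorem integrable_smul_prod (e : C(ℝ, ℝ)) {u : Sp d × ℝ → F} (hu : MemLp u 2 (muQ Ω T)) :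
    Integrable (fun z => e z.2 • u z) ((volume.restrict Ω).prod (volume.restrict (Ioo 0 T))) := by
  rw [← muQ_eq_prod]
  exact (memLp_bdd_smul (memLp_top_snd Ω T e) hu).integrable (by norm_num)

variable [CompleteSpace F]

theorem integral_inner_smul_indicator (e : C(ℝ, ℝ)) {u : Sp d × ℝ → F}
    (hu : MemLp u 2 (muQ Ω T)) {s : Set (Sp d)} (hs : MeasurableSet s) (v : F) :
    ∫ z, ⟪e z.2 • s.indicator (fun _ => v) z.1, u z⟫ ∂(muQ Ω T) =
      ∫ x in Ω, s.indicator (fun x => ⟪v, coefE T e u x⟫) x := by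
  have hint := integrable_smul_prod e hu
  have h3 : (fun z : Sp d × ℝ => ⟪e z.2 • s.indicator (fun _ => v) z.1, u z⟫) =
      (Prod.fst ⁻¹' s).indicator (fun z => ⟪v, e z.2 • u z⟫) := by
    ext z
    by_cases hz : z.1 ∈ s <;> simp [hz, real_inner_smul_left, real_inner_smul_right]
  have hi2 := (hint.const_inner (𝕜 := ℝ) v).indicator (measurable_fst hs)
  rw [h3, muQ_eq_prod, integral_prod _ hi2]
  refine integral_congr_ae ?_
  filter_upwards [hint.prod_right_ae] with x hx
  by_cases hxs : x ∈ s
  · simp only [hxs, indicator_of_mem, mem_preimage]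
    exact integral_inner hx v
  · simp [hxs]

/-- Fubini, tested on indicators of measurable sets times constant vectors: integrating u(x,·)
against e is dual to multiplying a function of x by e(t). This makes time Fourier coefficients
bounded operators into L²(Ω), so that adjoints can replace slice computations. -/
theorem coefE_ae_eq_adjoint (e : C(ℝ, ℝ)) {u : Sp d × ℝ → F} (hu : MemLp u 2 (muQ Ω T)) :
    coefE T e u =ᵐ[volume.restrict Ω] (tensL Ω T F e).adjoint (hu.toLp u) := by
  have hint := integrable_smul_prod e hu
  have hcoef : Integrable (coefE T e u) (volume.restrict Ω) := hint.integral_prod_left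
  refine Integrable.ae_eq_of_forall_setIntegral_eq _ _ hint.integral_prod_left
    ((Lp.memLp _).integrable one_le_two) fun s hs _ => ?_
  refine ext_inner_left ℝ fun v => ?_
  have hmem : MemLp (s.indicator fun _ => v) 2 (volume.restrict Ω) :=
    memLp_indicator_const 2 hs v (Or.inr (measure_ne_top _ _))
  have h1 : ⟪hmem.toLp _, (tensL Ω T F e).adjoint (hu.toLp u)⟫ =
      ⟪v, ∫ x in s, (tensL Ω T F e).adjoint (hu.toLp u) x ∂(volume.restrict Ω)⟫ := by
    have hi : Integrable ((tensL Ω T F e).adjoint (hu.toLp u)) (volume.restrict Ω) :=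
      (Lp.memLp _).integrable one_le_two
    rw [L2.inner_def, ← integral_inner hi.integrableOn, ← integral_indicator hs]
    refine integral_congr_ae ?_
    filter_upwards [hmem.coeFn_toLp] with x hx
    rw [hx]
    by_cases hxs : x ∈ s <;> simp [hxs]
  have h2 : ⟪hmem.toLp _, (tensL Ω T F e).adjoint (hu.toLp u)⟫ =
      ⟪v, ∫ x in s, coefE T e u x ∂(volume.restrict Ω)⟫ := by
    rw [ContinuousLinearMap.adjoint_inner_right, tensL_toLp, inner_toLp,
      ← integral_inner hcoef.integrableOn, ← integral_indicator hs]
    exact integral_inner_smul_indicator e hu hs v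
  rw [← h1, h2]

theorem memLp_coefE (e : C(ℝ, ℝ)) {u : Sp d × ℝ → F} (hu : MemLp u 2 (muQ Ω T)) :
    MemLp (coefE T e u) 2 (volume.restrict Ω) :=
  (memLp_congr_ae (coefE_ae_eq_adjoint e hu)).2 (Lp.memLp _)

theorem adjoint_tensL_toLp (e : C(ℝ, ℝ)) {u : Sp d × ℝ → F} (hu : MemLp u 2 (muQ Ω T)) :
    (tensL Ω T F e).adjoint (hu.toLp u) = (memLp_coefE e hu).toLp _ :=
  Lp.ext ((coefE_ae_eq_adjoint e hu).symm.trans (memLp_coefE e hu).coeFn_toLp.symm)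

end Cylinder

/-! ### Test functions, integration by parts and time cutoffs -/

section TestFunctions

variable {d : ℕ} {Ω : Set (Sp d)} {T : ℝ}

/-- Smooth functions with compact support that vanish near the lateral boundary. -/
def IsLatTest (Ω : Set (Sp d)) (φ : Sp d × ℝ → ℝ) : Prop :=
  ContDiff ℝ ∞ φ ∧ HasCompactSupport φ ∧ tsupport φ ⊆ Ω ×ˢ univ

theorem IsTest.isLatTest {φ : Sp d × ℝ → ℝ} (h : IsTest Ω T φ) : IsLatTest Ω φ :=
  ⟨h.1, h.2.1, h.2.2.trans (prod_mono_right (subset_univ _))⟩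

theorem gradX_apply (φ : Sp d × ℝ → ℝ) (z : Sp d × ℝ) (i : Fin d) :
    gradX φ z i = fderiv ℝ φ z (EuclideanSpace.single i 1, 0) := rfl

theorem continuous_gradX {φ : Sp d × ℝ → ℝ} (h : ContDiff ℝ ∞ φ) : Continuous (gradX φ) := by
  have h1 : Continuous (fderiv ℝ φ) := h.continuous_fderiv (by simp)
  exact (PiLp.continuous_toLp 2 _).comp (continuous_pi fun i => h1.clm_apply continuous_const)

theorem support_gradX_subset (φ : Sp d × ℝ → ℝ) :
    Function.support (gradX φ) ⊆ tsupport φ := by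
  intro z hz
  by_contra h
  refine hz ?_
  ext i
  rw [gradX_apply, fderiv_of_notMem_tsupport (𝕜 := ℝ) h]
  rfl

theorem hasCompactSupport_gradX {φ : Sp d × ℝ → ℝ} (h : HasCompactSupport φ) :
    HasCompactSupport (gradX φ) :=
  HasCompactSupport.of_support_subset_isCompact h (support_gradX_subset φ)

theorem memL2_of_continuous {F : Type*} [NormedAddCommGroup F] {f : Sp d × ℝ → F}
    (hf : Continuous f) (hc : HasCompactSupport f) : MemLp f 2 (muQ Ω T) :=
  (hf.memLp_of_hasCompactSupport hc (μ := volume)).restrict _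

theorem IsLatTest.memL2 {φ : Sp d × ℝ → ℝ} (h : IsLatTest Ω φ) : MemLp φ 2 (muQ Ω T) :=
  memL2_of_continuous h.1.continuous h.2.1

theorem IsLatTest.memL2_gradX {φ : Sp d × ℝ → ℝ} (h : IsLatTest Ω φ) :
    MemLp (gradX φ) 2 (muQ Ω T) :=
  memL2_of_continuous (continuous_gradX h.1) (hasCompactSupport_gradX h.2.1)

theorem gradX_add {φ ψ : Sp d × ℝ → ℝ} (hφ : ContDiff ℝ ∞ φ) (hψ : ContDiff ℝ ∞ ψ) :
    gradX (φ + ψ) = gradX φ + gradX ψ := by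
  ext z i
  rw [gradX_apply, fderiv_add (hφ.differentiable (by simp) z) (hψ.differentiable (by simp) z)]
  rfl

theorem gradX_const_smul (c : ℝ) {φ : Sp d × ℝ → ℝ} (hφ : ContDiff ℝ ∞ φ) :
    gradX (c • φ) = c • gradX φ := by
  ext z i
  rw [gradX_apply, fderiv_const_smul (hφ.differentiable (by simp) z)]
  rfl

theorem IsTest.add {φ ψ : Sp d × ℝ → ℝ} (hφ : IsTest Ω T φ) (hψ : IsTest Ω T ψ) :
    IsTest Ω T (φ + ψ) :=
  ⟨hφ.1.add hψ.1, hφ.2.1.add hψ.2.1, (tsupport_add φ ψ).trans (union_subset hφ.2.2 hψ.2.2)⟩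

theorem IsTest.const_smul (c : ℝ) {φ : Sp d × ℝ → ℝ} (hφ : IsTest Ω T φ) :
    IsTest Ω T (c • φ) := by
  have hs : tsupport (c • φ) ⊆ tsupport φ := closure_mono (Function.support_const_smul_subset c φ)
  exact ⟨hφ.1.const_smul c, HasCompactSupport.of_support_subset_isCompact hφ.2.1
    (subset_closure.trans hs), hs.trans hφ.2.2⟩

/-- Integrals over `Q` of functions vanishing outside of `Q` are integrals over the whole space. -/
theorem integral_muQ_of_support {f : Sp d × ℝ → ℝ} (h : ∀ z, z ∉ cyl Ω T → f z = 0) :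
    ∫ z, f z ∂(muQ Ω T) = ∫ z, f z :=
  setIntegral_eq_integral_of_forall_compl_eq_zero h

theorem IsTest.eq_zero {φ : Sp d × ℝ → ℝ} (h : IsTest Ω T φ) {z : Sp d × ℝ} (hz : z ∉ cyl Ω T) :
    φ z = 0 :=
  image_eq_zero_of_notMem_tsupport fun hz' => hz (h.2.2 hz')

theorem IsTest.fderiv_eq_zero {φ : Sp d × ℝ → ℝ} (h : IsTest Ω T φ) {z : Sp d × ℝ}
    (hz : z ∉ cyl Ω T) : fderiv ℝ φ z = 0 :=
  fderiv_of_notMem_tsupport (𝕜 := ℝ) fun hz' => hz (h.2.2 hz')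

instance : (volume : Measure (Sp d × ℝ)).IsAddHaarMeasure := by
  rw [Measure.volume_eq_prod]; infer_instance

/-- Integration by parts against a test function. -/
theorem integral_mul_fderiv_test {f φ : Sp d × ℝ → ℝ} (hf : ContDiff ℝ ∞ f) (h : IsTest Ω T φ)
    (v : Sp d × ℝ) :
    ∫ z, f z * fderiv ℝ φ z v ∂(muQ Ω T) = - ∫ z, fderiv ℝ f z v * φ z ∂(muQ Ω T) := by
  rw [integral_muQ_of_support fun z hz => by rw [h.fderiv_eq_zero hz]; simp,
    integral_muQ_of_support fun z hz => by rw [h.eq_zero hz, mul_zero]]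
  have h1 : Continuous fun z => fderiv ℝ φ z v :=
    (h.1.continuous_fderiv (by simp)).clm_apply continuous_const
  have h2 : Continuous fun z => fderiv ℝ f z v :=
    (hf.continuous_fderiv (by simp)).clm_apply continuous_const
  have hc : HasCompactSupport fun z => fderiv ℝ φ z v := h.2.1.fderiv_apply (𝕜 := ℝ) v
  refine integral_mul_fderiv_eq_neg_fderiv_mul_of_integrable ?_ ?_ ?_
    (fun x _ => hf.differentiable (by simp) x) (fun x _ => h.1.differentiable (by simp) x)
  · exact (h2.mul h.1.continuous).integrable_of_hasCompactSupport h.2.1.mul_left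
  · exact (hf.continuous.mul h1).integrable_of_hasCompactSupport hc.mul_left
  · exact (hf.continuous.mul h.1.continuous).integrable_of_hasCompactSupport h.2.1.mul_left

theorem fderiv_snd_comp {χ : ℝ → ℝ} (hχ : Differentiable ℝ χ) (z v : Sp d × ℝ) :
    fderiv ℝ (fun z : Sp d × ℝ => χ z.2) z v = v.2 * deriv χ z.2 := by
  have := (hχ z.2).hasDerivAt.comp_hasFDerivAt z (hasFDerivAt_snd (𝕜 := ℝ) (p := z))
  change fderiv ℝ (χ ∘ Prod.snd) z v = _
  rw [this.fderiv]
  simp [mul_comm]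

theorem fderiv_mul_time {φ : Sp d × ℝ → ℝ} {χ : ℝ → ℝ} (hφ : Differentiable ℝ φ)
    (hχ : Differentiable ℝ χ) (z v : Sp d × ℝ) :
    fderiv ℝ (fun z => χ z.2 * φ z) z v = χ z.2 * fderiv ℝ φ z v + φ z * (v.2 * deriv χ z.2) := by
  have h1 : DifferentiableAt ℝ (fun z : Sp d × ℝ => χ z.2) z :=
    (hχ z.2).comp z differentiableAt_snd
  rw [fderiv_fun_mul h1 (hφ z), ← fderiv_snd_comp hχ]
  simp

theorem gradX_mul_time {φ : Sp d × ℝ → ℝ} {χ : ℝ → ℝ} (hφ : Differentiable ℝ φ)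
    (hχ : Differentiable ℝ χ) (z : Sp d × ℝ) :
    gradX (fun z => χ z.2 * φ z) z = χ z.2 • gradX φ z := by
  ext i
  rw [gradX_apply, fderiv_mul_time hφ hχ, zero_mul, mul_zero, add_zero]
  rfl

theorem derivT_mul_time {φ : Sp d × ℝ → ℝ} {χ : ℝ → ℝ} (hφ : Differentiable ℝ φ)
    (hχ : Differentiable ℝ χ) (z : Sp d × ℝ) :
    derivT (fun z => χ z.2 * φ z) z = χ z.2 * derivT φ z + φ z * deriv χ z.2 := by
  rw [derivT, fderiv_mul_time hφ hχ, one_mul]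
  rfl

/-- Smooth cutoff functions on `(0,T)`. -/
def timeCut (T : ℝ) (n : ℕ) (t : ℝ) : ℝ :=
  Real.smoothTransition ((n + 4) * (t / T) - 1)
    + Real.smoothTransition ((n + 4) * ((T - t) / T) - 1) - 1

theorem contDiff_timeCut (T : ℝ) (n : ℕ) : ContDiff ℝ ∞ (timeCut T n) := by
  unfold timeCut
  refine ((Real.smoothTransition.contDiff.comp ?_).add
    (Real.smoothTransition.contDiff.comp ?_)).sub contDiff_const
  · exact (contDiff_const.mul (contDiff_id.div_const T)).sub contDiff_const
  · exact (contDiff_const.mul ((contDiff_const.sub contDiff_id).div_const T)).sub contDiff_const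

theorem abs_timeCut_le (T : ℝ) (n : ℕ) (t : ℝ) : |timeCut T n t| ≤ 1 := by
  have h1 := Real.smoothTransition.nonneg ((n + 4) * (t / T) - 1)
  have h2 := Real.smoothTransition.le_one ((n + 4) * (t / T) - 1)
  have h3 := Real.smoothTransition.nonneg ((n + 4) * ((T - t) / T) - 1)
  have h4 := Real.smoothTransition.le_one ((n + 4) * ((T - t) / T) - 1)
  rw [timeCut, abs_le]
  constructor <;> linarith

theorem tsupport_timeCut (hT : 0 < T) (n : ℕ) : tsupport (timeCut T n) ⊆ Ioo 0 T := by
  have hn : (0 : ℝ) < n + 4 := by positivity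
  have hd : T / (n + 4) ≤ T / 4 := by
    gcongr; linarith [(Nat.cast_nonneg n : (0 : ℝ) ≤ n)]
  have hd0 : 0 < T / (n + 4) := by positivity
  have hs : Function.support (timeCut T n) ⊆ Icc (T / (n + 4)) (T - T / (n + 4)) := by
    intro t ht
    by_contra hc
    refine ht ?_
    -- In a layer of width T/(n+4) at one end, one transition is still 0 and the other is already 1;
    -- the shift by 4 guarantees this for every n. The two then add up to 1 and the cutoff is 0.
    have key : ∀ s : ℝ, s < T / (n + 4) → Real.smoothTransition ((n + 4) * (s / T) - 1) = 0 ∧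
        Real.smoothTransition ((n + 4) * ((T - s) / T) - 1) = 1 := by
      intro s hs
      have h1 : (n + 4) * (s / T) ≤ 1 := by
        rw [lt_div_iff₀ hn] at hs
        rw [← mul_div_assoc, div_le_one hT]
        linarith
      refine ⟨Real.smoothTransition.zero_of_nonpos (by linarith),
        Real.smoothTransition.one_of_one_le ?_⟩
      rw [sub_div, div_self hT.ne', mul_sub, mul_one]
      linarith [(Nat.cast_nonneg n : (0 : ℝ) ≤ n)]
    rw [mem_Icc, not_and_or, not_le, not_le] at hc
    rw [timeCut]
    rcases hc with hc | hc
    · rw [(key t hc).1, (key t hc).2]; ring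
    · have := key (T - t) (by linarith)
      rw [sub_sub_cancel] at this
      rw [this.1, this.2]; ring
  refine (closure_minimal hs isClosed_Icc).trans fun t ht => ⟨hd0.trans_le ht.1, ?_⟩
  exact ht.2.trans_lt (by linarith)

theorem tendsto_timeCut (hT : 0 < T) {t : ℝ} (ht : t ∈ Ioo 0 T) :
    Tendsto (fun n => timeCut T n t) atTop (𝓝 1) := by
  have key : ∀ s : ℝ, 0 < s → ∀ᶠ n : ℕ in atTop,
      Real.smoothTransition ((n + 4) * (s / T) - 1) = 1 := by
    intro s hs
    have hsT : 0 < s / T := by positivity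
    obtain ⟨N, hN⟩ := exists_nat_ge (2 / (s / T))
    filter_upwards [eventually_ge_atTop N] with n hn
    refine Real.smoothTransition.one_of_one_le ?_
    have h1 : 2 / (s / T) ≤ n := hN.trans (by exact_mod_cast hn)
    rw [div_le_iff₀ hsT] at h1
    linarith
  refine tendsto_const_nhds.congr' ?_
  filter_upwards [key t ht.1, key (T - t) (by linarith [ht.2])] with n h1 h2
  rw [timeCut, h1, h2]; ring

theorem IsLatTest.mul_time {φ : Sp d × ℝ → ℝ} (h : IsLatTest Ω φ) {χ : ℝ → ℝ}
    (hχ : ContDiff ℝ ∞ χ) (hs : tsupport χ ⊆ Ioo 0 T) :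
    IsTest Ω T (fun z => χ z.2 * φ z) := by
  refine ⟨(hχ.comp contDiff_snd).mul h.1, h.2.1.mul_left, fun z hz => ⟨?_, hs ?_⟩⟩
  · exact (h.2.2 (tsupport_mul_subset_right hz)).1
  · have h1 := tsupport_mul_subset_left hz
    exact tsupport_comp_subset_preimage χ continuous_snd h1

end TestFunctions

/-! ### Strong convergence of bounded multipliers -/

section Convergence

variable {α : Type*} [MeasurableSpace α] {μ : Measure α}
  {F : Type*} [NormedAddCommGroup F] [InnerProductSpace ℝ F]

theorem tendsto_mulL {m : ℕ → α → ℝ} (hm : ∀ n, MemLp (m n) ∞ μ) {C : ℝ}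
    (hb : ∀ n z, |m n z| ≤ C) (hlim : ∀ᵐ z ∂μ, Tendsto (fun n => m n z) atTop (𝓝 1))
    (f : Lp F 2 μ) : Tendsto (fun n => mulL (m n) (hm n) f) atTop (𝓝 f) := by
  rw [tendsto_iff_norm_sub_tendsto_zero]
  have hsq : ∀ n, ‖mulL (m n) (hm n) f - f‖ ^ 2 = ∫ z, (m n z - 1) ^ 2 * ‖f z‖ ^ 2 ∂μ := by
    intro n
    rw [← real_inner_self_eq_norm_sq, L2.inner_def]
    refine integral_congr_ae ?_
    filter_upwards [Lp.coeFn_sub (mulL (m n) (hm n) f) f, coeFn_mulL (m n) (hm n) f] with z h1 h2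
    have h3 : m n z • f z - f z = (m n z - 1) • f z := by rw [sub_smul, one_smul]
    rw [h1, Pi.sub_apply, h2, h3, real_inner_self_eq_norm_sq, norm_smul, mul_pow,
      Real.norm_eq_abs, sq_abs]
  have h0 : Tendsto (fun n => ∫ z, (m n z - 1) ^ 2 * ‖f z‖ ^ 2 ∂μ) atTop (𝓝 (∫ _, (0 : ℝ) ∂μ)) := by
    refine tendsto_integral_of_dominated_convergence (fun z => (C + 1) ^ 2 * ‖f z‖ ^ 2) ?_ ?_ ?_ ?_
    · exact fun n => (((hm n).1.sub aestronglyMeasurable_const).pow 2).mul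
        ((Lp.aestronglyMeasurable f).norm.pow 2)
    · exact ((memLp_two_iff_integrable_sq_norm (Lp.aestronglyMeasurable f)).1
        (Lp.memLp f)).const_mul _
    · intro n
      refine Eventually.of_forall fun z => ?_
      rw [Real.norm_of_nonneg (by positivity)]
      refine mul_le_mul_of_nonneg_right ?_ (by positivity)
      have h1 := abs_le.1 (hb n z)
      refine sq_le_sq' (by linarith) (by linarith)
    · filter_upwards [hlim] with z hz
      have := ((hz.sub_const 1).pow 2).mul_const (‖f z‖ ^ 2)
      simpa using this
  rw [integral_zero] at h0
  have h1 := (h0.congr fun n => (hsq n).symm).sqrt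
  simpa [Real.sqrt_sq] using h1

end Convergence

/-! ### The energy space as a closure of test functions -/

section EnergySpace

variable {d : ℕ} {Ω : Set (Sp d)} {T : ℝ}

/-- Pairs of a function and a gradient field. -/
abbrev PairSp (Ω : Set (Sp d)) (T : ℝ) : Type :=
  WithLp 2 (Lp ℝ 2 (muQ Ω T) × Lp (Sp d) 2 (muQ Ω T))

/-- The pair of two square integrable functions. -/
def mkPair {u : Sp d × ℝ → ℝ} {g : Sp d × ℝ → Sp d} (hu : MemLp u 2 (muQ Ω T))
    (hg : MemLp g 2 (muQ Ω T)) : PairSp Ω T :=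
  WithLp.toLp 2 (hu.toLp u, hg.toLp g)

variable (Ω T) in
/-- The pairs `(φ, ∇φ)` of test functions. -/
def testSpace : Submodule ℝ (PairSp Ω T) where
  carrier := {x | ∃ φ, ∃ h : IsTest Ω T φ,
    x = mkPair h.isLatTest.memL2 h.isLatTest.memL2_gradX}
  zero_mem' := by
    have h : IsTest Ω T (0 : Sp d × ℝ → ℝ) :=
      ⟨contDiff_zero_fun, HasCompactSupport.zero, by simp [tsupport]⟩
    refine ⟨0, h, ?_⟩
    have h0 : gradX (0 : Sp d × ℝ → ℝ) = 0 := by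
      simpa using gradX_const_smul 0 (φ := (0 : Sp d × ℝ → ℝ)) h.1
    refine (WithLp.ext_iff 2).2 (Prod.ext ?_ ?_)
    · exact (MemLp.toLp_zero h.isLatTest.memL2).symm
    · exact ((MemLp.toLp_congr h.isLatTest.memL2_gradX MemLp.zero (by rw [h0])).trans
        (MemLp.toLp_zero _)).symm
  add_mem' := by
    rintro x x' ⟨φ, hφ, rfl⟩ ⟨ψ, hψ, rfl⟩
    refine ⟨φ + ψ, hφ.add hψ, ?_⟩
    refine (WithLp.ext_iff 2).2 (Prod.ext ?_ ?_)
    · exact (MemLp.toLp_add hφ.isLatTest.memL2 hψ.isLatTest.memL2).symm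
    · exact (MemLp.toLp_add hφ.isLatTest.memL2_gradX hψ.isLatTest.memL2_gradX).symm.trans
        (MemLp.toLp_congr _ (hφ.add hψ).isLatTest.memL2_gradX (by rw [gradX_add hφ.1 hψ.1]))
  smul_mem' := by
    rintro c x ⟨φ, hφ, rfl⟩
    refine ⟨c • φ, hφ.const_smul c, ?_⟩
    refine (WithLp.ext_iff 2).2 (Prod.ext ?_ ?_)
    · exact (MemLp.toLp_const_smul c hφ.isLatTest.memL2).symm
    · exact (MemLp.toLp_const_smul c hφ.isLatTest.memL2_gradX).symm.trans
        (MemLp.toLp_congr _ (hφ.const_smul c).isLatTest.memL2_gradX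
          (by rw [gradX_const_smul c hφ.1]))

variable (Ω T) in
/-- The space `H^{1,0}_0(Q)` as the closure of the test functions. -/
def energySpace : Submodule ℝ (PairSp Ω T) := (testSpace Ω T).topologicalClosure

instance : CompleteSpace (energySpace Ω T) :=
  inferInstanceAs (CompleteSpace (testSpace Ω T).topologicalClosure)

theorem isClosed_energySpace : IsClosed (energySpace Ω T : Set (PairSp Ω T)) :=
  (testSpace Ω T).isClosed_topologicalClosure

/-- The proof principle for the energy space: a closed condition need only be checked on test
functions of Q. -/
theorem energySpace_subset {s : Set (PairSp Ω T)} (hs : IsClosed s)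
    (h : ∀ φ, ∀ hφ : IsTest Ω T φ, mkPair hφ.isLatTest.memL2 hφ.isLatTest.memL2_gradX ∈ s) :
    (energySpace Ω T : Set (PairSp Ω T)) ⊆ s := by
  refine closure_minimal ?_ hs
  rintro x ⟨φ, hφ, rfl⟩
  exact h φ hφ

theorem IsTest.mem_energySpace {φ : Sp d × ℝ → ℝ} (h : IsTest Ω T φ) :
    mkPair h.isLatTest.memL2 h.isLatTest.memL2_gradX ∈ energySpace Ω T :=
  subset_closure ⟨φ, h, rfl⟩

/-- The norm contains no time derivative, so multiplying by `timeCut` changes (φ, ∇φ) arbitrarily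
little, by dominated convergence. Hence functions vanishing only near the lateral boundary and
functions in C_c^∞(Q) have the same closure. -/
theorem IsLatTest.mem_energySpace (hT : 0 < T) {φ : Sp d × ℝ → ℝ} (h : IsLatTest Ω φ) :
    mkPair (T := T) h.memL2 h.memL2_gradX ∈ energySpace Ω T := by
  let χ : ℕ → C(ℝ, ℝ) := fun n => ⟨timeCut T n, (contDiff_timeCut T n).continuous⟩
  have ht : ∀ n, IsTest Ω T (fun z => timeCut T n z.2 * φ z) := fun n =>
    h.mul_time (contDiff_timeCut T n) (tsupport_timeCut hT n)
  have hlim : ∀ᵐ z ∂(muQ Ω T), Tendsto (fun n => χ n z.2) atTop (𝓝 1) := by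
    have : ∀ᵐ t ∂(volume.restrict (Ioo 0 T)), Tendsto (fun n => χ n t) atTop (𝓝 1) := by
      filter_upwards [ae_restrict_mem measurableSet_Ioo] with t ht
      exact tendsto_timeCut hT ht
    rw [muQ_eq_prod]
    exact Measure.quasiMeasurePreserving_snd.ae this
  have h1 := tendsto_mulL (fun n => memLp_top_snd Ω T (χ n)) (fun n z => abs_timeCut_le T n z.2)
    hlim (MemLp.toLp φ h.memL2)
  have h2 := tendsto_mulL (fun n => memLp_top_snd Ω T (χ n)) (fun n z => abs_timeCut_le T n z.2)
    hlim (MemLp.toLp (gradX φ) h.memL2_gradX)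
  have h3 := ((WithLp.prod_continuous_toLp 2 _ _).tendsto _).comp (h1.prodMk_nhds h2)
  refine isClosed_energySpace.mem_of_tendsto h3 (Eventually.of_forall fun n => ?_)
  have h4 := (ht n).mem_energySpace
  refine Set.mem_of_eq_of_mem ?_ h4
  refine (WithLp.ext_iff 2).2 (Prod.ext ?_ ?_)
  · exact mulL_toLp _ h.memL2
  · refine (mulL_toLp _ h.memL2_gradX).trans (MemLp.toLp_congr _ (ht n).isLatTest.memL2_gradX ?_)
    refine Eventually.of_forall fun z => ?_
    exact (gradX_mul_time (h.1.differentiable (by simp))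
      ((contDiff_timeCut T n).differentiable (by simp)) z).symm

theorem norm_pair_le (x : PairSp Ω T) :
    ‖x‖ ≤ ‖x.fst‖ + ‖x.snd‖ := by
  refine (sq_le_sq₀ (norm_nonneg _) (by positivity)).1 ?_
  rw [WithLp.prod_norm_sq_eq_of_L2]
  nlinarith [norm_nonneg x.fst, norm_nonneg x.snd]

end EnergySpace

/-! ### Weak derivatives and the identification of H^{1,0}_0(Q) with the energy space -/

section WeakDerivatives

variable {d : ℕ} {Ω : Set (Sp d)} {T : ℝ}

theorem isOpen_cyl (hΩ : IsOpen Ω) : IsOpen (cyl Ω T) := hΩ.prod isOpen_Ioo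

theorem memLp_component {g : Sp d × ℝ → Sp d} (hg : MemLp g 2 (muQ Ω T)) (i : Fin d) :
    MemLp (fun z => g z i) 2 (muQ Ω T) :=
  (EuclideanSpace.proj (𝕜 := ℝ) i).comp_memLp' hg

section FiniteMeasure

variable [IsFiniteMeasure ((volume : Measure (Sp d)).restrict Ω)]

/-- The fundamental lemma of the calculus of variations on `Q`. -/
theorem ae_eq_of_integral_test (hΩ : IsOpen Ω) {f g : Sp d × ℝ → ℝ} (hf : MemLp f 2 (muQ Ω T))
    (hg : MemLp g 2 (muQ Ω T))
    (h : ∀ φ, IsTest Ω T φ → ∫ z, f z * φ z ∂(muQ Ω T) = ∫ z, g z * φ z ∂(muQ Ω T)) :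
    f =ᵐ[muQ Ω T] g := by
  have hQ := isOpen_cyl (T := T) hΩ
  have hint : IntegrableOn (f - g) (cyl Ω T) volume := (hf.sub hg).integrable one_le_two
  have key := hQ.ae_eq_zero_of_integral_contDiff_smul_eq_zero hint.locallyIntegrableOn
    fun φ h1 h2 h3 => by
      have ht : IsTest Ω T φ := ⟨h1, h2, h3⟩
      rw [← integral_muQ_of_support (Ω := Ω) (T := T) fun z hz => by
        rw [ht.eq_zero hz, zero_smul]]
      have e1 : Integrable (fun z => f z * φ z) (muQ Ω T) :=
        hf.integrable_mul ht.isLatTest.memL2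
      have e2 : Integrable (fun z => g z * φ z) (muQ Ω T) :=
        hg.integrable_mul ht.isLatTest.memL2
      have e3 := integral_sub e1 e2
      rw [h φ ht, sub_self] at e3
      rw [← e3]
      refine integral_congr_ae (Eventually.of_forall fun z => ?_)
      simp only [Pi.sub_apply, smul_eq_mul]
      ring
  rw [← ae_restrict_iff' hQ.measurableSet] at key
  filter_upwards [key] with z hz
  exact sub_eq_zero.1 hz

theorem IsWeakGrad.ae_eq (hΩ : IsOpen Ω) {u : Sp d × ℝ → ℝ} {g g' : Sp d × ℝ → Sp d}
    (h : IsWeakGrad Ω T u g) (h' : IsWeakGrad Ω T u g') : g =ᵐ[muQ Ω T] g' := by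
  have : ∀ i, (fun z => g z i) =ᵐ[muQ Ω T] fun z => g' z i := fun i =>
    ae_eq_of_integral_test hΩ (memLp_component h.1 i) (memLp_component h'.1 i) fun φ hφ => by
      rw [← neg_inj, ← h.2 φ hφ i, ← h'.2 φ hφ i]
  filter_upwards [ae_all_iff.2 this] with z hz
  ext i
  exact hz i

theorem IsWeakDt.ae_eq (hΩ : IsOpen Ω) {u g g' : Sp d × ℝ → ℝ}
    (h : IsWeakDt Ω T u g) (h' : IsWeakDt Ω T u g') : g =ᵐ[muQ Ω T] g' :=
  ae_eq_of_integral_test hΩ h.1 h'.1 fun φ hφ => by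
    rw [← neg_inj, ← h.2 φ hφ, ← h'.2 φ hφ]

theorem IsWeakDiv.ae_eq (hΩ : IsOpen Ω) {τ : Sp d × ℝ → Sp d} {g g' : Sp d × ℝ → ℝ}
    (h : IsWeakDiv Ω T τ g) (h' : IsWeakDiv Ω T τ g') : g =ᵐ[muQ Ω T] g' :=
  ae_eq_of_integral_test hΩ h.1 h'.1 fun φ hφ => by
    rw [← neg_inj, ← h.2 φ hφ, ← h'.2 φ hφ]

end FiniteMeasure

theorem isWeakGrad_weakGrad {u : Sp d × ℝ → ℝ} (h : ∃ g, IsWeakGrad Ω T u g) :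
    IsWeakGrad Ω T u (weakGrad Ω T u) := by
  rw [weakGrad, dif_pos h]
  exact h.choose_spec

theorem isWeakDt_weakDt {u : Sp d × ℝ → ℝ} (h : ∃ g, IsWeakDt Ω T u g) :
    IsWeakDt Ω T u (weakDt Ω T u) := by
  rw [weakDt, dif_pos h]
  exact h.choose_spec

theorem isWeakDiv_weakDiv {τ : Sp d × ℝ → Sp d} (h : ∃ g, IsWeakDiv Ω T τ g) :
    IsWeakDiv Ω T τ (weakDiv Ω T τ) := by
  rw [weakDiv, dif_pos h]
  exact h.choose_spec

theorem integral_congr_left {u v w : Sp d × ℝ → ℝ} (h : u =ᵐ[muQ Ω T] v) :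
    ∫ z, u z * w z ∂(muQ Ω T) = ∫ z, v z * w z ∂(muQ Ω T) :=
  integral_congr_ae (by filter_upwards [h] with z hz; rw [hz])

/-- The predicate `IsWeakGrad` sees u only under integrals, so it is the same predicate for u and v
and the choice returns literally the same function, not only one that agrees almost everywhere. -/
theorem weakGrad_congr {u v : Sp d × ℝ → ℝ} (h : u =ᵐ[muQ Ω T] v) :
    weakGrad Ω T u = weakGrad Ω T v := by
  have : IsWeakGrad Ω T u = IsWeakGrad Ω T v := by
    ext g
    simp only [IsWeakGrad, integral_congr_left h]
  unfold weakGrad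
  rw [this]

theorem weakDt_congr {u v : Sp d × ℝ → ℝ} (h : u =ᵐ[muQ Ω T] v) :
    weakDt Ω T u = weakDt Ω T v := by
  have : IsWeakDt Ω T u = IsWeakDt Ω T v := by
    ext g
    simp only [IsWeakDt, integral_congr_left h]
  unfold weakDt
  rw [this]

theorem normQ_congr {F : Type*} [NormedAddCommGroup F] {f g : Sp d × ℝ → F}
    (h : f =ᵐ[muQ Ω T] g) : normQ Ω T f = normQ Ω T g := by
  rw [normQ, normQ]
  congr 1
  exact integral_congr_ae (by filter_upwards [h] with z hz; rw [hz])

theorem MemH10Zero.memL2_weakGrad {u : Sp d × ℝ → ℝ} (h : MemH10Zero Ω T u) :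
    MemLp (weakGrad Ω T u) 2 (muQ Ω T) :=
  (isWeakGrad_weakGrad h.1.2).1

theorem MemH10Zero.memL2 {u : Sp d × ℝ → ℝ} (h : MemH10Zero Ω T u) : MemLp u 2 (muQ Ω T) := h.1.1

theorem MemH10Zero.congr {u v : Sp d × ℝ → ℝ} (h : u =ᵐ[muQ Ω T] v) (hu : MemH10Zero Ω T u) :
    MemH10Zero Ω T v := by
  refine ⟨⟨hu.memL2.ae_eq h, ?_⟩, fun ε hε => ?_⟩
  · obtain ⟨g, hg⟩ := hu.1.2
    refine ⟨g, hg.1, fun φ hφ i => ?_⟩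
    rw [← hg.2 φ hφ i, integral_congr_left h]
  · obtain ⟨φ, h1, h2, h3, h4, h5⟩ := hu.2 ε hε
    refine ⟨φ, h1, h2, h3, ?_, ?_⟩
    · have hc : (fun z => u z - φ z) =ᵐ[muQ Ω T] fun z => v z - φ z := by
        filter_upwards [h] with z hz
        rw [hz]
      rwa [← normQ_congr hc]
    · rwa [← weakGrad_congr h]

theorem MemH10Zero.mkPair_mem (hT : 0 < T) {u : Sp d × ℝ → ℝ} (h : MemH10Zero Ω T u) :
    mkPair h.memL2 h.memL2_weakGrad ∈ energySpace Ω T := by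
  have hc : mkPair h.memL2 h.memL2_weakGrad ∈ closure (energySpace Ω T : Set (PairSp Ω T)) := by
    rw [Metric.mem_closure_iff]
    intro ε hε
    obtain ⟨φ, h1, h2, h3, h4, h5⟩ := h.2 (ε / 2) (by positivity)
    have hl : IsLatTest Ω φ := ⟨h1, h2, h3⟩
    refine ⟨_, hl.mem_energySpace hT, ?_⟩
    rw [dist_eq_norm]
    refine (norm_pair_le _).trans_lt ?_
    have e1 : (mkPair h.memL2 h.memL2_weakGrad - mkPair hl.memL2 hl.memL2_gradX).fst =
        (h.memL2.sub hl.memL2).toLp _ := (MemLp.toLp_sub h.memL2 hl.memL2).symm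
    have e2 : (mkPair h.memL2 h.memL2_weakGrad - mkPair hl.memL2 hl.memL2_gradX).snd =
        (h.memL2_weakGrad.sub hl.memL2_gradX).toLp _ :=
      (MemLp.toLp_sub h.memL2_weakGrad hl.memL2_gradX).symm
    rw [e1, e2, ← normQ_eq_norm_toLp (h.memL2.sub hl.memL2),
      ← normQ_eq_norm_toLp (h.memL2_weakGrad.sub hl.memL2_gradX)]
    have := add_lt_add h4 h5
    rwa [add_halves] at this
  rwa [isClosed_energySpace.closure_eq] at hc

theorem memLp_smul_single {φ : Sp d × ℝ → ℝ} (h : MemLp φ 2 (muQ Ω T)) (i : Fin d) :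
    MemLp (fun z => φ z • EuclideanSpace.single i (1 : ℝ)) 2 (muQ Ω T) :=
  (ContinuousLinearMap.toSpanSingleton ℝ (EuclideanSpace.single i (1 : ℝ))).comp_memLp' h

/-- For fixed φ and i the defining identity is the vanishing of a continuous functional of the pair,
and for test functions it is classical integration by parts. -/
theorem isWeakGrad_of_mem_energySpace {x : PairSp Ω T} (hx : x ∈ energySpace Ω T) :
    IsWeakGrad Ω T x.fst x.snd := by
  refine ⟨Lp.memLp x.snd, fun φ hφ i => ?_⟩
  have hl := hφ.isLatTest
  have m1 := memLp_component (hl.memL2_gradX (T := T)) i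
  have m2 := memLp_smul_single (hl.memL2 (T := T)) i
  let L : PairSp Ω T → ℝ := fun x => ⟪x.fst, m1.toLp _⟫ + ⟪x.snd, m2.toLp _⟫
  have hL : Continuous L :=
    (((WithLp.fstL 2 ℝ _ _).continuous).inner continuous_const).add
      (((WithLp.sndL 2 ℝ _ _).continuous).inner continuous_const)
  have key : x ∈ L ⁻¹' {0} := by
    refine energySpace_subset (isClosed_singleton.preimage hL) (fun ψ hψ => ?_) hx
    change ⟪MemLp.toLp ψ hψ.isLatTest.memL2, m1.toLp _⟫ +
      ⟪MemLp.toLp (gradX ψ) hψ.isLatTest.memL2_gradX, m2.toLp _⟫ = 0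
    rw [inner_toLp_real, inner_toLp]
    have := integral_mul_fderiv_test hψ.1 hφ (EuclideanSpace.single i 1, 0)
    rw [← eq_neg_iff_add_eq_zero]
    refine Eq.trans this ?_
    congr 2
    ext z
    rw [real_inner_smul_right, EuclideanSpace.inner_single_right]
    simp [gradX_apply, mul_comm]
  have e : L x = ∫ z, x.fst z * gradX φ z i ∂(muQ Ω T) + ∫ z, x.snd z i * φ z ∂(muQ Ω T) := by
    have h1 := inner_toLp_real (Lp.memLp x.fst) m1
    have h2 := inner_toLp (Lp.memLp x.snd) m2
    rw [Lp.toLp_coeFn] at h1 h2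
    change ⟪x.fst, m1.toLp _⟫ + ⟪x.snd, m2.toLp _⟫ = _
    rw [h1, h2]
    congr 2
    ext z
    rw [real_inner_smul_right, EuclideanSpace.inner_single_right]
    simp [mul_comm]
  have h0 : L x = 0 := key
  rw [e] at h0
  exact eq_neg_of_add_eq_zero_left h0

/-- Flux identity: a weak divergence can be tested with functions of `H^{1,0}_0(Q)`. -/
theorem IsWeakDiv.inner_energySpace {τ : Sp d × ℝ → Sp d} {g : Sp d × ℝ → ℝ}
    (hτ : MemLp τ 2 (muQ Ω T)) (hg : MemLp g 2 (muQ Ω T)) (h : IsWeakDiv Ω T τ g) {x : PairSp Ω T}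
    (hx : x ∈ energySpace Ω T) :
    ⟪hτ.toLp τ, x.snd⟫ = - ⟪hg.toLp g, x.fst⟫ := by
  have hcl : IsClosed {x : PairSp Ω T | ⟪hτ.toLp τ, x.snd⟫ = - ⟪hg.toLp g, x.fst⟫} :=
    isClosed_eq (continuous_const.inner (WithLp.sndL 2 ℝ _ _).continuous)
      (continuous_const.inner (WithLp.fstL 2 ℝ _ _).continuous).neg
  refine energySpace_subset hcl (fun φ hφ => ?_) hx
  change ⟪hτ.toLp τ, MemLp.toLp (gradX φ) hφ.isLatTest.memL2_gradX⟫ =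
    - ⟪hg.toLp g, MemLp.toLp φ hφ.isLatTest.memL2⟫
  exact (inner_toLp _ _).trans ((h.2 φ hφ).trans (congrArg _ (inner_toLp_real _ _).symm))

variable [IsFiniteMeasure ((volume : Measure (Sp d)).restrict Ω)]

theorem weakGrad_of_mem_energySpace (hΩ : IsOpen Ω) {x : PairSp Ω T} (hx : x ∈ energySpace Ω T) :
    weakGrad Ω T x.fst =ᵐ[muQ Ω T] x.snd :=
  (isWeakGrad_weakGrad ⟨_, isWeakGrad_of_mem_energySpace hx⟩).ae_eq hΩ
    (isWeakGrad_of_mem_energySpace hx)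

/-- Converse of `MemH10Zero.mkPair_mem`: approximation in the norm of the pair controls both
distances, and the second component is the weak gradient by uniqueness. -/
theorem memH10Zero_of_mem_energySpace (hΩ : IsOpen Ω) {x : PairSp Ω T}
    (hx : x ∈ energySpace Ω T) : MemH10Zero Ω T x.fst := by
  refine ⟨⟨Lp.memLp _, _, isWeakGrad_of_mem_energySpace hx⟩, fun ε hε => ?_⟩
  obtain ⟨y, ⟨φ, hφ, rfl⟩, hy⟩ := Metric.mem_closure_iff.1 hx ε hε
  have hl := hφ.isLatTest
  rw [dist_eq_norm] at hy
  have hw := (isWeakGrad_weakGrad ⟨_, isWeakGrad_of_mem_energySpace hx⟩).1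
  refine ⟨φ, hφ.1, hφ.2.1, hl.2.2, ?_, ?_⟩
  · refine lt_of_le_of_lt (normQ_eq_norm_toLp ((Lp.memLp x.fst).sub hl.memL2)).le ?_
    refine lt_of_le_of_lt ?_ hy
    have e1 : ((Lp.memLp x.fst).sub hl.memL2).toLp _ =
        (x - mkPair hl.memL2 hl.memL2_gradX).fst := by
      rw [MemLp.toLp_sub (Lp.memLp x.fst) hl.memL2, Lp.toLp_coeFn]; rfl
    exact (congrArg norm e1).le.trans (WithLp.norm_fst_le _ _)
  · have hc : (fun z => weakGrad Ω T x.fst z - gradX φ z) =ᵐ[muQ Ω T] ⇑x.snd - gradX φ := by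
      filter_upwards [weakGrad_of_mem_energySpace hΩ hx] with z hz
      rw [hz]; rfl
    rw [normQ_congr hc, normQ_eq_norm_toLp ((Lp.memLp x.snd).sub hl.memL2_gradX)]
    refine lt_of_le_of_lt ?_ hy
    have e1 : ((Lp.memLp x.snd).sub hl.memL2_gradX).toLp _ =
        (x - mkPair hl.memL2 hl.memL2_gradX).snd := by
      rw [MemLp.toLp_sub (Lp.memLp x.snd) hl.memL2_gradX, Lp.toLp_coeFn]; rfl
    exact (congrArg norm e1).le.trans (WithLp.norm_snd_le _ _)

end WeakDerivatives

/-! ### Friedrichs' inequality -/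

section Friedrichs

variable {d : ℕ} {Ω : Set (Sp d)} {T : ℝ}

/-- Since ∂ᵢxᵢ = 1, integrate φ² = φ² ∂ᵢxᵢ by parts. On a bounded Ω the factor xᵢ is bounded, and
Cauchy–Schwarz gives Friedrichs' inequality with constant 2R. -/
theorem integral_sq_test {φ : Sp d × ℝ → ℝ} (h : IsTest Ω T φ) (i : Fin d) :
    ∫ z, φ z ^ 2 ∂(muQ Ω T) = - ∫ z, (2 * z.1 i * φ z) * gradX φ z i ∂(muQ Ω T) := by
  have hf : ContDiff ℝ ∞ fun z : Sp d × ℝ => z.1 i * φ z :=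
    (((EuclideanSpace.proj (𝕜 := ℝ) i).contDiff).comp contDiff_fst).mul h.1
  have h1 := integral_mul_fderiv_test hf h (EuclideanSpace.single i 1, 0)
  have hx : ∀ z : Sp d × ℝ, HasFDerivAt (fun z : Sp d × ℝ => z.1 i)
      ((EuclideanSpace.proj (𝕜 := ℝ) i).comp (ContinuousLinearMap.fst ℝ (Sp d) ℝ)) z := fun z =>
    ((EuclideanSpace.proj (𝕜 := ℝ) i).comp
      (ContinuousLinearMap.fst ℝ (Sp d) ℝ)).hasFDerivAt (x := z)
  have h2 : ∀ z, fderiv ℝ (fun z : Sp d × ℝ => z.1 i * φ z) z (EuclideanSpace.single i 1, 0)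
      = z.1 i * gradX φ z i + φ z := fun z => by
    have := (hx z).fun_mul (h.1.differentiable (by simp) z).hasFDerivAt
    rw [this.fderiv]
    simp [gradX_apply]
  simp only [h2] at h1
  have hc1 : Continuous fun z : Sp d × ℝ => z.1 i :=
    (EuclideanSpace.proj (𝕜 := ℝ) i).continuous.comp continuous_fst
  have hc2 : Continuous fun z : Sp d × ℝ => gradX φ z i :=
    (EuclideanSpace.proj (𝕜 := ℝ) i).continuous.comp (continuous_gradX h.1)
  have hφ := h.1.continuous
  have i1 : Integrable (fun z : Sp d × ℝ => z.1 i * φ z * gradX φ z i) (muQ Ω T) :=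
    (((hc1.mul hφ).mul hc2).integrable_of_hasCompactSupport
      (h.2.1.mul_left.mul_right) (μ := volume)).restrict
  have i2 : Integrable (fun z : Sp d × ℝ => φ z ^ 2) (muQ Ω T) := by
    have := ((hφ.mul hφ).integrable_of_hasCompactSupport h.2.1.mul_left (μ := volume)).restrict
      (s := cyl Ω T)
    simpa only [sq] using! this
  have h3 : ∫ z, (z.1 i * gradX φ z i + φ z) * φ z ∂(muQ Ω T) =
      ∫ z, z.1 i * φ z * gradX φ z i ∂(muQ Ω T) + ∫ z, φ z ^ 2 ∂(muQ Ω T) := by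
    rw [← integral_add i1 i2]
    congr 1; ext z; ring
  rw [h3] at h1
  have h4 : ∫ z, (2 * z.1 i * φ z) * gradX φ z i ∂(muQ Ω T) =
      2 * ∫ z, z.1 i * φ z * gradX φ z i ∂(muQ Ω T) := by
    rw [← integral_const_mul]
    congr 1; ext z; ring
  change ∫ z, z.1 i * φ z * gradX φ z i ∂(muQ Ω T) = _ at h1
  rw [h4]
  linarith

/-- Friedrichs' inequality. -/
theorem exists_friedrichs (hd : 1 ≤ d) (hΩ : IsOpen Ω) (hΩb : Bornology.IsBounded Ω) :
    ∃ C : ℝ, 0 < C ∧ ∀ x ∈ energySpace Ω T, ‖x.fst‖ ≤ C * ‖x.snd‖ := by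
  obtain ⟨R, hR0, hR⟩ := hΩb.exists_pos_norm_le
  refine ⟨2 * R, by positivity, fun x hx => ?_⟩
  have hcl : IsClosed {x : PairSp Ω T | ‖x.fst‖ ≤ 2 * R * ‖x.snd‖} :=
    isClosed_le (WithLp.fstL 2 ℝ _ _).continuous.norm
      (continuous_const.mul (WithLp.sndL 2 ℝ _ _).continuous.norm)
  refine energySpace_subset hcl (fun φ hφ => ?_) hx
  -- One coordinate direction is enough; this is where d ≥ 1 enters.
  let i : Fin d := ⟨0, hd⟩
  have m1 := hφ.isLatTest.memL2 (T := T)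
  have m2 := hφ.isLatTest.memL2_gradX (T := T)
  change ‖m1.toLp φ‖ ≤ 2 * R * ‖m2.toLp _‖
  have hz : ∀ᵐ z ∂(muQ Ω T), ‖z.1 i‖ ≤ R := by
    have : ∀ᵐ x ∂(volume.restrict Ω), ‖x i‖ ≤ R := by
      filter_upwards [ae_restrict_mem hΩ.measurableSet] with x hx
      exact (PiLp.norm_apply_le x i).trans (hR x hx)
    exact ae_fst this
  have h1 : ‖m1.toLp φ‖ ^ 2 ≤ 2 * R * ∫ z, ‖φ z‖ * ‖gradX φ z‖ ∂(muQ Ω T) := by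
    rw [norm_sq_toLp]
    simp only [Real.norm_eq_abs, sq_abs]
    rw [integral_sq_test hφ i, ← integral_const_mul]
    refine (neg_le_abs _).trans ((abs_integral_le_integral_abs).trans ?_)
    refine integral_mono_of_nonneg (Eventually.of_forall fun z => abs_nonneg _)
      ((m1.norm.integrable_mul m2.norm).const_mul _) ?_
    filter_upwards [hz] with z hz
    have h3 := PiLp.norm_apply_le (gradX φ z) i
    simp only [Real.norm_eq_abs, abs_mul, abs_two] at hz h3 ⊢
    calc 2 * |z.1 i| * |φ z| * |gradX φ z i| ≤ 2 * R * |φ z| * ‖gradX φ z‖ := by gcongr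
      _ = _ := by ring
  have h2 : ∫ z, ‖φ z‖ * ‖gradX φ z‖ ∂(muQ Ω T) ≤ ‖m1.toLp φ‖ * ‖m2.toLp _‖ := by
    have e1 := inner_toLp_real m1.norm m2.norm
    rw [← e1]
    refine (real_inner_le_norm _ _).trans (le_of_eq ?_)
    rw [Lp.norm_toLp, Lp.norm_toLp, Lp.norm_toLp, Lp.norm_toLp, eLpNorm_norm, eLpNorm_norm]
  rcases (norm_nonneg (m1.toLp φ)).eq_or_lt with h0 | h0
  · rw [← h0]; positivity
  · have h3 := h1.trans (mul_le_mul_of_nonneg_left h2 (by positivity))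
    refine le_of_mul_le_mul_right ?_ h0
    nlinarith

end Friedrichs

/-! ### Real Fourier series on (0,T) -/

section Fourier

variable {T : ℝ}

/-- The cosine coefficient of a function of time. -/
def cosCoef (T : ℝ) (f : ℝ → ℝ) (k : ℕ) : ℝ :=
  2 / T * ∫ t in (0 : ℝ)..T, f t * Real.cos (k * freq T * t)

/-- The sine coefficient of a function of time. -/
def sinCoef (T : ℝ) (f : ℝ → ℝ) (k : ℕ) : ℝ :=
  2 / T * ∫ t in (0 : ℝ)..T, f t * Real.sin (k * freq T * t)

theorem fourier_eq_cos_sin (n : ℤ) (t : ℝ) :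
    (fourier (-n) (t : AddCircle T) : ℂ) =
      Real.cos (n * freq T * t) - Real.sin (n * freq T * t) * Complex.I := by
  have h : (2 * Real.pi * Complex.I * ((-n : ℤ) : ℂ) * t / T : ℂ) =
      ((-(n * freq T * t) : ℝ) : ℂ) * Complex.I := by
    rw [freq]; push_cast; ring
  rw [fourier_coe_apply, h, Complex.exp_mul_I, ← Complex.ofReal_cos, ← Complex.ofReal_sin,
    Real.cos_neg, Real.sin_neg]
  push_cast
  ring

theorem intervalIntegrable_mul_continuous {f : ℝ → ℝ}
    (hf : IntervalIntegrable f volume 0 T) {e : ℝ → ℝ} (he : Continuous e) :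
    IntervalIntegrable (fun t => f t * e t) volume 0 T :=
  hf.mul_continuousOn he.continuousOn

theorem continuous_cos_freq (k T : ℝ) : Continuous fun t => Real.cos (k * freq T * t) :=
  Real.continuous_cos.comp (continuous_const.mul continuous_id)

theorem continuous_sin_freq (k T : ℝ) : Continuous fun t => Real.sin (k * freq T * t) :=
  Real.continuous_sin.comp (continuous_const.mul continuous_id)

/-- For n ≥ 0 the complex coefficient is half of the cosine coefficient minus i times half of the
sine coefficient, which carries Parseval's identity over to real functions. -/
theorem fourierCoeffOn_eq (hT : 0 < T) {f : ℝ → ℝ} (hf : IntervalIntegrable f volume 0 T)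
    (n : ℤ) :
    fourierCoeffOn hT (fun t => (f t : ℂ)) n =
      ((1 / T * ∫ t in (0 : ℝ)..T, f t * Real.cos (n * freq T * t) : ℝ) : ℂ)
        - ((1 / T * ∫ t in (0 : ℝ)..T, f t * Real.sin (n * freq T * t) : ℝ) : ℂ) * Complex.I := by
  have h1 := intervalIntegrable_mul_continuous hf (continuous_cos_freq n T)
  have h2 := intervalIntegrable_mul_continuous hf (continuous_sin_freq n T)
  rw [fourierCoeffOn_eq_integral]
  have h3 : ∀ t : ℝ, (fourier (-n) (t : AddCircle (T - 0)) : ℂ) • (f t : ℂ) =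
      ((f t * Real.cos (n * freq T * t) : ℝ) : ℂ)
        - ((f t * Real.sin (n * freq T * t) : ℝ) : ℂ) * Complex.I := fun t => by
    rw [fourier_eq_cos_sin, smul_eq_mul, sub_zero]
    push_cast
    ring
  simp only [h3, sub_zero]
  have h1' : IntervalIntegrable (fun t => ((f t * Real.cos (n * freq T * t) : ℝ) : ℂ)) volume 0 T :=
    ⟨h1.1.ofReal, h1.2.ofReal⟩
  have h2' : IntervalIntegrable (fun t => ((f t * Real.sin (n * freq T * t) : ℝ) : ℂ)) volume 0 T :=
    ⟨h2.1.ofReal, h2.2.ofReal⟩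
  rw [intervalIntegral.integral_sub h1' (h2'.mul_const _),
    intervalIntegral.integral_mul_const, intervalIntegral.integral_ofReal,
    intervalIntegral.integral_ofReal, Complex.real_smul]
  push_cast
  ring

theorem norm_sq_fourierCoeffOn (hT : 0 < T) {f : ℝ → ℝ} (hf : IntervalIntegrable f volume 0 T)
    (n : ℤ) :
    ‖fourierCoeffOn hT (fun t => (f t : ℂ)) n‖ ^ 2 =
      (1 / T * ∫ t in (0 : ℝ)..T, f t * Real.cos (n * freq T * t)) ^ 2
        + (1 / T * ∫ t in (0 : ℝ)..T, f t * Real.sin (n * freq T * t)) ^ 2 := by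
  rw [fourierCoeffOn_eq hT hf, ← Complex.normSq_eq_norm_sq, Complex.normSq_apply]
  simp
  ring

/-- Parseval's identity for real functions. -/
theorem hasSum_coef_sq (hT : 0 < T) {f : ℝ → ℝ} (hf : MemLp f 2 (volume.restrict (Ioo 0 T))) :
    HasSum (fun k => T / 2 * (cosCoef T f k ^ 2 + sinCoef T f k ^ 2))
      ((∫ t in Ioo 0 T, f t ^ 2) + T / 4 * cosCoef T f 0 ^ 2) := by
  rw [restrict_Ioo_eq_restrict_Ioc] at hf ⊢
  have hfi : IntervalIntegrable f volume 0 T :=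
    (intervalIntegrable_iff_integrableOn_Ioc_of_le hT.le).2 (hf.integrable one_le_two)
  have hfC : MemLp (fun t => (f t : ℂ)) 2 (volume.restrict (Ioc 0 T)) := hf.ofReal
  -- Pairing n with -n counts n = 0 twice; this is the origin of the extra term T/4 · `cosCoef T f 0
  -- ^ 2`.
  have h := (hasSum_sq_fourierCoeffOn hT hfC).nat_add_neg.mul_left T
  have hn : ∀ k : ℕ, T * (‖fourierCoeffOn hT (fun t => (f t : ℂ)) k‖ ^ 2
      + ‖fourierCoeffOn hT (fun t => (f t : ℂ)) (-k)‖ ^ 2) =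
      T / 2 * (cosCoef T f k ^ 2 + sinCoef T f k ^ 2) := fun k => by
    rw [norm_sq_fourierCoeffOn hT hfi, norm_sq_fourierCoeffOn hT hfi, cosCoef, sinCoef]
    push_cast
    simp only [neg_mul, Real.cos_neg, Real.sin_neg, mul_neg, intervalIntegral.integral_neg]
    ring
  simp only [hn] at h
  refine (congrArg (HasSum _) ?_).mpr h
  rw [norm_sq_fourierCoeffOn hT hfi, cosCoef]
  simp only [Complex.norm_real, Real.norm_eq_abs, sq_abs, sub_zero, smul_eq_mul]
  rw [intervalIntegral.integral_of_le hT.le, intervalIntegral.integral_of_le hT.le,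
    intervalIntegral.integral_of_le hT.le]
  simp
  field_simp
  ring

theorem cosCoef_add {f h : ℝ → ℝ} (hf : IntervalIntegrable f volume 0 T)
    (hh : IntervalIntegrable h volume 0 T) (k : ℕ) :
    cosCoef T (fun t => f t + h t) k = cosCoef T f k + cosCoef T h k := by
  simp only [cosCoef, add_mul]
  rw [intervalIntegral.integral_add (intervalIntegrable_mul_continuous hf (continuous_cos_freq k T))
    (intervalIntegrable_mul_continuous hh (continuous_cos_freq k T)), mul_add]

theorem sinCoef_add {f h : ℝ → ℝ} (hf : IntervalIntegrable f volume 0 T)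
    (hh : IntervalIntegrable h volume 0 T) (k : ℕ) :
    sinCoef T (fun t => f t + h t) k = sinCoef T f k + sinCoef T h k := by
  simp only [sinCoef, add_mul]
  rw [intervalIntegral.integral_add (intervalIntegrable_mul_continuous hf (continuous_sin_freq k T))
    (intervalIntegrable_mul_continuous hh (continuous_sin_freq k T)), mul_add]

theorem cosCoef_neg (f : ℝ → ℝ) (k : ℕ) : cosCoef T (fun t => - f t) k = - cosCoef T f k := by
  simp [cosCoef]

theorem sinCoef_neg (f : ℝ → ℝ) (k : ℕ) : sinCoef T (fun t => - f t) k = - sinCoef T f k := by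
  simp [sinCoef]

theorem intervalIntegrable_of_memLp (hT : 0 < T) {f : ℝ → ℝ}
    (hf : MemLp f 2 (volume.restrict (Ioo 0 T))) : IntervalIntegrable f volume 0 T := by
  rw [restrict_Ioo_eq_restrict_Ioc] at hf
  exact (intervalIntegrable_iff_integrableOn_Ioc_of_le hT.le).2 (hf.integrable one_le_two)

/-- Polarization of Parseval's identity, applied to f + h and f - h. -/
theorem hasSum_coef_mul (hT : 0 < T) {f h : ℝ → ℝ} (hf : MemLp f 2 (volume.restrict (Ioo 0 T)))
    (hh : MemLp h 2 (volume.restrict (Ioo 0 T))) :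
    HasSum (fun k => T / 2 * (cosCoef T f k * cosCoef T h k + sinCoef T f k * sinCoef T h k))
      ((∫ t in Ioo 0 T, f t * h t) + T / 4 * (cosCoef T f 0 * cosCoef T h 0)) := by
  have if' := intervalIntegrable_of_memLp hT hf
  have ih := intervalIntegrable_of_memLp hT hh
  have h1 := hasSum_coef_sq hT (hf.add hh)
  have h2 := hasSum_coef_sq hT (hf.add hh.neg)
  have h3 := (h1.sub h2).mul_left (1 / 4)
  have c1 : ∀ k, cosCoef T (f + h) k = cosCoef T f k + cosCoef T h k := cosCoef_add if' ih
  have s1 : ∀ k, sinCoef T (f + h) k = sinCoef T f k + sinCoef T h k := sinCoef_add if' ih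
  have c2 : ∀ k, cosCoef T (f + -h) k = cosCoef T f k - cosCoef T h k := fun k => by
    rw [sub_eq_add_neg, ← cosCoef_neg]; exact cosCoef_add if' ih.neg k
  have s2 : ∀ k, sinCoef T (f + -h) k = sinCoef T f k - sinCoef T h k := fun k => by
    rw [sub_eq_add_neg, ← sinCoef_neg]; exact sinCoef_add if' ih.neg k
  simp only [c1, s1, c2, s2] at h3
  have hk : ∀ k, T / 2 * (cosCoef T f k * cosCoef T h k + sinCoef T f k * sinCoef T h k) =
      1 / 4 * (T / 2 * ((cosCoef T f k + cosCoef T h k) ^ 2 + (sinCoef T f k + sinCoef T h k) ^ 2) -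
        T / 2 * ((cosCoef T f k - cosCoef T h k) ^ 2 + (sinCoef T f k - sinCoef T h k) ^ 2)) :=
    fun k => by ring
  simp only [hk]
  refine (congrArg (HasSum _) ?_).mpr h3
  · have e := integral_sub (hf.add hh).integrable_sq (hf.add hh.neg).integrable_sq
    have e2 : ∫ t in Ioo 0 T, f t * h t =
        1 / 4 * ∫ t in Ioo 0 T, ((f + h) t ^ 2 - (f + -h) t ^ 2) := by
      rw [← integral_const_mul]
      congr 1; ext t
      simp only [Pi.add_apply, Pi.neg_apply]
      ring
    rw [e2, e]
    ring

/-- Only the mean survives in Parseval's identity, so ∫f² = T c² with c the mean of f, and ∫(f - c)²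
= 0. -/
theorem ae_eq_const_of_coef_eq_zero (hT : 0 < T) {f : ℝ → ℝ}
    (hf : MemLp f 2 (volume.restrict (Ioo 0 T)))
    (hc : ∀ k, 1 ≤ k → cosCoef T f k = 0) (hs : ∀ k, sinCoef T f k = 0) :
    ∃ c : ℝ, f =ᵐ[volume.restrict (Ioo 0 T)] fun _ => c := by
  set c := cosCoef T f 0 / 2 with hc0
  have h1 := hasSum_coef_sq hT hf
  have h2 : HasSum (fun k => T / 2 * (cosCoef T f k ^ 2 + sinCoef T f k ^ 2))
      (T / 2 * (cosCoef T f 0 ^ 2 + sinCoef T f 0 ^ 2)) := by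
    refine hasSum_single 0 fun k hk => ?_
    rw [hc k (Nat.one_le_iff_ne_zero.2 hk), hs]; ring
  have h3 := h1.unique h2
  rw [hs] at h3
  have h4 : ∫ t in Ioo 0 T, f t = T * c := by
    rw [hc0, cosCoef, intervalIntegral.integral_of_le hT.le, integral_Ioc_eq_integral_Ioo]
    simp
    field_simp
  have hfi : Integrable f (volume.restrict (Ioo 0 T)) := hf.integrable one_le_two
  have h5 : ∫ t in Ioo 0 T, (f t - c) ^ 2 = 0 := by
    have e : ∀ t, (f t - c) ^ 2 = f t ^ 2 - 2 * c * f t + c ^ 2 := fun t => by ring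
    simp only [e]
    have e1 : Integrable (fun t => f t ^ 2 - 2 * c * f t) (volume.restrict (Ioo 0 T)) :=
      hf.integrable_sq.sub (hfi.const_mul _)
    rw [integral_add e1 (integrable_const _),
      integral_sub hf.integrable_sq (hfi.const_mul _), integral_const_mul, h4]
    have : cosCoef T f 0 = 2 * c := by rw [hc0]; ring
    rw [this] at h3
    simp only [integral_const, measureReal_restrict_apply_univ, Real.volume_real_Ioo_of_le hT.le,
      smul_eq_mul, sub_zero]
    linear_combination h3
  have h6 : MemLp (fun t => f t - c) 2 (volume.restrict (Ioo 0 T)) := hf.sub (memLp_const c)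
  rw [integral_eq_zero_iff_of_nonneg (fun t => sq_nonneg _) h6.integrable_sq] at h5
  refine ⟨c, ?_⟩
  filter_upwards [h5] with t ht
  exact sub_eq_zero.1 (pow_eq_zero_iff two_ne_zero |>.1 ht)

/-- Integration by parts for a primitive and a smooth function. -/
theorem integral_primitive_mul_deriv {g θ : ℝ → ℝ} (hg : IntervalIntegrable g volume 0 T)
    (hθ : ContDiff ℝ ∞ θ) :
    ∫ t in (0 : ℝ)..T, (∫ s in (0 : ℝ)..t, g s) * deriv θ t =
      (∫ s in (0 : ℝ)..T, g s) * θ T - ∫ t in (0 : ℝ)..T, g t * θ t := by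
  have h1 : AbsolutelyContinuousOnInterval (fun t => ∫ s in (0 : ℝ)..t, g s) 0 T :=
    hg.absolutelyContinuousOnInterval_intervalIntegral left_mem_uIcc
  have h2 : AbsolutelyContinuousOnInterval θ 0 T :=
    (hθ.of_le (by simp)).contDiffOn.absolutelyContinuousOnInterval
  rw [h1.integral_mul_deriv_eq_deriv_mul h2, intervalIntegral.integral_same, zero_mul, sub_zero]
  congr 1
  refine intervalIntegral.integral_congr_ae ?_
  filter_upwards [hg.ae_hasDerivAt_integral] with t ht htT
  rw [(ht (uIoc_subset_uIcc htT) 0 left_mem_uIcc).deriv]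

end Fourier

/-! ### Boundary terms produced by the time cutoffs -/

section EdgeLayer

variable {T : ℝ}

/-- A smooth transition from `0` to `1` in a layer at `t = 0`. -/
def edge (T : ℝ) (n : ℕ) (t : ℝ) : ℝ := Real.smoothTransition ((n + 4) * (t / T) - 1)

theorem timeCut_eq_edge (T : ℝ) (n : ℕ) :
    timeCut T n = fun t => edge T n t + edge T n (T - t) - 1 := rfl

theorem contDiff_edge (T : ℝ) (n : ℕ) : ContDiff ℝ ∞ (edge T n) :=
  Real.smoothTransition.contDiff.comp
    ((contDiff_const.mul (contDiff_id.div_const T)).sub contDiff_const)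

theorem monotone_edge (hT : 0 < T) (n : ℕ) : Monotone (edge T n) := fun s t h =>
  Real.smoothTransition.monotone (by gcongr)

theorem continuous_deriv_of_contDiff {θ : ℝ → ℝ} (h : ContDiff ℝ ∞ θ) : Continuous (deriv θ) :=
  h.continuous_deriv (by simp)

/-- The derivative of `edge` is nonnegative, has integral 1 on (0,T) and lives in a layer of width
at most 2T/(n+4) at 0, so it is an approximate identity there. -/
theorem tendsto_integral_mul_deriv_edge (hT : 0 < T) {h : ℝ → ℝ}
    (hc : ContinuousOn h (Icc 0 T)) :
    Tendsto (fun n => ∫ t in (0 : ℝ)..T, h t * deriv (edge T n) t) atTop (𝓝 (h 0)) := by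
  have hd : ∀ n, Differentiable ℝ (edge T n) := fun n => (contDiff_edge T n).differentiable (by simp)
  have hcd : ∀ n, Continuous (deriv (edge T n)) := fun n =>
    continuous_deriv_of_contDiff (contDiff_edge T n)
  have h1 : ∀ n, ∫ t in (0 : ℝ)..T, deriv (edge T n) t = 1 := fun n => by
    rw [intervalIntegral.integral_deriv_eq_sub (fun t _ => hd n t) ((hcd n).intervalIntegrable _ _),
      edge, edge, div_self hT.ne', Real.smoothTransition.one_of_one_le,
      Real.smoothTransition.zero_of_nonpos]
    · ring
    · simp
    · linarith [(Nat.cast_nonneg n : (0 : ℝ) ≤ n)]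
  have h0 : ∀ n t, 0 ≤ deriv (edge T n) t := fun n t => (monotone_edge hT n).deriv_nonneg
  have hu : ∀ g : ℝ → ℝ, ContinuousOn g (Icc 0 T) → ∀ n,
      IntervalIntegrable (fun t => g t * deriv (edge T n) t) volume 0 T := fun g hg n => by
    refine ContinuousOn.intervalIntegrable ?_
    rw [uIcc_of_le hT.le]
    exact hg.mul (hcd n).continuousOn
  rw [Metric.tendsto_atTop]
  intro ε hε
  have hc0 := hc 0 (left_mem_Icc.2 hT.le)
  obtain ⟨δ, hδ, hδh⟩ := Metric.continuousWithinAt_iff.1 hc0 (ε / 2) (by positivity)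
  obtain ⟨N, hN⟩ := exists_nat_ge (2 * T / δ)
  refine ⟨N, fun n hn => ?_⟩
  have e1 : h 0 = ∫ t in (0 : ℝ)..T, h 0 * deriv (edge T n) t := by
    rw [intervalIntegral.integral_const_mul, h1, mul_one]
  rw [Real.dist_eq, e1, ← intervalIntegral.integral_sub (hu h hc n)
    (hu (fun _ => h 0) continuousOn_const n)]
  have key : ∀ t ∈ Icc 0 T, |h t * deriv (edge T n) t - h 0 * deriv (edge T n) t| ≤
      ε / 2 * deriv (edge T n) t := by
    intro t ht
    rw [← sub_mul, abs_mul, abs_of_nonneg (h0 n t)]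
    by_cases htδ : t < δ
    · refine mul_le_mul_of_nonneg_right ?_ (h0 n t)
      have := hδh ht (by rw [Real.dist_eq, sub_zero, abs_of_nonneg ht.1]; exact htδ)
      exact this.le
    · have hz : deriv (edge T n) t = 0 := by
        have hev : edge T n =ᶠ[𝓝 t] fun _ => 1 := by
          have hlt : 2 * T / (n + 4) < t := by
            refine lt_of_lt_of_le ?_ (not_lt.1 htδ)
            have h2 : 2 * T / δ ≤ n := hN.trans (by exact_mod_cast hn)
            rw [div_le_iff₀ hδ] at h2
            rw [div_lt_iff₀ (by positivity)]
            linarith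
          filter_upwards [lt_mem_nhds hlt] with s hs
          refine Real.smoothTransition.one_of_one_le ?_
          rw [div_lt_iff₀ (by positivity)] at hs
          have : 2 ≤ (n + 4) * (s / T) := by
            rw [← mul_div_assoc, le_div_iff₀ hT]; linarith
          linarith
        rw [hev.deriv_eq, deriv_const]
      rw [hz, mul_zero, mul_zero]
  refine lt_of_le_of_lt (intervalIntegral.abs_integral_le_integral_abs hT.le) ?_
  refine lt_of_le_of_lt (intervalIntegral.integral_mono_on hT.le
    ((hu h hc n).sub (hu (fun _ => h 0) continuousOn_const n)).abs
    (hu (fun _ => ε / 2) continuousOn_const n) key) ?_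
  rw [intervalIntegral.integral_const_mul, h1, mul_one]
  linarith

/-- The cutoff rises at 0 and falls at T; the second layer is the mirror image of the first and
contributes -h(T). -/
theorem tendsto_integral_mul_deriv_timeCut (hT : 0 < T) {h : ℝ → ℝ}
    (hc : ContinuousOn h (Icc 0 T)) :
    Tendsto (fun n => ∫ t in (0 : ℝ)..T, h t * deriv (timeCut T n) t) atTop (𝓝 (h 0 - h T)) := by
  have hd : ∀ n, Differentiable ℝ (edge T n) := fun n => (contDiff_edge T n).differentiable (by simp)
  have hcd : ∀ n, Continuous (deriv (edge T n)) := fun n =>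
    continuous_deriv_of_contDiff (contDiff_edge T n)
  have hder : ∀ n t, deriv (timeCut T n) t = deriv (edge T n) t - deriv (edge T n) (T - t) := by
    intro n t
    have h1 := (hd n t).hasDerivAt
    have h2 := (hd n (T - t)).hasDerivAt.comp_const_sub T t
    have h3 := (h1.add h2).sub_const 1
    rw [timeCut_eq_edge]
    exact h3.deriv.trans (by ring)
  have hc' : ContinuousOn (fun t => h (T - t)) (Icc 0 T) :=
    hc.comp (continuous_const.sub continuous_id).continuousOn
      fun t ht => ⟨by linarith [ht.2], by linarith [ht.1]⟩
  have h1 := tendsto_integral_mul_deriv_edge hT hc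
  have h2 := tendsto_integral_mul_deriv_edge hT hc'
  rw [sub_zero] at h2
  refine (h1.sub h2).congr fun n => ?_
  have e : ∫ t in (0 : ℝ)..T, h (T - t) * deriv (edge T n) t =
      ∫ t in (0 : ℝ)..T, h t * deriv (edge T n) (T - t) := by
    have := intervalIntegral.integral_comp_sub_left (a := 0) (b := T)
      (fun t => h t * deriv (edge T n) (T - t)) T
    simpa using this
  rw [e, ← intervalIntegral.integral_sub]
  · refine intervalIntegral.integral_congr fun t _ => ?_
    simp only [hder, mul_sub]
  · refine ContinuousOn.intervalIntegrable ?_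
    rw [uIcc_of_le hT.le]
    exact hc.mul (hcd n).continuousOn
  · refine ContinuousOn.intervalIntegrable ?_
    rw [uIcc_of_le hT.le]
    exact hc.mul ((hcd n).comp (continuous_const.sub continuous_id)).continuousOn

/-- Passing to the limit in the weak formulation on a time slice. -/
theorem integral_mul_eq_of_timeCut (hT : 0 < T) {u g v θ : ℝ → ℝ}
    (hu : IntervalIntegrable u volume 0 T) (hg : IntervalIntegrable g volume 0 T)
    (hv : ContinuousOn v (Icc 0 T)) (huv : ∀ᵐ t ∂(volume.restrict (Ioo 0 T)), u t = v t)
    (hv0 : v 0 = v T) (hθ : ContDiff ℝ ∞ θ) (hθ0 : θ 0 = θ T)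
    (h : ∀ n, ∫ t in (0 : ℝ)..T, u t * deriv (fun t => timeCut T n t * θ t) t =
      - ∫ t in (0 : ℝ)..T, g t * (timeCut T n t * θ t)) :
    ∫ t in (0 : ℝ)..T, u t * deriv θ t = - ∫ t in (0 : ℝ)..T, g t * θ t := by
  have hlim : ∀ (f e : ℝ → ℝ), IntervalIntegrable f volume 0 T → Continuous e →
      Tendsto (fun n => ∫ t in (0 : ℝ)..T, f t * (timeCut T n t * e t)) atTop
        (𝓝 (∫ t in (0 : ℝ)..T, f t * e t)) := by
    intro f e hf he
    have hfe := hf.mul_continuousOn he.continuousOn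
    refine intervalIntegral.tendsto_integral_filter_of_dominated_convergence
      (fun t => ‖f t * e t‖) ?_ ?_ hfe.norm ?_
    · refine Eventually.of_forall fun n => ?_
      have hcut := (contDiff_timeCut T n).continuous
      exact (hf.mul_continuousOn (hcut.mul he).continuousOn).aestronglyMeasurable_restrict_uIoc
    · refine Eventually.of_forall fun n => Eventually.of_forall fun t _ => ?_
      rw [mul_left_comm, norm_mul]
      exact mul_le_of_le_one_left (norm_nonneg _) (abs_timeCut_le T n t)
    · have hne : ∀ᵐ t : ℝ, t ≠ T := by simp [ae_iff, measure_singleton]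
      filter_upwards [hne] with t ht htI
      rw [uIoc_of_le hT.le] at htI
      have := (tendsto_timeCut hT ⟨htI.1, lt_of_le_of_ne htI.2 ht⟩).mul_const (e t)
      simpa using this.const_mul (f t)
  have hθd : Continuous (deriv θ) := continuous_deriv_of_contDiff hθ
  have l1 := hlim u (deriv θ) hu hθd
  have l2 := hlim g θ hg hθ.continuous
  -- The boundary term needs the continuous representative v; its limit v(0)θ(0) - v(T)θ(T) is zero
  -- by periodicity of v and θ.
  have l3 := tendsto_integral_mul_deriv_timeCut hT (hv.mul hθ.continuous.continuousOn)
  simp only [hv0, hθ0, sub_self, Pi.mul_apply] at l3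
  have e : ∀ n, (∫ t in (0 : ℝ)..T, u t * (timeCut T n t * deriv θ t)) +
      ∫ t in (0 : ℝ)..T, v t * θ t * deriv (timeCut T n) t =
      - ∫ t in (0 : ℝ)..T, g t * (timeCut T n t * θ t) := fun n => by
    have hcut := contDiff_timeCut T n
    have e1 : ∫ t in (0 : ℝ)..T, v t * θ t * deriv (timeCut T n) t =
        ∫ t in (0 : ℝ)..T, u t * (θ t * deriv (timeCut T n) t) := by
      rw [intervalIntegral.integral_of_le hT.le, intervalIntegral.integral_of_le hT.le,
        integral_Ioc_eq_integral_Ioo, integral_Ioc_eq_integral_Ioo]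
      refine integral_congr_ae ?_
      filter_upwards [huv] with t ht
      rw [ht, mul_assoc]
    have i1 : IntervalIntegrable (fun t => u t * (timeCut T n t * deriv θ t)) volume 0 T :=
      hu.mul_continuousOn (hcut.continuous.mul hθd).continuousOn
    have i2 : IntervalIntegrable (fun t => u t * (θ t * deriv (timeCut T n) t)) volume 0 T :=
      hu.mul_continuousOn (hθ.continuous.mul (continuous_deriv_of_contDiff hcut)).continuousOn
    rw [← h n, e1, ← intervalIntegral.integral_add i1 i2]
    refine intervalIntegral.integral_congr fun t _ => ?_
    have hder : deriv (fun t => timeCut T n t * θ t) t =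
        deriv (timeCut T n) t * θ t + timeCut T n t * deriv θ t :=
      deriv_fun_mul (hcut.differentiable (by simp) t) (hθ.differentiable (by simp) t)
    simp only [hder]
    ring
  have l4 := (l1.add l3).congr e
  rw [add_zero] at l4
  exact tendsto_nhds_unique l4 l2.neg

end EdgeLayer

/-! ### Periodic time derivatives through Fourier coefficients -/

section TimeDerivative

variable {d : ℕ} {Ω : Set (Sp d)} {T : ℝ}

/-- The function `cos(k ω t)`. -/
def cosF (T : ℝ) (k : ℕ) : C(ℝ, ℝ) := ⟨fun t => Real.cos (k * freq T * t), continuous_cos_freq k T⟩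

/-- The function `sin(k ω t)`. -/
def sinF (T : ℝ) (k : ℕ) : C(ℝ, ℝ) := ⟨fun t => Real.sin (k * freq T * t), continuous_sin_freq k T⟩

theorem coefE_eq_intervalIntegral (hT : 0 < T) (e : ℝ → ℝ) (u : Sp d × ℝ → ℝ) (x : Sp d) :
    coefE T e u x = ∫ t in (0 : ℝ)..T, u (x, t) * e t := by
  rw [intervalIntegral.integral_of_le hT.le, integral_Ioc_eq_integral_Ioo]
  simp only [coefE, smul_eq_mul, mul_comm]

theorem coefC_eq_coefE (hT : 0 < T) (u : Sp d × ℝ → ℝ) (k : ℕ) :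
    coefC T u k = fun x => 2 / T * coefE T (cosF T k) u x := by
  funext x
  rw [coefE_eq_intervalIntegral hT]
  rfl

theorem coefS_eq_coefE (hT : 0 < T) (u : Sp d × ℝ → ℝ) (k : ℕ) :
    coefS T u k = fun x => 2 / T * coefE T (sinF T k) u x := by
  funext x
  rw [coefE_eq_intervalIntegral hT]
  rfl

theorem coefC_congr_ae (hT : 0 < T) {u v : Sp d × ℝ → ℝ} (h : u =ᵐ[muQ Ω T] v) (k : ℕ) :
    coefC T u k =ᵐ[volume.restrict Ω] coefC T v k := by
  rw [coefC_eq_coefE hT, coefC_eq_coefE hT]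
  filter_upwards [coefE_congr_ae (cosF T k) h] with x hx
  rw [hx]

theorem coefS_congr_ae (hT : 0 < T) {u v : Sp d × ℝ → ℝ} (h : u =ᵐ[muQ Ω T] v) (k : ℕ) :
    coefS T u k =ᵐ[volume.restrict Ω] coefS T v k := by
  rw [coefS_eq_coefE hT, coefS_eq_coefE hT]
  filter_upwards [coefE_congr_ae (sinF T k) h] with x hx
  rw [hx]

theorem HasHalfDt.congr (hT : 0 < T) {u v : Sp d × ℝ → ℝ} (h : u =ᵐ[muQ Ω T] v)
    (hu : HasHalfDt Ω T u) : HasHalfDt Ω T v := by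
  refine (summable_congr fun k => ?_).mp hu
  congr 1
  refine integral_congr_ae ?_
  filter_upwards [coefC_congr_ae hT h k, coefS_congr_ae hT h k] with x h1 h2
  rw [h1, h2]

theorem halfPerp_congr (hT : 0 < T) (σ : Sp d → ℝ) {u u' v v' : Sp d × ℝ → ℝ}
    (h : u =ᵐ[muQ Ω T] u') (h' : v =ᵐ[muQ Ω T] v') :
    halfPerp Ω T σ u v = halfPerp Ω T σ u' v' := by
  unfold halfPerp
  congr 2
  funext k
  congr 1
  refine integral_congr_ae ?_
  filter_upwards [coefC_congr_ae hT h k, coefS_congr_ae hT h k, coefC_congr_ae hT h' k,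
    coefS_congr_ae hT h' k] with x h1 h2 h3 h4
  rw [h1, h2, h3, h4]

/-- The identity holds term by term. Negation passes through `tsum` and the integral
unconditionally, so no convergence of the series is needed. -/
theorem halfPerp_antisymm (σ : Sp d → ℝ) (u v : Sp d × ℝ → ℝ) :
    halfPerp Ω T σ u v = - halfPerp Ω T σ v u := by
  unfold halfPerp
  rw [← mul_neg, ← tsum_neg]
  congr 2
  funext k
  rw [← mul_neg, ← integral_neg]
  congr 2
  funext x
  ring

theorem MemL2.memLp_slice {u : Sp d × ℝ → ℝ} (hu : MemLp u 2 (muQ Ω T)) :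
    ∀ᵐ x ∂(volume.restrict Ω), MemLp (fun t => u (x, t)) 2 (volume.restrict (Ioo 0 T)) := by
  rw [muQ_eq_prod] at hu
  have h2 := (memLp_two_iff_integrable_sq hu.1).1 hu
  filter_upwards [h2.prod_right_ae, hu.1.prodMk_left] with x hx hm
  exact (memLp_two_iff_integrable_sq hm).2 hx

theorem hasDerivAt_slice {φ : Sp d × ℝ → ℝ} (hφ : Differentiable ℝ φ) (x : Sp d) (t : ℝ) :
    HasDerivAt (fun t => φ (x, t)) (derivT φ (x, t)) t := by
  have h1 : HasDerivAt (fun t : ℝ => (x, t)) ((0 : Sp d), (1 : ℝ)) t :=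
    (hasDerivAt_const t x).prodMk (hasDerivAt_id t)
  exact (hφ (x, t)).hasFDerivAt.comp_hasDerivAt t h1

theorem continuous_derivT {φ : Sp d × ℝ → ℝ} (hφ : ContDiff ℝ ∞ φ) : Continuous (derivT φ) :=
  (hφ.continuous_fderiv (by simp)).clm_apply continuous_const

theorem IsTest.memL2_derivT {φ : Sp d × ℝ → ℝ} (h : IsTest Ω T φ) :
    MemLp (derivT φ) 2 (muQ Ω T) := by
  refine memL2_of_continuous (continuous_derivT h.1) ?_
  have := (h.2.1.fderiv (𝕜 := ℝ)).comp_left (g := fun L : (Sp d × ℝ) →L[ℝ] ℝ => L (0, 1)) rfl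
  exact this

section FiniteMeasure

variable [IsFiniteMeasure ((volume : Measure (Sp d)).restrict Ω)]

theorem memLp_coefC (hT : 0 < T) {u : Sp d × ℝ → ℝ} (hu : MemLp u 2 (muQ Ω T)) (k : ℕ) :
    MemLp (coefC T u k) 2 (volume.restrict Ω) := by
  rw [coefC_eq_coefE hT]
  exact (memLp_coefE (cosF T k) hu).const_mul _

theorem memLp_coefS (hT : 0 < T) {u : Sp d × ℝ → ℝ} (hu : MemLp u 2 (muQ Ω T)) (k : ℕ) :
    MemLp (coefS T u k) 2 (volume.restrict Ω) := by
  rw [coefS_eq_coefE hT]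
  exact (memLp_coefE (sinF T k) hu).const_mul _

/-- Testing with a product of a function of space and a function of time. -/
theorem integral_mul_mul (e : C(ℝ, ℝ)) {u : Sp d × ℝ → ℝ} (hu : MemLp u 2 (muQ Ω T))
    {ψ : Sp d → ℝ} (hψ : MemLp ψ 2 (volume.restrict Ω)) :
    ∫ z, u z * (e z.2 * ψ z.1) ∂(muQ Ω T) = ∫ x in Ω, ψ x * coefE T e u x := by
  have h := ContinuousLinearMap.adjoint_inner_right (tensL Ω T ℝ e) (hψ.toLp ψ) (hu.toLp u)
  rw [adjoint_tensL_toLp, tensL_toLp, inner_toLp_real, inner_toLp_real] at h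
  rw [h]
  exact integral_congr_ae (Eventually.of_forall fun z => mul_comm _ _)

end FiniteMeasure

theorem tsupport_mul_subset_prod (χ : ℝ → ℝ) (ψ : Sp d → ℝ) :
    tsupport (fun z : Sp d × ℝ => χ z.2 * ψ z.1) ⊆ tsupport ψ ×ˢ tsupport χ := by
  refine closure_minimal (fun z hz => ?_) ((isClosed_tsupport _).prod (isClosed_tsupport _))
  rw [Function.mem_support, mul_ne_zero_iff] at hz
  exact ⟨subset_tsupport _ hz.2, subset_tsupport _ hz.1⟩

theorem isLatTest_mul {χ : ℝ → ℝ} {ψ : Sp d → ℝ} (hχ : ContDiff ℝ ∞ χ)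
    (hχc : HasCompactSupport χ) (hψ : ContDiff ℝ ∞ ψ) (hψc : HasCompactSupport ψ)
    (hψs : tsupport ψ ⊆ Ω) : IsLatTest Ω (fun z => χ z.2 * ψ z.1) :=
  ⟨(hχ.comp contDiff_snd).mul (hψ.comp contDiff_fst),
    (hψc.isCompact.prod hχc.isCompact).of_isClosed_subset (isClosed_tsupport _)
      (tsupport_mul_subset_prod χ ψ),
    (tsupport_mul_subset_prod χ ψ).trans (prod_mono hψs (subset_univ _))⟩

theorem isTest_mul {χ : ℝ → ℝ} {ψ : Sp d → ℝ} (hχ : ContDiff ℝ ∞ χ)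
    (hχc : HasCompactSupport χ) (hs : tsupport χ ⊆ Ioo 0 T)
    (hψ : ContDiff ℝ ∞ ψ) (hψc : HasCompactSupport ψ) (hψs : tsupport ψ ⊆ Ω) :
    IsTest Ω T (fun z => χ z.2 * ψ z.1) :=
  have h := isLatTest_mul hχ hχc hψ hψc hψs
  ⟨h.1, h.2.1, (tsupport_mul_subset_prod χ ψ).trans (prod_mono hψs hs)⟩

theorem derivT_mul {χ : ℝ → ℝ} {ψ : Sp d → ℝ} (hχ : Differentiable ℝ χ)
    (hψ : Differentiable ℝ ψ) (z : Sp d × ℝ) :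
    derivT (fun z : Sp d × ℝ => χ z.2 * ψ z.1) z = deriv χ z.2 * ψ z.1 := by
  have h : HasFDerivAt (fun z : Sp d × ℝ => ψ z.1)
      ((fderiv ℝ ψ z.1).comp (ContinuousLinearMap.fst ℝ (Sp d) ℝ)) z :=
    (hψ z.1).hasFDerivAt.comp z hasFDerivAt_fst
  have h0 : derivT (fun z : Sp d × ℝ => ψ z.1) z = 0 := by
    rw [derivT, h.fderiv]
    simp
  rw [derivT_mul_time (φ := fun z => ψ z.1) (hψ.comp differentiable_fst) hχ, h0]
  ring

section FiniteMeasure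

variable [IsFiniteMeasure ((volume : Measure (Sp d)).restrict Ω)]

/-- Test functions χ(t)ψ(x) with ψ arbitrary localize the weak identity to almost every x. The
exceptional null set depends on χ, so only countably many χ may be used at once. -/
theorem IsWeakDt.coefE_eq (hΩ : IsOpen Ω) {u g : Sp d × ℝ → ℝ} (hu : MemLp u 2 (muQ Ω T))
    (h : IsWeakDt Ω T u g) {χ : ℝ → ℝ} (hχ : ContDiff ℝ ∞ χ) (hχc : HasCompactSupport χ)
    (hs : tsupport χ ⊆ Ioo 0 T) :
    ∀ᵐ x ∂(volume.restrict Ω), coefE T (deriv χ) u x = - coefE T χ g x := by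
  have hg := h.1
  let e : C(ℝ, ℝ) := ⟨χ, hχ.continuous⟩
  let e' : C(ℝ, ℝ) := ⟨deriv χ, continuous_deriv_of_contDiff hχ⟩
  have m1 : MemLp (coefE T (deriv χ) u) 2 (volume.restrict Ω) := memLp_coefE e' hu
  have m2 : MemLp (coefE T χ g) 2 (volume.restrict Ω) := memLp_coefE e hg
  have hint : IntegrableOn (fun x => coefE T (deriv χ) u x + coefE T χ g x) Ω volume :=
    (m1.add m2).integrable one_le_two
  have key := hΩ.ae_eq_zero_of_integral_contDiff_smul_eq_zero hint.locallyIntegrableOn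
    fun ψ h1 h2 h3 => by
      have hψ : MemLp ψ 2 (volume.restrict Ω) := h1.continuous.memLp_of_hasCompactSupport h2
      have h4 := h.2 _ (isTest_mul hχ hχc hs h1 h2 h3)
      simp only [derivT_mul (hχ.differentiable (by simp)) (h1.differentiable (by simp))] at h4
      rw [show (∫ z, u z * (deriv χ z.2 * ψ z.1) ∂(muQ Ω T)) = _ from integral_mul_mul e' hu hψ,
        show (∫ z, g z * (χ z.2 * ψ z.1) ∂(muQ Ω T)) = _ from integral_mul_mul e hg hψ] at h4
      have i1 : Integrable (fun x => ψ x * coefE T (deriv χ) u x) (volume.restrict Ω) :=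
        hψ.integrable_mul m1
      have i2 : Integrable (fun x => ψ x * coefE T χ g x) (volume.restrict Ω) :=
        hψ.integrable_mul m2
      have h5 := integral_add i1 i2
      rw [← setIntegral_eq_integral_of_forall_compl_eq_zero (s := Ω) fun x hx => by
        rw [image_eq_zero_of_notMem_tsupport fun hx' => hx (h3 hx'), zero_smul]]
      simp only [smul_eq_mul, mul_add]
      rw [h5]
      change (∫ x in Ω, ψ x * coefE T (deriv χ) u x) = - ∫ x in Ω, ψ x * coefE T χ g x at h4
      rw [h4, neg_add_cancel]
  rw [← ae_restrict_iff' hΩ.measurableSet] at key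
  filter_upwards [key] with x hx
  linarith

end FiniteMeasure

variable (Ω T) in
/-- `g` is the time derivative of the time-periodic function `u`, in terms of the Fourier
coefficients. -/
def IsPeriodicDt (u g : Sp d × ℝ → ℝ) : Prop :=
  MemLp u 2 (muQ Ω T) ∧ MemLp g 2 (muQ Ω T) ∧ ∀ k : ℕ, ∀ᵐ x ∂(volume.restrict Ω),
    coefC T g k x = k * freq T * coefS T u k x ∧ coefS T g k x = - (k * freq T * coefC T u k x)

theorem contDiff_cosF (k : ℕ) : ContDiff ℝ ∞ (cosF T k) :=
  Real.contDiff_cos.comp (contDiff_const.mul contDiff_id)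

theorem contDiff_sinF (k : ℕ) : ContDiff ℝ ∞ (sinF T k) :=
  Real.contDiff_sin.comp (contDiff_const.mul contDiff_id)

theorem deriv_cosF (k : ℕ) (t : ℝ) : deriv (cosF T k) t = - (k * freq T * sinF T k t) := by
  have h := ((hasDerivAt_id t).const_mul (k * freq T)).cos
  refine h.deriv.trans ?_
  simp [sinF]
  ring

theorem deriv_sinF (k : ℕ) (t : ℝ) : deriv (sinF T k) t = k * freq T * cosF T k t := by
  have h := ((hasDerivAt_id t).const_mul (k * freq T)).sin
  refine h.deriv.trans ?_
  simp [cosF]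
  ring

theorem freq_mul (hT : 0 < T) (k : ℕ) : k * freq T * T = k * (2 * Real.pi) := by
  rw [freq]; field_simp

theorem cosF_zero (k : ℕ) : cosF T k 0 = 1 := by simp [cosF]

theorem cosF_end (hT : 0 < T) (k : ℕ) : cosF T k T = 1 := by
  simp [cosF, freq_mul hT, Real.cos_nat_mul_two_pi]

theorem sinF_zero (k : ℕ) : sinF T k 0 = 0 := by simp [sinF]

theorem sinF_end (hT : 0 < T) (k : ℕ) : sinF T k T = 0 := by
  have := Real.sin_add_nat_mul_two_pi 0 k
  simpa [sinF, freq_mul hT] using this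

theorem freq_pos (hT : 0 < T) : 0 < freq T := by rw [freq]; positivity

theorem hasCompactSupport_of_tsupport_subset {χ : ℝ → ℝ} (hs : tsupport χ ⊆ Ioo 0 T) :
    HasCompactSupport χ :=
  isCompact_Icc.of_isClosed_subset (isClosed_tsupport _) (hs.trans Ioo_subset_Icc_self)

/-- On almost every slice, integration by parts shows that u(x,·) and the primitive of g(x,·) have
the same Fourier coefficients of index k ≥ 1; hence they differ by a constant. -/
theorem IsPeriodicDt.ae_primitive (hT : 0 < T) {u g : Sp d × ℝ → ℝ} (h : IsPeriodicDt Ω T u g) :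
    ∀ᵐ x ∂(volume.restrict Ω), IntervalIntegrable (fun t => g (x, t)) volume 0 T ∧
      (∫ t in (0 : ℝ)..T, g (x, t)) = 0 ∧
      ∃ c, ∀ᵐ t ∂(volume.restrict (Ioo 0 T)), u (x, t) = c + ∫ s in (0 : ℝ)..t, g (x, s) := by
  filter_upwards [ae_all_iff.2 h.2.2, MemL2.memLp_slice h.1, MemL2.memLp_slice h.2.1]
    with x hx hux hgx
  have hui := intervalIntegrable_of_memLp hT hux
  have hgi := intervalIntegrable_of_memLp hT hgx
  -- The relation for k = 0 says that g has mean zero: its primitive vanishes at both ends, and the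
  -- boundary terms below disappear.
  have h0 : (∫ t in (0 : ℝ)..T, g (x, t)) = 0 := by
    have := (hx 0).1
    simp only [coefC, Nat.cast_zero, zero_mul, Real.cos_zero, mul_one, mul_eq_zero,
      div_eq_zero_iff, OfNat.ofNat_ne_zero, hT.ne', false_or, or_self] at this
    exact this
  refine ⟨hgi, h0, ?_⟩
  set W : ℝ → ℝ := fun t => ∫ s in (0 : ℝ)..t, g (x, s) with hW
  have hWc : ContinuousOn W (uIcc 0 T) :=
    intervalIntegral.continuousOn_primitive_interval' hgi left_mem_uIcc
  have hWm : MemLp W 2 (volume.restrict (Ioo 0 T)) := by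
    rw [uIcc_of_le hT.le] at hWc
    obtain ⟨C, hC⟩ := isCompact_Icc.exists_bound_of_continuousOn hWc
    refine MemLp.of_bound
      ((hWc.mono Ioo_subset_Icc_self).aestronglyMeasurable measurableSet_Ioo) C ?_
    filter_upwards [ae_restrict_mem measurableSet_Ioo] with t ht
    exact hC t (Ioo_subset_Icc_self ht)
  have hWn : IntervalIntegrable (fun t => - W t) volume 0 T :=
    (intervalIntegrable_of_memLp hT hWm).neg
  have hsin : ∀ k : ℕ, k * freq T * (∫ t in (0 : ℝ)..T, W t * cosF T k t) =
      - ∫ t in (0 : ℝ)..T, g (x, t) * sinF T k t := fun k => by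
    have := integral_primitive_mul_deriv hgi (contDiff_sinF (T := T) k)
    simp only [deriv_sinF] at this
    rw [h0, zero_mul, zero_sub] at this
    rw [← this, ← intervalIntegral.integral_const_mul]
    congr 1; funext t; ring
  have hcos : ∀ k : ℕ, k * freq T * (∫ t in (0 : ℝ)..T, W t * sinF T k t) =
      ∫ t in (0 : ℝ)..T, g (x, t) * cosF T k t := fun k => by
    have := integral_primitive_mul_deriv hgi (contDiff_cosF (T := T) k)
    simp only [deriv_cosF] at this
    rw [h0, zero_mul, zero_sub] at this
    rw [← neg_inj, ← this, ← intervalIntegral.integral_const_mul, ← intervalIntegral.integral_neg]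
    congr 1; funext t; ring
  have hkpos : ∀ k : ℕ, 1 ≤ k → (0 : ℝ) < k * freq T := fun k hk =>
    mul_pos (by exact_mod_cast hk) (freq_pos hT)
  obtain ⟨c, hc⟩ := ae_eq_const_of_coef_eq_zero hT (f := fun t => u (x, t) + - W t)
    (hux.add hWm.neg) (fun k hk => by
      rw [cosCoef_add hui hWn, cosCoef_neg]
      have e1 : sinCoef T (fun t => g (x, t)) k = - (k * freq T * cosCoef T (fun t => u (x, t)) k) :=
        (hx k).2
      have e2 : k * freq T * cosCoef T W k = - sinCoef T (fun t => g (x, t)) k := by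
        have := hsin k
        change k * freq T * (2 / T * ∫ t in (0 : ℝ)..T, W t * cosF T k t) =
          - (2 / T * ∫ t in (0 : ℝ)..T, g (x, t) * sinF T k t)
        linear_combination (2 / T) * this
      refine mul_left_cancel₀ (hkpos k hk).ne' ?_
      linear_combination e1 - e2) (fun k => by
      rcases Nat.eq_zero_or_pos k with rfl | hk
      · simp [sinCoef]
      rw [sinCoef_add hui hWn, sinCoef_neg]
      have e1 : cosCoef T (fun t => g (x, t)) k = k * freq T * sinCoef T (fun t => u (x, t)) k :=
        (hx k).1
      have e2 : k * freq T * sinCoef T W k = cosCoef T (fun t => g (x, t)) k := by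
        have := hcos k
        change k * freq T * (2 / T * ∫ t in (0 : ℝ)..T, W t * sinF T k t) =
          2 / T * ∫ t in (0 : ℝ)..T, g (x, t) * cosF T k t
        linear_combination (2 / T) * this
      refine mul_left_cancel₀ (hkpos k hk).ne' ?_
      linear_combination (-1) * e2 - e1)
  refine ⟨c, ?_⟩
  filter_upwards [hc] with t ht
  linarith

theorem IsPeriodicDt.periodicInTime (hT : 0 < T) {u g : Sp d × ℝ → ℝ}
    (h : IsPeriodicDt Ω T u g) : PeriodicInTime Ω T u := by
  filter_upwards [h.ae_primitive hT] with x ⟨h1, h2, c, hc⟩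
  refine ⟨fun t => c + ∫ s in (0 : ℝ)..t, g (x, s), ?_, hc, ?_⟩
  · have := intervalIntegral.continuousOn_primitive_interval' h1 left_mem_uIcc
    rw [uIcc_of_le hT.le] at this
    exact continuousOn_const.add this
  · simp [h2]

/-- Integrate by parts on each slice with u(x,·) = c + primitive. Since φ(x,·) vanishes at both
ends, c contributes nothing, and Fubini assembles the slices. -/
theorem IsPeriodicDt.isWeakDt (hT : 0 < T) {u g : Sp d × ℝ → ℝ}
    (h : IsPeriodicDt Ω T u g) : IsWeakDt Ω T u g := by
  refine ⟨h.2.1, fun φ hφ => ?_⟩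
  have i1 : Integrable (fun z => u z * derivT φ z) (muQ Ω T) := h.1.integrable_mul hφ.memL2_derivT
  have i2 : Integrable (fun z => g z * φ z) (muQ Ω T) := h.2.1.integrable_mul hφ.isLatTest.memL2
  rw [muQ_eq_prod] at i1 i2 ⊢
  rw [integral_prod _ i1, integral_prod _ i2, ← integral_neg]
  refine integral_congr_ae ?_
  filter_upwards [h.ae_primitive hT] with x ⟨h1, h2, c, hc⟩
  have hd := hasDerivAt_slice (hφ.1.differentiable (by simp)) x
  have hsm : ContDiff ℝ ∞ (fun t => φ (x, t)) := hφ.1.comp (contDiff_const.prodMk contDiff_id)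
  have hder : deriv (fun t => φ (x, t)) = fun t => derivT φ (x, t) := funext fun t => (hd t).deriv
  have z0 : φ (x, 0) = 0 := hφ.eq_zero fun hz => lt_irrefl _ hz.2.1
  have zT : φ (x, T) = 0 := hφ.eq_zero fun hz => lt_irrefl _ hz.2.2
  have hdc : Continuous fun t => derivT φ (x, t) :=
    (continuous_derivT hφ.1).comp (continuous_const.prodMk continuous_id)
  have e1 := integral_primitive_mul_deriv h1 hsm
  rw [hder, h2, zero_mul, zero_sub] at e1
  have e2 : ∫ t in (0 : ℝ)..T, derivT φ (x, t) = 0 := by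
    rw [intervalIntegral.integral_eq_sub_of_hasDerivAt (fun t _ => hd t)
      (hdc.intervalIntegrable _ _), z0, zT, sub_zero]
  have hWc := intervalIntegral.continuousOn_primitive_interval' h1 left_mem_uIcc
  have e3 : ∫ t in (0 : ℝ)..T, (c + ∫ s in (0 : ℝ)..t, g (x, s)) * derivT φ (x, t) =
      - ∫ t in (0 : ℝ)..T, g (x, t) * φ (x, t) := by
    rw [← e1]
    simp only [add_mul]
    rw [intervalIntegral.integral_add, intervalIntegral.integral_const_mul, e2, mul_zero, zero_add]
    · exact (hdc.intervalIntegrable _ _).const_mul _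
    · exact (hWc.mul hdc.continuousOn).intervalIntegrable
  have e4 : ∫ t in Ioo 0 T, u (x, t) * derivT φ (x, t) =
      ∫ t in Ioo 0 T, (c + ∫ s in (0 : ℝ)..t, g (x, s)) * derivT φ (x, t) := by
    refine integral_congr_ae ?_
    filter_upwards [hc] with t ht
    rw [ht]
  rw [e4]
  simp only [← integral_Ioc_eq_integral_Ioo, ← intervalIntegral.integral_of_le hT.le]
  exact e3

section FiniteMeasure

variable [IsFiniteMeasure ((volume : Measure (Sp d)).restrict Ω)]

/-- The periodic functions cos and sin are not admissible tests in (0,T). They are multiplied by the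
cutoffs, and the boundary layers cancel in the limit because u(x,·) has equal end values. -/
theorem IsWeakDt.isPeriodicDt (hΩ : IsOpen Ω) (hT : 0 < T) {u g : Sp d × ℝ → ℝ}
    (hu : MemLp u 2 (muQ Ω T)) (h : IsWeakDt Ω T u g) (hp : PeriodicInTime Ω T u) :
    IsPeriodicDt Ω T u g := by
  have hg := h.1
  have key : ∀ θ : ℝ → ℝ, ContDiff ℝ ∞ θ → θ 0 = θ T → ∀ᵐ x ∂(volume.restrict Ω),
      ∫ t in (0 : ℝ)..T, u (x, t) * deriv θ t = - ∫ t in (0 : ℝ)..T, g (x, t) * θ t := by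
    intro θ hθ hθ0
    have h1 : ∀ n, ∀ᵐ x ∂(volume.restrict Ω),
        coefE T (deriv fun t => timeCut T n t * θ t) u x
          = - coefE T (fun t => timeCut T n t * θ t) g x := fun n => by
      have hs : tsupport (fun t => timeCut T n t * θ t) ⊆ Ioo 0 T :=
        (tsupport_mul_subset_left (f := timeCut T n) (g := θ)).trans (tsupport_timeCut hT n)
      exact h.coefE_eq hΩ hu ((contDiff_timeCut T n).mul hθ)
        (hasCompactSupport_of_tsupport_subset hs) hs
    filter_upwards [ae_all_iff.2 h1, hp, MemL2.memLp_slice hu, MemL2.memLp_slice hg]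
      with x hx ⟨v, hv1, hv2, hv3⟩ hux hgx
    refine integral_mul_eq_of_timeCut hT (intervalIntegrable_of_memLp hT hux)
      (intervalIntegrable_of_memLp hT hgx) hv1 hv2 hv3 hθ hθ0 fun n => ?_
    have := hx n
    rwa [coefE_eq_intervalIntegral hT, coefE_eq_intervalIntegral hT] at this
  refine ⟨hu, hg, fun k => ?_⟩
  filter_upwards [key (cosF T k) (contDiff_cosF k) (by rw [cosF_zero, cosF_end hT]),
    key (sinF T k) (contDiff_sinF k) (by rw [sinF_zero, sinF_end hT])] with x h1 h2
  simp only [deriv_cosF, deriv_sinF] at h1 h2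
  have e1 : ∫ t in (0 : ℝ)..T, u (x, t) * -(k * freq T * sinF T k t) =
      - (k * freq T) * ∫ t in (0 : ℝ)..T, u (x, t) * sinF T k t := by
    rw [← intervalIntegral.integral_const_mul]
    congr 1; funext t; ring
  have e2 : ∫ t in (0 : ℝ)..T, u (x, t) * (k * freq T * cosF T k t) =
      (k * freq T) * ∫ t in (0 : ℝ)..T, u (x, t) * cosF T k t := by
    rw [← intervalIntegral.integral_const_mul]
    congr 1; funext t; ring
  rw [e1] at h1
  rw [e2] at h2
  change 2 / T * (∫ t in (0 : ℝ)..T, g (x, t) * cosF T k t) =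
      k * freq T * (2 / T * ∫ t in (0 : ℝ)..T, u (x, t) * sinF T k t) ∧
    2 / T * (∫ t in (0 : ℝ)..T, g (x, t) * sinF T k t) =
      - (k * freq T * (2 / T * ∫ t in (0 : ℝ)..T, u (x, t) * cosF T k t))
  constructor
  · linear_combination (2 / T) * h1
  · linear_combination (2 / T) * h2

end FiniteMeasure

end TimeDerivative

/-! ### Parseval's identity on Q and the half-derivative form -/

section Parseval

variable {d : ℕ} {Ω : Set (Sp d)} {T : ℝ}

theorem integrable_slice_mul {u v : Sp d × ℝ → ℝ} (hu : MemLp u 2 (muQ Ω T))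
    (hv : MemLp v 2 (muQ Ω T)) :
    Integrable (fun x => ∫ t in Ioo 0 T, u (x, t) * v (x, t)) (volume.restrict Ω) := by
  have i1 : Integrable (fun z => u z * v z) (muQ Ω T) := hu.integrable_mul hv
  rw [muQ_eq_prod] at i1
  exact i1.integral_prod_left

theorem ae_hasSum_coef_sq (hT : 0 < T) {u : Sp d × ℝ → ℝ} (hu : MemLp u 2 (muQ Ω T)) :
    ∀ᵐ x ∂(volume.restrict Ω), HasSum (fun k => T / 2 * (coefC T u k x ^ 2 + coefS T u k x ^ 2))
      ((∫ t in Ioo 0 T, u (x, t) * u (x, t)) + T / 4 * coefC T u 0 x ^ 2) := by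
  filter_upwards [MemL2.memLp_slice hu] with x hx
  have := hasSum_coef_sq hT hx
  simp only [sq (u (x, _))] at this
  exact this

variable [IsFiniteMeasure ((volume : Measure (Sp d)).restrict Ω)]

theorem integrable_tsum_coef_sq (hT : 0 < T) {u : Sp d × ℝ → ℝ} (hu : MemLp u 2 (muQ Ω T)) :
    Integrable (fun x => ∑' k, T / 2 * (coefC T u k x ^ 2 + coefS T u k x ^ 2))
      (volume.restrict Ω) := by
  have h1 : Integrable (fun x => (∫ t in Ioo 0 T, u (x, t) * u (x, t))
      + T / 4 * coefC T u 0 x ^ 2) (volume.restrict Ω) :=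
    (integrable_slice_mul hu hu).add ((memLp_coefC hT hu 0).integrable_sq.const_mul _)
  refine h1.congr ?_
  filter_upwards [ae_hasSum_coef_sq hT hu] with x hx
  exact hx.tsum_eq.symm

theorem integrable_coef_sq (hT : 0 < T) {u : Sp d × ℝ → ℝ} (hu : MemLp u 2 (muQ Ω T)) (k : ℕ) :
    Integrable (fun x => coefC T u k x ^ 2 + coefS T u k x ^ 2) (volume.restrict Ω) :=
  (memLp_coefC hT hu k).integrable_sq.add (memLp_coefS hT hu k).integrable_sq

theorem summable_integral_coef_sq (hT : 0 < T) {u : Sp d × ℝ → ℝ} (hu : MemLp u 2 (muQ Ω T)) :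
    Summable fun k => ∫ x in Ω, (coefC T u k x ^ 2 + coefS T u k x ^ 2) := by
  have h := hasSum_integral_of_dominated_convergence
    (F := fun k x => T / 2 * (coefC T u k x ^ 2 + coefS T u k x ^ 2))
    (fun k x => T / 2 * (coefC T u k x ^ 2 + coefS T u k x ^ 2))
    (fun k => ((integrable_coef_sq hT hu k).const_mul _).1)
    (fun k => Eventually.of_forall fun x => by
      rw [Real.norm_of_nonneg (by positivity)])
    ((ae_hasSum_coef_sq hT hu).mono fun x hx => hx.summable)
    (integrable_tsum_coef_sq hT hu) (ae_hasSum_coef_sq hT hu)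
  have h2 := h.summable
  simp only [integral_const_mul] at h2
  exact (summable_mul_left_iff (by positivity)).1 h2

/-- Parseval's identity in time, with a weight depending on space. -/
theorem hasSum_integral_coef_mul (hT : 0 < T) {m : Sp d → ℝ} {C : ℝ}
    (hm : AEStronglyMeasurable m (volume.restrict Ω))
    (hC : ∀ᵐ x ∂(volume.restrict Ω), |m x| ≤ C) {u v : Sp d × ℝ → ℝ}
    (hu : MemLp u 2 (muQ Ω T)) (hv : MemLp v 2 (muQ Ω T))
    (h0 : ∀ᵐ x ∂(volume.restrict Ω), coefC T u 0 x = 0) :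
    HasSum (fun k => T / 2 * ∫ x in Ω, m x *
        (coefC T u k x * coefC T v k x + coefS T u k x * coefS T v k x))
      (∫ z, m z.1 * u z * v z ∂(muQ Ω T)) := by
  have hmt : MemLp m ∞ (volume.restrict Ω) := memLp_top_of_bound hm C hC
  have e1 : ∫ z, m z.1 * u z * v z ∂(muQ Ω T) =
      ∫ x in Ω, m x * ∫ t in Ioo 0 T, u (x, t) * v (x, t) := by
    have i1 : Integrable (fun z => m z.1 * u z * v z) (muQ Ω T) :=
      (memLp_bdd_smul (memLp_top_fst hmt) hu).integrable_mul hv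
    rw [muQ_eq_prod] at i1 ⊢
    rw [integral_prod _ i1]
    simp only [mul_assoc, integral_const_mul]
  rw [e1]
  have h := hasSum_integral_of_dominated_convergence (μ := volume.restrict Ω)
    (F := fun k x => T / 2 * (m x *
      (coefC T u k x * coefC T v k x + coefS T u k x * coefS T v k x)))
    (f := fun x => m x * ∫ t in Ioo 0 T, u (x, t) * v (x, t))
    -- A dominating series: the Parseval terms of u plus those of v, whose sum over k is integrable
    -- in x.
    (fun k x => C * (T / 2 * (coefC T u k x ^ 2 + coefS T u k x ^ 2)
      + T / 2 * (coefC T v k x ^ 2 + coefS T v k x ^ 2)))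
    (fun k => (hm.mul (((memLp_coefC hT hu k).1.mul (memLp_coefC hT hv k).1).add
      ((memLp_coefS hT hu k).1.mul (memLp_coefS hT hv k).1))).const_mul _)
    (fun k => by
      filter_upwards [hC] with x hx
      have hC0 : 0 ≤ C := (abs_nonneg _).trans hx
      have e : |coefC T u k x * coefC T v k x + coefS T u k x * coefS T v k x| ≤
          (coefC T u k x ^ 2 + coefS T u k x ^ 2) + (coefC T v k x ^ 2 + coefS T v k x ^ 2) := by
        rw [abs_le]
        constructor <;> nlinarith [sq_nonneg (coefC T u k x + coefC T v k x),
          sq_nonneg (coefC T u k x - coefC T v k x), sq_nonneg (coefS T u k x + coefS T v k x),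
          sq_nonneg (coefS T u k x - coefS T v k x), sq_nonneg (coefC T u k x),
          sq_nonneg (coefC T v k x), sq_nonneg (coefS T u k x), sq_nonneg (coefS T v k x)]
      rw [Real.norm_eq_abs, abs_mul, abs_mul, abs_of_pos (by positivity : 0 < T / 2)]
      calc T / 2 * (|m x| * |coefC T u k x * coefC T v k x + coefS T u k x * coefS T v k x|)
          ≤ T / 2 * (C * ((coefC T u k x ^ 2 + coefS T u k x ^ 2)
              + (coefC T v k x ^ 2 + coefS T v k x ^ 2))) := by gcongr
        _ = _ := by ring)
    (by
      filter_upwards [ae_hasSum_coef_sq hT hu, ae_hasSum_coef_sq hT hv] with x h1 h2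
      exact (h1.summable.add h2.summable).mul_left _)
    (by
      refine (((integrable_tsum_coef_sq hT hu).add
        (integrable_tsum_coef_sq hT hv)).const_mul C).congr ?_
      filter_upwards [ae_hasSum_coef_sq hT hu, ae_hasSum_coef_sq hT hv] with x h1 h2
      rw [tsum_mul_left, h1.summable.tsum_add h2.summable, Pi.add_apply])
    (by
      -- The zero mean of u removes the doubled k = 0 term from Parseval's identity.
      filter_upwards [MemL2.memLp_slice hu, MemL2.memLp_slice hv, h0] with x h1 h2 h3
      have h4 := (hasSum_coef_mul hT h1 h2).mul_left (m x)
      have h3' : cosCoef T (fun t => u (x, t)) 0 = 0 := h3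
      rw [h3', zero_mul, mul_zero, add_zero] at h4
      refine (congrArg (fun f => HasSum f _) (funext fun k => ?_)).mp h4
      change _ = T / 2 * (m x * (cosCoef T (fun t => u (x, t)) k * cosCoef T (fun t => v (x, t)) k
        + sinCoef T (fun t => u (x, t)) k * sinCoef T (fun t => v (x, t)) k))
      ring)
  simp only [integral_const_mul] at h
  exact h

/-- The weight kω together with the rotation of the coefficients of u gives exactly the coefficients
of the derivative g, so the series is Parseval's series for ∫ m g v. -/
theorem IsPeriodicDt.halfPerp_eq (hT : 0 < T) {m : Sp d → ℝ} {C : ℝ}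
    (hm : AEStronglyMeasurable m (volume.restrict Ω))
    (hC : ∀ᵐ x ∂(volume.restrict Ω), |m x| ≤ C) {u g v : Sp d × ℝ → ℝ}
    (h : IsPeriodicDt Ω T u g) (hv : MemLp v 2 (muQ Ω T)) :
    halfPerp Ω T m u v = ∫ z, m z.1 * g z * v z ∂(muQ Ω T) := by
  have h0 : ∀ᵐ x ∂(volume.restrict Ω), coefC T g 0 x = 0 := by
    filter_upwards [h.2.2 0] with x hx
    simpa using hx.1
  rw [halfPerp, ← tsum_mul_left, ← (hasSum_integral_coef_mul hT hm hC h.2.1 hv h0).tsum_eq]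
  congr 1
  funext k
  congr 1
  rw [← integral_const_mul]
  refine integral_congr_ae ?_
  filter_upwards [h.2.2 k] with x ⟨h1, h2⟩
  rw [h1, h2]
  ring

/-- For k ≥ 1, kω ≤ (kω)²/ω, and the coefficients of g carry the factor (kω)². -/
theorem IsPeriodicDt.hasHalfDt (hT : 0 < T) {u g : Sp d × ℝ → ℝ} (h : IsPeriodicDt Ω T u g) :
    HasHalfDt Ω T u := by
  have hf := freq_pos hT
  refine Summable.of_nonneg_of_le (fun k => ?_) (fun k => ?_)
    ((summable_integral_coef_sq hT h.2.1).mul_left (freq T)⁻¹)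
  · have : 0 ≤ ∫ x in Ω, (coefC T u k x ^ 2 + coefS T u k x ^ 2) :=
      integral_nonneg fun x => by positivity
    positivity
  · rcases Nat.eq_zero_or_pos k with rfl | hk
    · simp only [Nat.cast_zero, zero_mul]
      have : 0 ≤ ∫ x in Ω, (coefC T g 0 x ^ 2 + coefS T g 0 x ^ 2) :=
        integral_nonneg fun x => by positivity
      positivity
    rw [← integral_const_mul, ← integral_const_mul]
    refine integral_mono_ae ((integrable_coef_sq hT h.1 k).const_mul _)
      ((integrable_coef_sq hT h.2.1 k).const_mul _) ?_
    filter_upwards [h.2.2 k] with x ⟨h1, h2⟩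
    rw [h1, h2]
    have hk1 : (1 : ℝ) ≤ k := by exact_mod_cast hk
    have : (freq T)⁻¹ * ((k * freq T * coefS T u k x) ^ 2 + (-(k * freq T * coefC T u k x)) ^ 2) =
        k * (k * freq T * (coefC T u k x ^ 2 + coefS T u k x ^ 2)) := by
      field_simp
      ring
    rw [this]
    exact le_mul_of_one_le_left (by positivity) hk1

end Parseval

/-! ### Averaging test functions in time -/

section TimeAverage

variable {d : ℕ} {Ω : Set (Sp d)} {T : ℝ}

theorem coefE_of_support {f : Sp d × ℝ → ℝ} (h : ∀ z, z ∉ cyl Ω T → f z = 0) (e : ℝ → ℝ) (x : Sp d) :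
    coefE T e f x = ∫ t, e t • f (x, t) := by
  rw [coefE]
  exact setIntegral_eq_integral_of_forall_compl_eq_zero fun t ht => by
    rw [h (x, t) fun hz => ht hz.2, smul_zero]

/-- The average is the convolution of e with t ↦ φ(x,-t), evaluated at 0, so smoothness in the
parameter x is inherited from φ. -/
theorem IsTest.contDiff_coefE {φ : Sp d × ℝ → ℝ} (h : IsTest Ω T φ) (e : C(ℝ, ℝ)) :
    ContDiff ℝ ∞ (coefE T e φ) := by
  have hg : ContDiff ℝ ∞ (fun q : Sp d × ℝ => φ (q.1, - q.2)) :=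
    h.1.comp (contDiff_fst.prodMk contDiff_snd.neg)
  have key := contDiffOn_convolution_right_with_param_comp (μ := (volume : Measure ℝ)) (n := ⊤)
    (ContinuousLinearMap.mul ℝ ℝ) (v := fun _ : Sp d => (0 : ℝ)) contDiffOn_const (f := e)
    (g := fun x t => φ (x, - t)) isOpen_univ (isCompact_Icc (a := -T) (b := 0))
    (fun x t _ ht => h.eq_zero fun hz => ht (by
      have h1 := hz.2.1
      have h2 := hz.2.2
      exact ⟨by simp at h2; linarith, by simp at h1; linarith⟩))
    e.continuous.locallyIntegrable hg.contDiffOn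
  refine (congrArg (ContDiff ℝ ∞) (funext fun x => ?_)).mpr (contDiffOn_univ.1 key)
  rw [coefE_of_support fun z hz => h.eq_zero hz]
  simp only [convolution_def, ContinuousLinearMap.mul_apply', zero_sub, neg_neg, smul_eq_mul]

theorem IsTest.tsupport_coefE_subset {φ : Sp d × ℝ → ℝ} (h : IsTest Ω T φ) (e : ℝ → ℝ) :
    tsupport (coefE T e φ) ⊆ Prod.fst '' tsupport φ := by
  have hc : IsCompact (tsupport φ) := h.2.1
  refine closure_minimal (fun x hx => ?_) (hc.image continuous_fst).isClosed
  by_contra hn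
  refine hx ?_
  have h0 : ∀ t, φ (x, t) = 0 := fun t =>
    image_eq_zero_of_notMem_tsupport fun ht => hn ⟨(x, t), ht, rfl⟩
  simp [coefE, h0]

theorem IsTest.fderiv_coefE {φ : Sp d × ℝ → ℝ} (h : IsTest Ω T φ) (e : C(ℝ, ℝ)) (x v : Sp d) :
    fderiv ℝ (coefE T e φ) x v = ∫ t in Ioo 0 T, e t * fderiv ℝ φ (x, t) (v, 0) := by
  have hcf : Continuous (fderiv ℝ φ) := h.1.continuous_fderiv (by simp)
  obtain ⟨C, hC⟩ := hcf.bounded_above_of_compact_support (h.2.1.fderiv (𝕜 := ℝ))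
  have hC0 : 0 ≤ C := (norm_nonneg _).trans (hC 0)
  have hφx : ∀ x, Continuous fun t => φ (x, t) := fun x =>
    h.1.continuous.comp (continuous_const.prodMk continuous_id)
  let F' : Sp d → ℝ → Sp d →L[ℝ] ℝ := fun x t =>
    e t • (fderiv ℝ φ (x, t)).comp (ContinuousLinearMap.inl ℝ (Sp d) ℝ)
  have hF'c : ∀ x, Continuous (F' x) := fun x =>
    e.continuous.smul ((hcf.comp (continuous_const.prodMk continuous_id)).clm_comp continuous_const)
  have hint : ∀ {E : Type} [NormedAddCommGroup E] (f : ℝ → E), Continuous f →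
      Integrable f (volume.restrict (Ioo 0 T)) := fun f hf =>
    (hf.continuousOn.integrableOn_Icc (a := 0) (b := T)).mono_set Ioo_subset_Icc_self
  have hb : ∀ x t, ‖F' x t‖ ≤ ‖e t‖ * C := fun x t => by
    rw [norm_smul]
    refine mul_le_mul_of_nonneg_left ?_ (norm_nonneg _)
    refine (ContinuousLinearMap.opNorm_comp_le _ _).trans ?_
    calc ‖fderiv ℝ φ (x, t)‖ * ‖ContinuousLinearMap.inl ℝ (Sp d) ℝ‖ ≤ C * 1 :=
          mul_le_mul (hC _) (ContinuousLinearMap.norm_inl_le_one ℝ (Sp d) ℝ) (norm_nonneg _) hC0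
      _ = C := mul_one C
  have hd := hasFDerivAt_integral_of_dominated_of_fderiv_le (𝕜 := ℝ)
    (μ := volume.restrict (Ioo 0 T))
    (F := fun x t => e t • φ (x, t)) (F' := F') (x₀ := x) (bound := fun t => ‖e t‖ * C)
    univ_mem (Eventually.of_forall fun x => (e.continuous.smul (hφx x)).aestronglyMeasurable)
    (hint _ (e.continuous.smul (hφx x))) (hF'c x).aestronglyMeasurable
    (Eventually.of_forall fun t x _ => hb x t)
    (hint _ (e.continuous.norm.mul continuous_const))
    (Eventually.of_forall fun t x _ => by
      have h1 : HasFDerivAt (fun x : Sp d => (x, t)) (ContinuousLinearMap.inl ℝ (Sp d) ℝ) x :=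
        (hasFDerivAt_id x).prodMk (hasFDerivAt_const t x)
      have h2 := (h.1.differentiable (by simp) (x, t)).hasFDerivAt.comp x h1
      exact h2.const_smul (e t))
  change fderiv ℝ (fun x => ∫ t in Ioo 0 T, e t • φ (x, t)) x v = _
  rw [hd.fderiv, ← ContinuousLinearMap.apply_apply v,
    ← ContinuousLinearMap.integral_comp_comm _ (hint _ (hF'c x))]
  rfl

theorem coefE_gradX_apply {φ : Sp d × ℝ → ℝ} (h : ContDiff ℝ ∞ φ) (e : C(ℝ, ℝ)) (x : Sp d)
    (i : Fin d) :
    coefE T e (gradX φ) x i =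
      ∫ t in Ioo 0 T, e t * fderiv ℝ φ (x, t) (EuclideanSpace.single i 1, 0) := by
  have hc : Continuous fun t => e t • gradX φ (x, t) :=
    e.continuous.smul ((continuous_gradX h).comp (continuous_const.prodMk continuous_id))
  have hi : Integrable (fun t => e t • gradX φ (x, t)) (volume.restrict (Ioo 0 T)) :=
    (hc.continuousOn.integrableOn_Icc (a := 0) (b := T)).mono_set Ioo_subset_Icc_self
  exact ((EuclideanSpace.proj (𝕜 := ℝ) i).integral_comp_comm hi).symm

variable [IsFiniteMeasure ((volume : Measure (Sp d)).restrict Ω)]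

/-- Taking a time coefficient and multiplying by e(t) acts in t alone, so it commutes with ∇ₓ and
keeps the spatial support compactly inside Ω. -/
theorem IsTest.tensL_adjoint_mem (hT : 0 < T) {φ : Sp d × ℝ → ℝ} (h : IsTest Ω T φ)
    {e e' : C(ℝ, ℝ)} (he : ContDiff ℝ ∞ e) :
    (WithLp.toLp 2
      (tensL Ω T ℝ e ((tensL Ω T ℝ e').adjoint (h.isLatTest.memL2.toLp φ)),
       tensL Ω T (Sp d) e ((tensL Ω T (Sp d) e').adjoint (h.isLatTest.memL2_gradX.toLp (gradX φ))))
      : PairSp Ω T) ∈ energySpace Ω T := by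
  -- The function e need not have compact support; a bump equal to 1 on (0,T) repairs this without
  -- changing anything on Q.
  let b : ContDiffBump (0 : ℝ) := ⟨T + 1, T + 2, by linarith, by linarith⟩
  have hb1 : ∀ t ∈ Ioo 0 T, b t = 1 := fun t ht => b.one_of_mem_closedBall (by
    rw [mem_closedBall_zero_iff, Real.norm_eq_abs, abs_of_pos ht.1]
    exact ht.2.le.trans (by change T ≤ T + 1; linarith))
  have hχ : ContDiff ℝ ∞ fun t => b t * e t := b.contDiff.mul he
  have hψ := h.contDiff_coefE e'
  have hsub := h.tsupport_coefE_subset (e' : ℝ → ℝ)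
  have hlat : IsLatTest Ω (fun z => (b z.2 * e z.2) * coefE T e' φ z.1) :=
    isLatTest_mul hχ b.hasCompactSupport.mul_right hψ
      ((h.2.1.image continuous_fst).of_isClosed_subset (isClosed_tsupport _) hsub)
      (hsub.trans (by rintro _ ⟨z, hz, rfl⟩; exact (h.2.2 hz).1))
  have hQ : ∀ᵐ z ∂(muQ Ω T), z.2 ∈ Ioo 0 T := by
    rw [muQ_eq_prod]
    exact Measure.quasiMeasurePreserving_snd.ae (ae_restrict_mem measurableSet_Ioo)
  refine Set.mem_of_eq_of_mem ?_ (hlat.mem_energySpace hT)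
  refine (WithLp.ext_iff 2).2 (Prod.ext ?_ ?_)
  · change tensL Ω T ℝ e ((tensL Ω T ℝ e').adjoint (h.isLatTest.memL2.toLp φ)) = hlat.memL2.toLp _
    rw [adjoint_tensL_toLp, tensL_toLp]
    refine MemLp.toLp_congr _ _ ?_
    filter_upwards [hQ] with z hz
    rw [hb1 _ hz, one_mul, smul_eq_mul]
  · change tensL Ω T (Sp d) e ((tensL Ω T (Sp d) e').adjoint
      (h.isLatTest.memL2_gradX.toLp (gradX φ))) = hlat.memL2_gradX.toLp _
    rw [adjoint_tensL_toLp, tensL_toLp]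
    refine MemLp.toLp_congr _ _ ?_
    filter_upwards [hQ] with z hz
    rw [gradX_mul_time (φ := fun z => coefE T e' φ z.1) (χ := fun t => b t * e t)
      ((hψ.differentiable (by simp)).comp differentiable_fst) (hχ.differentiable (by simp)),
      hb1 _ hz, one_mul]
    congr 1
    ext i
    have hd : HasFDerivAt (fun z : Sp d × ℝ => coefE T e' φ z.1)
        ((fderiv ℝ (coefE T e' φ) z.1).comp (ContinuousLinearMap.fst ℝ (Sp d) ℝ)) z :=
      (hψ.differentiable (by simp) z.1).hasFDerivAt.comp z hasFDerivAt_fst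
    rw [coefE_gradX_apply h.1, gradX_apply, hd.fderiv]
    exact (h.fderiv_coefE e' z.1 _).symm

end TimeAverage

/-! ### Skew operators A B* - B A* and their commutation relations -/

section Adjoint

variable {H K : Type*} [NormedAddCommGroup H] [InnerProductSpace ℝ H] [CompleteSpace H]
  [NormedAddCommGroup K] [InnerProductSpace ℝ K] [CompleteSpace K]

theorem inner_skew_comp_adjoint (A B : K →L[ℝ] H) (c : ℝ) (f g : H) :
    ⟪c • (A (B.adjoint f) - B (A.adjoint f)), g⟫ = - ⟪f, c • (A (B.adjoint g) - B (A.adjoint g))⟫ := by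
  have h : ∀ A B : K →L[ℝ] H, ⟪A (B.adjoint f), g⟫ = ⟪f, B (A.adjoint g)⟫ := fun A B => by
    rw [← ContinuousLinearMap.adjoint_inner_right, ContinuousLinearMap.adjoint_inner_left]
  rw [real_inner_smul_left, real_inner_smul_right, inner_sub_left, inner_sub_right, h A B, h B A]
  ring

theorem adjoint_comm_of_symm {A : K →L[ℝ] H} {M : H →L[ℝ] H} {m : K →L[ℝ] K}
    (hM : ∀ f g, ⟪M f, g⟫ = ⟪f, M g⟫) (hm : ∀ a b, ⟪m a, b⟫ = ⟪a, m b⟫)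
    (h : ∀ a, A (m a) = M (A a)) (f : H) : A.adjoint (M f) = m (A.adjoint f) := by
  refine ext_inner_right ℝ fun a => ?_
  rw [ContinuousLinearMap.adjoint_inner_left, hM, ← h, hm, ContinuousLinearMap.adjoint_inner_left]

theorem skew_comp_adjoint_comm {A B : K →L[ℝ] H} {M : H →L[ℝ] H} {m : K →L[ℝ] K}
    (hM : ∀ f g, ⟪M f, g⟫ = ⟪f, M g⟫) (hm : ∀ a b, ⟪m a, b⟫ = ⟪a, m b⟫)
    (hA : ∀ a, A (m a) = M (A a)) (hB : ∀ a, B (m a) = M (B a)) (c : ℝ) (f : H) :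
    c • (A (B.adjoint (M f)) - B (A.adjoint (M f))) =
      M (c • (A (B.adjoint f) - B (A.adjoint f))) := by
  rw [adjoint_comm_of_symm hM hm hA, adjoint_comm_of_symm hM hm hB, hA, hB, map_smul, map_sub]

/-- Pairings with the ranges of A and B determine the adjoints. With A, B multiplication by cos and
sin modes, this reads off relations between Fourier coefficients. -/
theorem adjoint_eq_smul_adjoint {A B : K →L[ℝ] H} {c : ℝ} {u g : H}
    (h : ∀ a, ⟪g, A a⟫ = c * ⟪u, B a⟫) : A.adjoint g = c • B.adjoint u := by
  refine ext_inner_right ℝ fun a => ?_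
  rw [ContinuousLinearMap.adjoint_inner_left, real_inner_smul_left,
    ContinuousLinearMap.adjoint_inner_left, h]

theorem continuous_toLp_map {E G : Type*} [NormedAddCommGroup E] [InnerProductSpace ℝ E]
    [NormedAddCommGroup G] [InnerProductSpace ℝ G] (A : E →L[ℝ] E) (B : G →L[ℝ] G) :
    Continuous fun x : WithLp 2 (E × G) => WithLp.toLp 2 (A x.fst, B x.snd) :=
  (WithLp.prod_continuous_toLp 2 _ _).comp
    ((A.continuous.comp (WithLp.fstL 2 ℝ _ _).continuous).prodMk
      (B.continuous.comp (WithLp.sndL 2 ℝ _ _).continuous))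

end Adjoint

/-! ### The truncated time derivative -/

section TruncatedDerivative

variable {d : ℕ} {Ω : Set (Sp d)} {T : ℝ}

theorem integral_cos_int (hT : 0 < T) (n : ℤ) :
    ∫ t in (0 : ℝ)..T, Real.cos (n * freq T * t) = if n = 0 then T else 0 := by
  split_ifs with h
  · simp [h]
  have hn : (n : ℝ) * freq T ≠ 0 := mul_ne_zero (by exact_mod_cast h) (freq_pos hT).ne'
  have hTn : (n : ℝ) * freq T * T = ((2 * n : ℤ) : ℝ) * Real.pi := by
    rw [freq]; push_cast; field_simp
  rw [intervalIntegral.integral_comp_mul_left _ hn, integral_cos, hTn, Real.sin_int_mul_pi]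
  simp

theorem integral_sin_int (hT : 0 < T) (n : ℤ) :
    ∫ t in (0 : ℝ)..T, Real.sin (n * freq T * t) = 0 := by
  rcases eq_or_ne n 0 with rfl | h
  · simp
  have hn : (n : ℝ) * freq T ≠ 0 := mul_ne_zero (by exact_mod_cast h) (freq_pos hT).ne'
  have hTn : (n : ℝ) * freq T * T = n * (2 * Real.pi) := by
    rw [freq]; field_simp
  rw [intervalIntegral.integral_comp_mul_left _ hn, integral_sin, hTn, Real.cos_int_mul_two_pi]
  simp

theorem intervalIntegrable_cos_int (n : ℤ) :
    IntervalIntegrable (fun t => Real.cos (n * freq T * t)) volume 0 T :=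
  (continuous_cos_freq n T).intervalIntegrable _ _

theorem intervalIntegrable_sin_int (n : ℤ) :
    IntervalIntegrable (fun t => Real.sin (n * freq T * t)) volume 0 T :=
  (continuous_sin_freq n T).intervalIntegrable _ _

/-- The factor j disposes of j = k = 0, where the integral is T instead of T/2; `modeDt` carries the
same factor. -/
theorem integral_cosF_cosF (hT : 0 < T) (j k : ℕ) :
    j * ∫ t in Ioo 0 T, cosF T j t * cosF T k t = if j = k then j * (T / 2) else 0 := by
  rw [← integral_Ioc_eq_integral_Ioo, ← intervalIntegral.integral_of_le hT.le]
  have e : ∀ t, cosF T j t * cosF T k t = 1 / 2 * (Real.cos (((j - k : ℤ) : ℝ) * freq T * t)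
      + Real.cos (((j + k : ℤ) : ℝ) * freq T * t)) := fun t => by
    have h1 : ((j - k : ℤ) : ℝ) * freq T * t = j * freq T * t - k * freq T * t := by
      push_cast; ring
    have h2 : ((j + k : ℤ) : ℝ) * freq T * t = j * freq T * t + k * freq T * t := by
      push_cast; ring
    rw [h1, h2, Real.cos_sub, Real.cos_add]
    simp only [cosF, ContinuousMap.coe_mk]
    ring
  simp only [e]
  rw [intervalIntegral.integral_const_mul, intervalIntegral.integral_add
    (intervalIntegrable_cos_int _) (intervalIntegrable_cos_int _), integral_cos_int hT,
    integral_cos_int hT]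
  rcases Nat.eq_zero_or_pos j with rfl | hj
  · simp
  rw [if_neg (by omega : ¬ ((j : ℤ) + k = 0)), add_zero]
  by_cases hjk : j = k
  · rw [if_pos hjk, if_pos (by omega)]; ring
  · rw [if_neg hjk, if_neg (by omega)]; ring

theorem integral_sinF_sinF (hT : 0 < T) (j k : ℕ) :
    j * ∫ t in Ioo 0 T, sinF T j t * sinF T k t = if j = k then j * (T / 2) else 0 := by
  rw [← integral_Ioc_eq_integral_Ioo, ← intervalIntegral.integral_of_le hT.le]
  have e : ∀ t, sinF T j t * sinF T k t = 1 / 2 * (Real.cos (((j - k : ℤ) : ℝ) * freq T * t)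
      - Real.cos (((j + k : ℤ) : ℝ) * freq T * t)) := fun t => by
    have h1 : ((j - k : ℤ) : ℝ) * freq T * t = j * freq T * t - k * freq T * t := by
      push_cast; ring
    have h2 : ((j + k : ℤ) : ℝ) * freq T * t = j * freq T * t + k * freq T * t := by
      push_cast; ring
    rw [h1, h2, Real.cos_sub, Real.cos_add]
    simp only [sinF, ContinuousMap.coe_mk]
    ring
  simp only [e]
  rw [intervalIntegral.integral_const_mul, intervalIntegral.integral_sub
    (intervalIntegrable_cos_int _) (intervalIntegrable_cos_int _), integral_cos_int hT,
    integral_cos_int hT]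
  rcases Nat.eq_zero_or_pos j with rfl | hj
  · simp
  rw [if_neg (by omega : ¬ ((j : ℤ) + k = 0)), sub_zero]
  by_cases hjk : j = k
  · rw [if_pos hjk, if_pos (by omega)]; ring
  · rw [if_neg hjk, if_neg (by omega)]; ring

theorem integral_sinF_cosF (hT : 0 < T) (j k : ℕ) :
    ∫ t in Ioo 0 T, sinF T j t * cosF T k t = 0 := by
  rw [← integral_Ioc_eq_integral_Ioo, ← intervalIntegral.integral_of_le hT.le]
  have e : ∀ t, sinF T j t * cosF T k t = 1 / 2 * (Real.sin (((j - k : ℤ) : ℝ) * freq T * t)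
      + Real.sin (((j + k : ℤ) : ℝ) * freq T * t)) := fun t => by
    have h1 : ((j - k : ℤ) : ℝ) * freq T * t = j * freq T * t - k * freq T * t := by
      push_cast; ring
    have h2 : ((j + k : ℤ) : ℝ) * freq T * t = j * freq T * t + k * freq T * t := by
      push_cast; ring
    rw [h1, h2, Real.sin_sub, Real.sin_add]
    simp only [sinF, cosF, ContinuousMap.coe_mk]
    ring
  simp only [e]
  rw [intervalIntegral.integral_const_mul, intervalIntegral.integral_add
    (intervalIntegrable_sin_int _) (intervalIntegrable_sin_int _), integral_sin_int hT,
    integral_sin_int hT]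
  simp

variable {F : Type*} [NormedAddCommGroup F] [InnerProductSpace ℝ F] [CompleteSpace F]

variable (Ω T F) in
/-- The time derivative of the `k`-th Fourier mode. -/
def modeDt (k : ℕ) : Lp F 2 (muQ Ω T) →L[ℝ] Lp F 2 (muQ Ω T) :=
  (k * freq T * (2 / T)) •
    ((tensL Ω T F (cosF T k)).comp (tensL Ω T F (sinF T k)).adjoint
      - (tensL Ω T F (sinF T k)).comp (tensL Ω T F (cosF T k)).adjoint)

variable (Ω T F) in
/-- The time derivative of the partial sums of the Fourier series in time. -/
def truncDt (N : ℕ) : Lp F 2 (muQ Ω T) →L[ℝ] Lp F 2 (muQ Ω T) :=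
  ∑ k ∈ Finset.range N, modeDt Ω T F k

theorem modeDt_apply (k : ℕ) (f : Lp F 2 (muQ Ω T)) :
    modeDt Ω T F k f = (k * freq T * (2 / T)) •
      (tensL Ω T F (cosF T k) ((tensL Ω T F (sinF T k)).adjoint f)
        - tensL Ω T F (sinF T k) ((tensL Ω T F (cosF T k)).adjoint f)) := rfl

theorem truncDt_apply (N : ℕ) (f : Lp F 2 (muQ Ω T)) :
    truncDt Ω T F N f = ∑ k ∈ Finset.range N, modeDt Ω T F k f :=
  sum_apply _ _ _

theorem inner_modeDt (k : ℕ) (f g : Lp F 2 (muQ Ω T)) :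
    ⟪modeDt Ω T F k f, g⟫ = - ⟪f, modeDt Ω T F k g⟫ := by
  have h := inner_skew_comp_adjoint (tensL Ω T F (cosF T k)) (tensL Ω T F (sinF T k))
    (k * freq T * (2 / T)) f g
  exact h

theorem inner_truncDt (N : ℕ) (f g : Lp F 2 (muQ Ω T)) :
    ⟪truncDt Ω T F N f, g⟫ = - ⟪f, truncDt Ω T F N g⟫ := by
  simp only [truncDt_apply, sum_inner, inner_sum, inner_modeDt, Finset.sum_neg_distrib]

theorem modeDt_mulL {m : Sp d → ℝ} (hm : MemLp m ∞ (volume.restrict Ω)) (k : ℕ)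
    (f : Lp F 2 (muQ Ω T)) :
    modeDt Ω T F k (mulL _ (memLp_top_fst hm) f) =
      mulL _ (memLp_top_fst hm) (modeDt Ω T F k f) := by
  have h := skew_comp_adjoint_comm (A := tensL Ω T F (cosF T k)) (B := tensL Ω T F (sinF T k))
    (M := mulL _ (memLp_top_fst hm)) (m := mulL m hm) (inner_mulL_comm _ (memLp_top_fst hm))
    (inner_mulL_comm m hm) (tensL_mulL hm (cosF T k)) (tensL_mulL hm (sinF T k))
    (k * freq T * (2 / T)) f
  exact h

theorem truncDt_mulL {m : Sp d → ℝ} (hm : MemLp m ∞ (volume.restrict Ω)) (N : ℕ)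
    (f : Lp F 2 (muQ Ω T)) :
    truncDt Ω T F N (mulL _ (memLp_top_fst hm) f) =
      mulL _ (memLp_top_fst hm) (truncDt Ω T F N f) := by
  rw [truncDt_apply, truncDt_apply, map_sum]
  exact Finset.sum_congr rfl fun k _ => modeDt_mulL hm k f

/-- An operator D that is skew and commutes with the symmetric operator M satisfies ⟪M D f, f⟫ =
-⟪f, M D f⟫. -/
theorem inner_mulL_truncDt {m : Sp d → ℝ} (hm : MemLp m ∞ (volume.restrict Ω)) (N : ℕ)
    (f : Lp F 2 (muQ Ω T)) :
    ⟪mulL _ (memLp_top_fst hm) (truncDt Ω T F N f), f⟫ = 0 := by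
  have h1 := inner_truncDt N (mulL _ (memLp_top_fst hm) f) f
  rw [truncDt_mulL hm, inner_mulL_comm _ _ f, real_inner_comm] at h1
  rw [real_inner_comm]
  linarith

theorem inner_mulL_truncDt' {m : Sp d → ℝ} (hm : MemLp m ∞ (volume.restrict Ω)) (N : ℕ)
    (f : Lp F 2 (muQ Ω T)) :
    ⟪mulL _ (memLp_top_fst hm) f, truncDt Ω T F N f⟫ = 0 := by
  rw [inner_mulL_comm, real_inner_comm, inner_mulL_truncDt hm]

theorem adjoint_tensL_tensL (e e' : C(ℝ, ℝ)) (a : Lp F 2 (volume.restrict Ω)) :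
    (tensL Ω T F e).adjoint (tensL Ω T F e' a) = (∫ t in Ioo 0 T, e t * e' t) • a := by
  refine ext_inner_left ℝ fun b => ?_
  rw [ContinuousLinearMap.adjoint_inner_right, inner_tensL_tensL, inner_smul_right]

theorem modeDt_cosF (hT : 0 < T) (j k : ℕ) (a : Lp F 2 (volume.restrict Ω)) :
    modeDt Ω T F j (tensL Ω T F (cosF T k) a) =
      if j = k then -(k * freq T) • tensL Ω T F (sinF T k) a else 0 := by
  rw [modeDt_apply, adjoint_tensL_tensL, adjoint_tensL_tensL, integral_sinF_cosF hT, zero_smul,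
    map_zero, zero_sub, map_smul, ← neg_smul, smul_smul]
  have h := integral_cosF_cosF hT j k
  have e : j * freq T * (2 / T) * -(∫ t in Ioo 0 T, cosF T j t * cosF T k t) =
      -(freq T * (2 / T)) * (j * ∫ t in Ioo 0 T, cosF T j t * cosF T k t) := by ring
  rw [e, h]
  split_ifs with hjk
  · subst hjk
    congr 1
    field_simp
  · rw [mul_zero, zero_smul]

theorem modeDt_sinF (hT : 0 < T) (j k : ℕ) (a : Lp F 2 (volume.restrict Ω)) :
    modeDt Ω T F j (tensL Ω T F (sinF T k) a) =
      if j = k then (k * freq T) • tensL Ω T F (cosF T k) a else 0 := by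
  have hcs : ∫ t in Ioo 0 T, cosF T j t * sinF T k t = 0 :=
    (integral_congr_ae (Eventually.of_forall fun t => mul_comm _ _)).trans
      (integral_sinF_cosF hT k j)
  rw [modeDt_apply, adjoint_tensL_tensL, adjoint_tensL_tensL, hcs, zero_smul,
    map_zero, sub_zero, map_smul, smul_smul]
  have h := integral_sinF_sinF hT j k
  have e : j * freq T * (2 / T) * (∫ t in Ioo 0 T, sinF T j t * sinF T k t) =
      freq T * (2 / T) * (j * ∫ t in Ioo 0 T, sinF T j t * sinF T k t) := by ring
  rw [e, h]
  split_ifs with hjk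
  · subst hjk
    congr 1
    field_simp
  · rw [mul_zero, zero_smul]

/-- Once N exceeds k the truncation differentiates the mode exactly, so the sequence is eventually
constant, which is what passing to the weak limit requires. -/
theorem truncDt_cosF (hT : 0 < T) {N k : ℕ} (hk : k < N) (a : Lp F 2 (volume.restrict Ω)) :
    truncDt Ω T F N (tensL Ω T F (cosF T k) a) =
      -(k * freq T) • tensL Ω T F (sinF T k) a := by
  simp only [truncDt_apply, modeDt_cosF hT, Finset.sum_ite_eq', Finset.mem_range, hk, if_true]

theorem truncDt_sinF (hT : 0 < T) {N k : ℕ} (hk : k < N) (a : Lp F 2 (volume.restrict Ω)) :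
    truncDt Ω T F N (tensL Ω T F (sinF T k) a) =
      (k * freq T) • tensL Ω T F (cosF T k) a := by
  simp only [truncDt_apply, modeDt_sinF hT, Finset.sum_ite_eq', Finset.mem_range, hk, if_true]

theorem map_mem_energySpace {A : Lp ℝ 2 (muQ Ω T) →L[ℝ] Lp ℝ 2 (muQ Ω T)}
    {B : Lp (Sp d) 2 (muQ Ω T) →L[ℝ] Lp (Sp d) 2 (muQ Ω T)}
    (h : ∀ φ, ∀ hφ : IsTest Ω T φ, (WithLp.toLp 2 (A (hφ.isLatTest.memL2.toLp φ),
      B (hφ.isLatTest.memL2_gradX.toLp (gradX φ))) : PairSp Ω T) ∈ energySpace Ω T)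
    {x : PairSp Ω T} (hx : x ∈ energySpace Ω T) :
    (WithLp.toLp 2 (A x.fst, B x.snd) : PairSp Ω T) ∈ energySpace Ω T :=
  energySpace_subset (isClosed_energySpace.preimage (continuous_toLp_map A B)) h hx

variable [IsFiniteMeasure ((volume : Measure (Sp d)).restrict Ω)]

theorem energySpace_tensL_adjoint (hT : 0 < T) {e e' : C(ℝ, ℝ)} (he : ContDiff ℝ ∞ e)
    {x : PairSp Ω T} (hx : x ∈ energySpace Ω T) :
    (WithLp.toLp 2 (tensL Ω T ℝ e ((tensL Ω T ℝ e').adjoint x.fst),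
      tensL Ω T (Sp d) e ((tensL Ω T (Sp d) e').adjoint x.snd)) : PairSp Ω T) ∈
      energySpace Ω T := by
  have h := map_mem_energySpace (A := (tensL Ω T ℝ e).comp (tensL Ω T ℝ e').adjoint)
    (B := (tensL Ω T (Sp d) e).comp (tensL Ω T (Sp d) e').adjoint)
    (fun φ hφ => hφ.tensL_adjoint_mem hT he) hx
  exact h

theorem energySpace_modeDt (hT : 0 < T) (k : ℕ) {x : PairSp Ω T} (hx : x ∈ energySpace Ω T) :
    (WithLp.toLp 2 (modeDt Ω T ℝ k x.fst, modeDt Ω T (Sp d) k x.snd) : PairSp Ω T) ∈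
      energySpace Ω T :=
  Submodule.smul_mem _ (k * freq T * (2 / T)) (Submodule.sub_mem _
    (energySpace_tensL_adjoint (e' := sinF T k) hT (contDiff_cosF k) hx)
    (energySpace_tensL_adjoint (e' := cosF T k) hT (contDiff_sinF k) hx))

/-- This makes the truncated derivative of a solution an admissible test function whose gradient is
the truncated derivative of the gradient. -/
theorem energySpace_truncDt (hT : 0 < T) (N : ℕ) {x : PairSp Ω T} (hx : x ∈ energySpace Ω T) :
    (WithLp.toLp 2 (truncDt Ω T ℝ N x.fst, truncDt Ω T (Sp d) N x.snd) : PairSp Ω T) ∈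
      energySpace Ω T := by
  induction N with
  | zero =>
    refine Set.mem_of_eq_of_mem ?_ (Submodule.zero_mem (energySpace Ω T))
    refine (WithLp.ext_iff 2).2 (Prod.ext ?_ ?_)
    · exact (truncDt_apply 0 x.fst).trans (Finset.sum_range_zero _)
    · exact (truncDt_apply 0 x.snd).trans (Finset.sum_range_zero _)
  | succ N ih =>
    refine Set.mem_of_eq_of_mem ?_ (Submodule.add_mem _ ih (energySpace_modeDt hT N hx))
    refine (WithLp.ext_iff 2).2 (Prod.ext ?_ ?_)
    · exact (truncDt_apply (N + 1) x.fst).trans ((Finset.sum_range_succ _ N).trans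
        (congrArg (· + modeDt Ω T ℝ N x.fst) (truncDt_apply N x.fst).symm))
    · exact (truncDt_apply (N + 1) x.snd).trans ((Finset.sum_range_succ _ N).trans
        (congrArg (· + modeDt Ω T (Sp d) N x.snd) (truncDt_apply N x.snd).symm))

theorem coefE_coeFn_ae_eq (e : C(ℝ, ℝ)) (f : Lp ℝ 2 (muQ Ω T)) :
    coefE T e f =ᵐ[volume.restrict Ω] (tensL Ω T ℝ e).adjoint f := by
  have h := coefE_ae_eq_adjoint e (Lp.memLp f)
  have h' : (Lp.memLp f).toLp f = f := Lp.toLp_coeFn f (Lp.memLp f)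
  exact h.trans (Eventually.of_forall fun x => by rw [h'])

theorem coefE_eq_of_adjoint {e e' : C(ℝ, ℝ)} {u g : Lp ℝ 2 (muQ Ω T)} {c : ℝ}
    (h : (tensL Ω T ℝ e).adjoint g = c • (tensL Ω T ℝ e').adjoint u) :
    ∀ᵐ x ∂(volume.restrict Ω), coefE T e g x = c * coefE T e' u x := by
  have h1 := coefE_coeFn_ae_eq e g
  have h2 := coefE_coeFn_ae_eq e' u
  generalize (tensL Ω T ℝ e).adjoint g = a at h h1
  generalize (tensL Ω T ℝ e').adjoint u = b at h h2
  subst h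
  filter_upwards [h1, h2, Lp.coeFn_smul c b] with x a1 a2 a3
  rw [a1, a2, a3, Pi.smul_apply, smul_eq_mul]

/-- The weak limits of the truncated time derivatives are time derivatives. -/
theorem isPeriodicDt_of_truncDt (hT : 0 < T) {u g : Lp ℝ 2 (muQ Ω T)}
    (h : ∀ e e', (∀ᶠ N in atTop, truncDt Ω T ℝ N e = e') → ⟪g, e⟫ = - ⟪u, e'⟫) :
    IsPeriodicDt Ω T u g := by
  refine ⟨Lp.memLp u, Lp.memLp g, fun k => ?_⟩
  -- Testing with cos(kωt)a(x), for arbitrary a, yields the cosine coefficient of g from the sine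
  -- coefficient of u.
  have h1 := coefE_eq_of_adjoint (adjoint_eq_smul_adjoint (A := tensL Ω T ℝ (cosF T k))
    (B := tensL Ω T ℝ (sinF T k)) (c := k * freq T) (u := u) (g := g) fun a => by
      rw [h _ _ ((eventually_gt_atTop k).mono fun N hN => truncDt_cosF hT hN a),
        real_inner_smul_right, neg_mul, neg_neg])
  have h2 := coefE_eq_of_adjoint (adjoint_eq_smul_adjoint (A := tensL Ω T ℝ (sinF T k))
    (B := tensL Ω T ℝ (cosF T k)) (c := -(k * freq T)) (u := u) (g := g) fun a => by
      rw [h _ _ ((eventually_gt_atTop k).mono fun N hN => truncDt_sinF hT hN a),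
        real_inner_smul_right, neg_mul])
  rw [coefC_eq_coefE hT, coefC_eq_coefE hT, coefS_eq_coefE hT, coefS_eq_coefE hT]
  filter_upwards [h1, h2] with x b1 b2
  rw [b1, b2]
  constructor <;> ring

end TruncatedDerivative

/-! ### The optimality system and the quadratic expansion of the cost -/

section OptimalitySystem

variable {d : ℕ} {Ω : Set (Sp d)} {T : ℝ}

theorem toLp_eq_of_ae {α F : Type*} [MeasurableSpace α] {μ : Measure α} [NormedAddCommGroup F]
    {f : α → F} (hf : MemLp f 2 μ) {g : Lp F 2 μ} (h : f =ᵐ[μ] g) : hf.toLp f = g :=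
  (MemLp.toLp_congr hf (Lp.memLp g) h).trans (Lp.toLp_coeFn g _)

theorem integrable_inner_of_memLp {α F : Type*} [MeasurableSpace α] {μ : Measure α}
    [NormedAddCommGroup F] [InnerProductSpace ℝ F] {f g : α → F} (hf : MemLp f 2 μ)
    (hg : MemLp g 2 μ) : Integrable (fun z => ⟪f z, g z⟫) μ := by
  refine (L2.integrable_inner (𝕜 := ℝ) (hf.toLp f) (hg.toLp g)).congr ?_
  filter_upwards [hf.coeFn_toLp, hg.coeFn_toLp] with z h1 h2
  rw [h1, h2]

theorem inner_mulL_fst {F : Type*} [NormedAddCommGroup F] [InnerProductSpace ℝ F] {m : Sp d → ℝ}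
    (hm : MemLp m ∞ (volume.restrict Ω)) {f g : Sp d × ℝ → F} (hf : MemLp f 2 (muQ Ω T))
    (hg : MemLp g 2 (muQ Ω T)) :
    ⟪mulL _ (memLp_top_fst hm) (hf.toLp f), hg.toLp g⟫ = ∫ z, m z.1 * ⟪f z, g z⟫ ∂(muQ Ω T) := by
  rw [mulL_toLp, inner_toLp]
  simp only [real_inner_smul_left]

theorem integrable_mul_inner {F : Type*} [NormedAddCommGroup F] [InnerProductSpace ℝ F]
    {m : Sp d → ℝ} (hm : MemLp m ∞ (volume.restrict Ω)) {f g : Sp d × ℝ → F}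
    (hf : MemLp f 2 (muQ Ω T)) (hg : MemLp g 2 (muQ Ω T)) :
    Integrable (fun z => m z.1 * ⟪f z, g z⟫) (muQ Ω T) := by
  refine (integrable_inner_of_memLp (memLp_bdd_smul (memLp_top_fst hm) hf) hg).congr ?_
  exact Eventually.of_forall fun z => real_inner_smul_left _ _ _

theorem inner_mulL_fst_real {m : Sp d → ℝ}
    (hm : MemLp m ∞ (volume.restrict Ω)) {f g : Sp d × ℝ → ℝ} (hf : MemLp f 2 (muQ Ω T))
    (hg : MemLp g 2 (muQ Ω T)) :
    ⟪mulL _ (memLp_top_fst hm) (hf.toLp f), hg.toLp g⟫ = ∫ z, m z.1 * f z * g z ∂(muQ Ω T) := by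
  rw [mulL_toLp, inner_toLp_real]
  rfl

theorem IsPeriodicDt.congr (hT : 0 < T) {u v g : Sp d × ℝ → ℝ} (h : IsPeriodicDt Ω T u g)
    (huv : u =ᵐ[muQ Ω T] v) : IsPeriodicDt Ω T v g := by
  refine ⟨(memLp_congr_ae huv).1 h.1, h.2.1, fun k => ?_⟩
  filter_upwards [h.2.2 k, coefC_congr_ae hT huv k, coefS_congr_ae hT huv k] with x h1 h2 h3
  rwa [← h2, ← h3]

theorem SolvesKKT.isState {σ ν : Sp d → ℝ} {lam : ℝ} (hν : MemLp ν ∞ (volume.restrict Ω))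
    {yd y p : Sp d × ℝ → ℝ} (h : SolvesKKT Ω T σ ν lam yd y p) :
    IsState Ω T σ ν (fun z => - lam⁻¹ * p z) y := by
  obtain ⟨hy, hp, -, h2⟩ := h
  refine ⟨hy, fun q hq => ?_⟩
  have e := h2 q hq
  have i1 : Integrable (fun s => lam⁻¹ * p s * q s) (muQ Ω T) :=
    (hp.1.memL2.const_mul lam⁻¹).integrable_mul hq.1.memL2
  rw [integral_add (integrable_mul_inner hν hy.1.memL2_weakGrad hq.1.memL2_weakGrad) i1] at e
  have e2 : ∫ z, -lam⁻¹ * p z * q z ∂(muQ Ω T) = - ∫ z, lam⁻¹ * p z * q z ∂(muQ Ω T) := by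
    rw [← integral_neg]
    congr 1; funext z; ring
  rw [e2]
  linarith

theorem IsState.congr {σ ν : Sp d → ℝ} (hT : 0 < T) {u u' y y' : Sp d × ℝ → ℝ}
    (h : IsState Ω T σ ν u y) (hy : y =ᵐ[muQ Ω T] y') (hu : u =ᵐ[muQ Ω T] u') :
    IsState Ω T σ ν u' y' := by
  refine ⟨⟨h.1.1.congr hy, h.1.2.congr hT hy⟩, fun q hq => ?_⟩
  rw [← weakGrad_congr hy, ← halfPerp_congr hT σ hy (EventuallyEq.refl _ q),
    ← integral_congr_left hu]
  exact h.2 q hq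

theorem SolvesKKT.congr {σ ν : Sp d → ℝ} {lam : ℝ} (hT : 0 < T) {yd y p y' p' : Sp d × ℝ → ℝ}
    (h : SolvesKKT Ω T σ ν lam yd y p) (hy : y =ᵐ[muQ Ω T] y') (hp : p =ᵐ[muQ Ω T] p') :
    SolvesKKT Ω T σ ν lam yd y' p' := by
  obtain ⟨a, b, h1, h2⟩ := h
  refine ⟨⟨a.1.congr hy, a.2.congr hT hy⟩, ⟨b.1.congr hp, b.2.congr hT hp⟩,
    fun z hz => ?_, fun q hq => ?_⟩
  · rw [← h1 z hz, weakGrad_congr hp, halfPerp_congr hT σ hp (EventuallyEq.refl _ z)]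
    congr 1
    refine integral_congr_ae ?_
    filter_upwards [hy] with s hs
    rw [hs]
  · rw [← h2 q hq, weakGrad_congr hy, halfPerp_congr hT σ hy (EventuallyEq.refl _ q)]
    congr 1
    refine integral_congr_ae ?_
    filter_upwards [hp] with s hs
    rw [hs]

theorem cost_congr {lam : ℝ} {yd y u y' u' : Sp d × ℝ → ℝ} (hy : y =ᵐ[muQ Ω T] y')
    (hu : u =ᵐ[muQ Ω T] u') : cost Ω T lam yd y u = cost Ω T lam yd y' u' := by
  rw [cost, cost, normQ_congr hu]
  congr 3
  exact normQ_congr (hy.sub (EventuallyEq.refl _ yd))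

theorem normQ_sub_eq {f g : Sp d × ℝ → ℝ} (hf : MemLp f 2 (muQ Ω T)) (hg : MemLp g 2 (muQ Ω T)) :
    normQ Ω T (fun z => f z - g z) = ‖hf.toLp f - hg.toLp g‖ := by
  rw [← MemLp.toLp_sub hf hg]
  exact normQ_eq_norm_toLp (hf.sub hg)

/-- The cost of any admissible pair in terms of the distance to a solution of the optimality
system. -/
theorem SolvesKKT.cost_eq {σ ν : Sp d → ℝ} {lam : ℝ} (hlam : 0 < lam)
    (hν : MemLp ν ∞ (volume.restrict Ω)) {yd y p z v : Sp d × ℝ → ℝ}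
    (hyd : MemLp yd 2 (muQ Ω T)) (h : SolvesKKT Ω T σ ν lam yd y p) (hv : MemLp v 2 (muQ Ω T))
    (hz : IsState Ω T σ ν v z) :
    cost Ω T lam yd z v = cost Ω T lam yd y (fun s => - lam⁻¹ * p s)
      + 1 / 2 * normQ Ω T (fun s => z s - y s) ^ 2
      + lam / 2 * normQ Ω T (fun s => v s - - lam⁻¹ * p s) ^ 2 := by
  have hst := h.isState hν
  obtain ⟨hy, hp, h1, -⟩ := h
  have hzm := hz.1.1.memL2
  have hym := hy.1.memL2
  have hpm := hp.1.memL2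
  have hu : MemLp (fun s => - lam⁻¹ * p s) 2 (muQ Ω T) := hpm.const_mul _
  have eU : hu.toLp _ = (-lam⁻¹) • hpm.toLp p := MemLp.toLp_const_smul (-lam⁻¹) hpm
  -- The adjoint equation is tested with both states z and y, and both state equations with p.
  -- Subtracting identifies ⟨y - yd, z - y⟩ with ⟨v - u, p⟩, where u = -p/λ, so the first-order
  -- terms of the cost cancel.
  have a1 := h1 z hz.1
  have a2 := h1 y hy
  have a3 := hz.2 p hp
  have a4 := hst.2 p hp
  have i1 : Integrable (fun s => y s * z s) (muQ Ω T) := hym.integrable_mul hzm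
  have i2 : Integrable (fun s => y s * y s) (muQ Ω T) := hym.integrable_mul hym
  rw [integral_sub i1 (integrable_mul_inner hν hp.1.memL2_weakGrad hz.1.1.memL2_weakGrad),
    ← inner_toLp_real hym hzm, ← inner_toLp_real hyd hzm] at a1
  rw [integral_sub i2 (integrable_mul_inner hν hp.1.memL2_weakGrad hy.1.memL2_weakGrad),
    ← inner_toLp_real hym hym, ← inner_toLp_real hyd hym] at a2
  simp only [real_inner_comm (weakGrad Ω T p _)] at a3 a4
  rw [← inner_toLp_real hv hpm] at a3
  rw [← inner_toLp_real hu hpm] at a4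
  have b1 := halfPerp_antisymm (Ω := Ω) (T := T) σ p z
  have b2 := halfPerp_antisymm (Ω := Ω) (T := T) σ p y
  rw [cost, cost, normQ_sub_eq hzm hyd, normQ_sub_eq hym hyd, normQ_sub_eq hzm hym,
    normQ_sub_eq hv hu, normQ_eq_norm_toLp hv, normQ_eq_norm_toLp hu]
  have c : ∀ w : Lp ℝ 2 (muQ Ω T), lam * ⟪w, hu.toLp _⟫ = - ⟪w, hpm.toLp p⟫ := fun w => by
    rw [eU, real_inner_smul_right]
    field_simp
  have c1 := c (hv.toLp v)
  have c2 := c (hu.toLp _)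
  rw [real_inner_self_eq_norm_sq] at c2
  rw [real_inner_self_eq_norm_sq] at a2
  rw [real_inner_comm] at a1
  rw [real_inner_comm (hzm.toLp z) (hyd.toLp yd)] at a1
  rw [real_inner_comm (hym.toLp y) (hyd.toLp yd)] at a2
  rw [norm_sub_sq_real (hzm.toLp z) (hyd.toLp yd), norm_sub_sq_real (hym.toLp y) (hyd.toLp yd),
    norm_sub_sq_real (hzm.toLp z) (hym.toLp y), norm_sub_sq_real (hv.toLp v) (hu.toLp _)]
  linarith

variable [IsFiniteMeasure ((volume : Measure (Sp d)).restrict Ω)]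

/-- The coupled system has a solution with time derivatives in `L²(Q)`. -/
theorem exists_regular_solution (hd : 1 ≤ d) (hΩ : IsOpen Ω) (hΩb : Bornology.IsBounded Ω)
    (hT : 0 < T) {σ ν : Sp d → ℝ} (hσ : MemLp σ ∞ (volume.restrict Ω))
    (hν : MemLp ν ∞ (volume.restrict Ω)) {σ₀ ν₀ lam : ℝ} (hσ₀ : 0 < σ₀) (hν₀ : 0 < ν₀)
    (hlam : 0 < lam) (hσl : ∀ᵐ x ∂(volume.restrict Ω), σ₀ ≤ σ x)
    (hνl : ∀ᵐ x ∂(volume.restrict Ω), ν₀ ≤ ν x) (b : Lp ℝ 2 (muQ Ω T)) :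
    ∃ Y ∈ energySpace Ω T, ∃ P ∈ energySpace Ω T, ∃ gy gp : Lp ℝ 2 (muQ Ω T),
      IsPeriodicDt Ω T Y.fst gy ∧ IsPeriodicDt Ω T P.fst gp ∧
      (∀ Z ∈ energySpace Ω T, ⟪Y.fst, Z.fst⟫ - ⟪mulL _ (memLp_top_fst hν) P.snd, Z.snd⟫
        + ⟪mulL _ (memLp_top_fst hσ) gp, Z.fst⟫ = ⟪b, Z.fst⟫) ∧
      (∀ Z ∈ energySpace Ω T, ⟪mulL _ (memLp_top_fst hν) Y.snd, Z.snd⟫ + lam⁻¹ * ⟪P.fst, Z.fst⟫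
        + ⟪mulL _ (memLp_top_fst hσ) gy, Z.fst⟫ = 0) := by
  obtain ⟨C, hC, hCF⟩ := exists_friedrichs (T := T) hd hΩ hΩb
  let j : energySpace Ω T →L[ℝ] Lp ℝ 2 (muQ Ω T) :=
    (WithLp.fstL 2 ℝ _ _).comp (energySpace Ω T).subtypeL
  let gr : energySpace Ω T →L[ℝ] Lp (Sp d) 2 (muQ Ω T) :=
    (WithLp.sndL 2 ℝ _ _).comp (energySpace Ω T).subtypeL
  obtain ⟨y, p, gy, gp, h1, h2, h3⟩ := exists_coupled_solution_limit j gr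
    (mulL _ (memLp_top_fst hν)) (mulL _ (memLp_top_fst hσ)) (truncDt Ω T ℝ) (truncDt Ω T (Sp d))
    hσ₀ hν₀ hlam (le_inner_mulL _ _ (ae_fst hνl)) (le_inner_mulL _ _ (ae_fst hσl))
    inner_truncDt (fun n => inner_mulL_truncDt hσ n) (fun n => inner_mulL_truncDt' hν n)
    -- The constant C + 1 bounds the full norm of the pair by its gradient part: the function costs
    -- C and the gradient itself costs 1.
    (fun n v => ⟨⟨_, energySpace_truncDt hT n v.2⟩, rfl, rfl⟩) (C := C + 1) (by linarith)
    (fun v => by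
      have e1 : ‖v‖ ≤ ‖v.1.fst‖ + ‖v.1.snd‖ := norm_pair_le v.1
      have e2 := hCF v.1 v.2
      change ‖v‖ ≤ (C + 1) * ‖v.1.snd‖
      linarith)
    (fun v => WithLp.norm_fst_le _ _) b
  exact ⟨y.1, y.2, p.1, p.2, gy, gp,
    isPeriodicDt_of_truncDt hT fun e e' he => (h3 e e' he).1,
    isPeriodicDt_of_truncDt hT fun e e' he => (h3 e e' he).2,
    fun Z hZ => h1 ⟨Z, hZ⟩, fun Z hZ => h2 ⟨Z, hZ⟩⟩

/-- With ∂ₜu in L² the form b_σ(u,·) is an L² pairing, so the equations extend to test functions in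
the whole energy space, without half a derivative in time. -/
theorem IsPeriodicDt.inner_mulL_eq_halfPerp (hT : 0 < T) {σ : Sp d → ℝ} {C : ℝ}
    (hσ : MemLp σ ∞ (volume.restrict Ω)) (hC : ∀ᵐ x ∂(volume.restrict Ω), |σ x| ≤ C)
    {u v : Sp d × ℝ → ℝ} {g V : Lp ℝ 2 (muQ Ω T)} (h : IsPeriodicDt Ω T u g)
    (hv : v =ᵐ[muQ Ω T] V) :
    ⟪mulL _ (memLp_top_fst hσ) g, V⟫ = halfPerp Ω T σ u v := by
  have hvm : MemLp v 2 (muQ Ω T) := (memLp_congr_ae hv).2 (Lp.memLp V)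
  rw [h.halfPerp_eq hT hσ.1 hC hvm, ← inner_mulL_fst_real hσ h.2.1 hvm, toLp_eq_of_ae hvm hv,
    toLp_eq_of_ae h.2.1 (EventuallyEq.refl _ _)]

/-- The variational equations for the energy space give the optimality system. -/
theorem solvesKKT_of_energySpace (hΩ : IsOpen Ω) (hT : 0 < T) {σ ν : Sp d → ℝ} {C lam : ℝ}
    (hσ : MemLp σ ∞ (volume.restrict Ω)) (hν : MemLp ν ∞ (volume.restrict Ω))
    (hC : ∀ᵐ x ∂(volume.restrict Ω), |σ x| ≤ C) {yd : Sp d × ℝ → ℝ} (hyd : MemLp yd 2 (muQ Ω T))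
    {Y P : PairSp Ω T} (hY : Y ∈ energySpace Ω T) (hP : P ∈ energySpace Ω T)
    {gy gp : Lp ℝ 2 (muQ Ω T)} (hgy : IsPeriodicDt Ω T Y.fst gy) (hgp : IsPeriodicDt Ω T P.fst gp)
    (h1 : ∀ Z ∈ energySpace Ω T, ⟪Y.fst, Z.fst⟫ - ⟪mulL _ (memLp_top_fst hν) P.snd, Z.snd⟫
        + ⟪mulL _ (memLp_top_fst hσ) gp, Z.fst⟫ = ⟪hyd.toLp yd, Z.fst⟫)
    (h2 : ∀ Z ∈ energySpace Ω T, ⟪mulL _ (memLp_top_fst hν) Y.snd, Z.snd⟫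
        + lam⁻¹ * ⟪P.fst, Z.fst⟫ + ⟪mulL _ (memLp_top_fst hσ) gy, Z.fst⟫ = 0) :
    SolvesKKT Ω T σ ν lam yd Y.fst P.fst := by
  have hYm := memH10Zero_of_mem_energySpace hΩ hY
  have hPm := memH10Zero_of_mem_energySpace hΩ hP
  have gY := toLp_eq_of_ae hYm.memL2_weakGrad (weakGrad_of_mem_energySpace hΩ hY)
  have gP := toLp_eq_of_ae hPm.memL2_weakGrad (weakGrad_of_mem_energySpace hΩ hP)
  have tY : hYm.memL2.toLp _ = Y.fst := toLp_eq_of_ae _ (EventuallyEq.refl _ _)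
  have tP : hPm.memL2.toLp _ = P.fst := toLp_eq_of_ae _ (EventuallyEq.refl _ _)
  refine ⟨⟨hYm, hgy.hasHalfDt hT⟩, ⟨hPm, hgp.hasHalfDt hT⟩, fun z hz => ?_, fun q hq => ?_⟩
  · have e := h1 _ (hz.1.mkPair_mem hT)
    change ⟪Y.fst, hz.1.memL2.toLp z⟫ - ⟪mulL _ (memLp_top_fst hν) P.snd,
      hz.1.memL2_weakGrad.toLp _⟫ + ⟪mulL _ (memLp_top_fst hσ) gp, hz.1.memL2.toLp z⟫
      = ⟪hyd.toLp yd, hz.1.memL2.toLp z⟫ at e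
    rw [hgp.inner_mulL_eq_halfPerp hT hσ hC hz.1.memL2.coeFn_toLp.symm, ← gP, ← tY,
      inner_mulL_fst hν, inner_toLp_real, inner_toLp_real] at e
    have i1 : Integrable (fun s => Y.fst s * z s) (muQ Ω T) := hYm.memL2.integrable_mul hz.1.memL2
    rw [← e, integral_sub i1 (integrable_mul_inner hν hPm.memL2_weakGrad hz.1.memL2_weakGrad)]
  · have e := h2 _ (hq.1.mkPair_mem hT)
    change ⟪mulL _ (memLp_top_fst hν) Y.snd, hq.1.memL2_weakGrad.toLp _⟫
      + lam⁻¹ * ⟪P.fst, hq.1.memL2.toLp q⟫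
      + ⟪mulL _ (memLp_top_fst hσ) gy, hq.1.memL2.toLp q⟫ = 0 at e
    rw [hgy.inner_mulL_eq_halfPerp hT hσ hC hq.1.memL2.coeFn_toLp.symm, ← gY, ← tP,
      inner_mulL_fst hν, inner_toLp_real, ← integral_const_mul] at e
    have i1 : Integrable (fun s => lam⁻¹ * (P.fst s * q s)) (muQ Ω T) :=
      (hPm.memL2.integrable_mul hq.1.memL2).const_mul _
    simp only [mul_assoc]
    rw [integral_add (integrable_mul_inner hν hYm.memL2_weakGrad hq.1.memL2_weakGrad) i1]
    exact e

end OptimalitySystem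

/-! ### The minorant: upper bound and attainment -/

section Minorant

variable {d : ℕ} {Ω : Set (Sp d)} {T : ℝ}

theorem normQ_eq_norm_of_ae {F : Type*} [NormedAddCommGroup F] [InnerProductSpace ℝ F]
    {f : Sp d × ℝ → F} {X : Lp F 2 (muQ Ω T)} (h : f =ᵐ[muQ Ω T] X) : normQ Ω T f = ‖X‖ := by
  have hf : MemLp f 2 (muQ Ω T) := (memLp_congr_ae h).2 (Lp.memLp X)
  rw [normQ_eq_norm_toLp hf, toLp_eq_of_ae hf h]

theorem mu1_pos {ν₀ σ₀ : ℝ} (hν₀ : 0 < ν₀) (hσ₀ : 0 < σ₀) : 0 < mu1 ν₀ σ₀ :=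
  mul_pos (by positivity) (lt_min hν₀ hσ₀)

theorem sqrt_two_mul_mu1_le (ν₀ σ₀ : ℝ) : Real.sqrt 2 * mu1 ν₀ σ₀ ≤ ν₀ := by
  rw [mu1, ← mul_assoc, mul_one_div_cancel (by positivity), one_mul]
  exact min_le_left _ _

/-- Test functions belong to the energy space, so a variational equation with L² right-hand side is
the definition of the divergence of its flux. -/
theorem isWeakDiv_of_energySpace {f : Sp d × ℝ → Sp d} {G : Lp (Sp d) 2 (muQ Ω T)}
    {g : Lp ℝ 2 (muQ Ω T)} (hf : f =ᵐ[muQ Ω T] G)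
    (h : ∀ Z ∈ energySpace Ω T, ⟪G, Z.snd⟫ = - ⟪g, Z.fst⟫) : IsWeakDiv Ω T f g := by
  have hfm : MemLp f 2 (muQ Ω T) := (memLp_congr_ae hf).2 (Lp.memLp G)
  refine ⟨Lp.memLp g, fun φ hφ => ?_⟩
  have e : ⟪G, hφ.isLatTest.memL2_gradX.toLp (gradX φ)⟫ = - ⟪g, hφ.isLatTest.memL2.toLp φ⟫ :=
    h _ hφ.mem_energySpace
  rw [← toLp_eq_of_ae hfm hf, ← toLp_eq_of_ae (Lp.memLp g) (EventuallyEq.refl _ _), inner_toLp,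
    inner_toLp_real] at e
  exact e

/-- Dictionary between functions and L² classes. Any representatives and any versions of the weak
derivatives are allowed, which makes the Hilbert space estimate applicable. -/
theorem minorant_eq {σ ν : Sp d → ℝ} (hσ : MemLp σ ∞ (volume.restrict Ω))
    (hν : MemLp ν ∞ (volume.restrict Ω)) {yd η ζ : Sp d × ℝ → ℝ} {τ ρ : Sp d × ℝ → Sp d}
    {B E Z gη gζ dτ dρ : Lp ℝ 2 (muQ Ω T)} {E' Z' τ' ρ' : Lp (Sp d) 2 (muQ Ω T)}
    (hyd : yd =ᵐ[muQ Ω T] B) (hη : η =ᵐ[muQ Ω T] E) (hζ : ζ =ᵐ[muQ Ω T] Z)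
    (hη' : weakGrad Ω T η =ᵐ[muQ Ω T] E') (hζ' : weakGrad Ω T ζ =ᵐ[muQ Ω T] Z')
    (hgη : weakDt Ω T η =ᵐ[muQ Ω T] gη) (hgζ : weakDt Ω T ζ =ᵐ[muQ Ω T] gζ)
    (hτ : τ =ᵐ[muQ Ω T] τ') (hρ : ρ =ᵐ[muQ Ω T] ρ')
    (hdτ : weakDiv Ω T τ =ᵐ[muQ Ω T] dτ) (hdρ : weakDiv Ω T ρ =ᵐ[muQ Ω T] dρ) (lam C m : ℝ) :
    minorant Ω T σ ν lam C m yd η ζ τ ρ =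
      1 / 2 * ‖E - B‖ ^ 2 + 1 / (2 * lam) * ‖Z‖ ^ 2
      - (⟪mulL _ (memLp_top_fst hν) E', Z'⟫ + ⟪mulL _ (memLp_top_fst hσ) gη, Z⟫
        + lam⁻¹ * ‖Z‖ ^ 2)
      - C ^ 2 / (m ^ 2 * lam) * (C * ‖E - B + dρ + mulL _ (memLp_top_fst hσ) gζ‖
        + ‖ρ' - mulL _ (memLp_top_fst hν) Z'‖) ^ 2
      - 1 / m * (C * ‖mulL _ (memLp_top_fst hσ) gη - dτ + lam⁻¹ • Z‖
        + ‖τ' - mulL _ (memLp_top_fst hν) E'‖)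
        * (C * ‖E - B + dρ + mulL _ (memLp_top_fst hσ) gζ‖
          + ‖ρ' - mulL _ (memLp_top_fst hν) Z'‖) := by
  have n1 : normQ Ω T (fun z => η z - yd z) = ‖E - B‖ := normQ_eq_norm_of_ae <| by
    filter_upwards [hη, hyd, Lp.coeFn_sub E B] with z h1 h2 h3
    rw [h1, h2, h3, Pi.sub_apply]
  have n2 : normQ Ω T ζ = ‖Z‖ := normQ_eq_norm_of_ae hζ
  have n3 : normQ Ω T (res3 Ω T σ yd ζ ρ η) = ‖E - B + dρ + mulL _ (memLp_top_fst hσ) gζ‖ :=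
    normQ_eq_norm_of_ae <| by
      filter_upwards [hη, hyd, Lp.coeFn_sub E B, Lp.coeFn_add (E - B) dρ,
        Lp.coeFn_add (E - B + dρ) (mulL _ (memLp_top_fst hσ) gζ), hdρ, hgζ,
        coeFn_mulL _ (memLp_top_fst hσ) gζ] with z h1 h2 h3 h4 h5 h6 h7 h8
      rw [h5, Pi.add_apply, h4, Pi.add_apply, h3, Pi.sub_apply, h8, res3, h1, h2, h6, h7,
        smul_eq_mul]
  have n1' : normQ Ω T (res1 Ω T σ η τ (fun z => - lam⁻¹ * ζ z)) =
      ‖mulL _ (memLp_top_fst hσ) gη - dτ + lam⁻¹ • Z‖ := normQ_eq_norm_of_ae <| by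
    filter_upwards [hζ, hdτ, hgη, Lp.coeFn_sub (mulL _ (memLp_top_fst hσ) gη) dτ,
      Lp.coeFn_add (mulL _ (memLp_top_fst hσ) gη - dτ) (lam⁻¹ • Z), Lp.coeFn_smul lam⁻¹ Z,
      coeFn_mulL _ (memLp_top_fst hσ) gη] with z h1 h2 h3 h4 h5 h6 h7
    rw [h5, Pi.add_apply, h4, Pi.sub_apply, h6, Pi.smul_apply, h7, res1, h1, h2, h3,
      smul_eq_mul, smul_eq_mul]
    ring
  have nf : ∀ {u : Sp d × ℝ → ℝ} {κ : Sp d × ℝ → Sp d} {U κ' : Lp (Sp d) 2 (muQ Ω T)},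
      weakGrad Ω T u =ᵐ[muQ Ω T] U → κ =ᵐ[muQ Ω T] κ' →
      normQ Ω T (resFlux Ω T ν u κ) = ‖κ' - mulL _ (memLp_top_fst hν) U‖ := by
    intro u κ U κ' hu hκ
    refine normQ_eq_norm_of_ae ?_
    filter_upwards [hu, hκ, Lp.coeFn_sub κ' (mulL _ (memLp_top_fst hν) U),
      coeFn_mulL _ (memLp_top_fst hν) U] with z h1 h2 h3 h4
    rw [h3, Pi.sub_apply, h4, resFlux, h1, h2]
  have mE' := (memLp_congr_ae hη').2 (Lp.memLp E')
  have mZ' := (memLp_congr_ae hζ').2 (Lp.memLp Z')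
  have mZ := (memLp_congr_ae hζ).2 (Lp.memLp Z)
  have mg := (memLp_congr_ae hgη).2 (Lp.memLp gη)
  have hint : ∫ z, (ν z.1 * inner ℝ (weakGrad Ω T η z) (weakGrad Ω T ζ z)
      + σ z.1 * weakDt Ω T η z * ζ z + lam⁻¹ * ζ z ^ 2) ∂(muQ Ω T) =
      ⟪mulL _ (memLp_top_fst hν) E', Z'⟫ + ⟪mulL _ (memLp_top_fst hσ) gη, Z⟫
        + lam⁻¹ * ‖Z‖ ^ 2 := by
    have i1 := integrable_mul_inner hν mE' mZ'
    have i2 : Integrable (fun z => σ z.1 * weakDt Ω T η z * ζ z) (muQ Ω T) :=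
      (memLp_bdd_smul (memLp_top_fst hσ) mg).integrable_mul mZ
    have i3 : Integrable (fun z => lam⁻¹ * ζ z ^ 2) (muQ Ω T) := mZ.integrable_sq.const_mul _
    have i12 : Integrable (fun z => ν z.1 * inner ℝ (weakGrad Ω T η z) (weakGrad Ω T ζ z)
      + σ z.1 * weakDt Ω T η z * ζ z) (muQ Ω T) := i1.add i2
    rw [integral_add i12 i3, integral_add i1 i2, integral_const_mul, ← toLp_eq_of_ae mE' hη',
      ← toLp_eq_of_ae mZ' hζ', ← toLp_eq_of_ae mZ hζ, ← toLp_eq_of_ae mg hgη,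
      inner_mulL_fst hν, inner_mulL_fst_real hσ, norm_sq_toLp]
    simp only [Real.norm_eq_abs, sq_abs]
  rw [minorant, n1, n2, n3, n1', nf hη' hτ, nf hζ' hρ, hint]

theorem cost_eq_norm {lam : ℝ} (hlam : 0 < lam) {yd y p : Sp d × ℝ → ℝ}
    {B Y P : Lp ℝ 2 (muQ Ω T)} (hyd : yd =ᵐ[muQ Ω T] B) (hy : y =ᵐ[muQ Ω T] Y)
    (hp : p =ᵐ[muQ Ω T] P) :
    cost Ω T lam yd y (fun z => - lam⁻¹ * p z) =
      1 / 2 * ‖Y - B‖ ^ 2 + 1 / (2 * lam) * ‖P‖ ^ 2 := by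
  have n1 : normQ Ω T (fun z => y z - yd z) = ‖Y - B‖ := normQ_eq_norm_of_ae <| by
    filter_upwards [hy, hyd, Lp.coeFn_sub Y B] with z h1 h2 h3
    rw [h1, h2, h3, Pi.sub_apply]
  have n2 : normQ Ω T (fun z => - lam⁻¹ * p z) = ‖(-lam⁻¹) • P‖ := normQ_eq_norm_of_ae <| by
    filter_upwards [hp, Lp.coeFn_smul (-lam⁻¹) P] with z h1 h2
    rw [h1, h2, Pi.smul_apply, smul_eq_mul]
  rw [cost, n1, n2, norm_smul, norm_neg, Real.norm_of_nonneg (by positivity)]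
  field_simp

theorem exists_isFriedrichsConst (hd : 1 ≤ d) (hΩ : IsOpen Ω) (hΩb : Bornology.IsBounded Ω)
    (hT : 0 < T) : ∃ C, IsFriedrichsConst Ω T C := by
  obtain ⟨C, hC, h⟩ := exists_friedrichs (T := T) hd hΩ hΩb
  refine ⟨C, hC, fun u hu => ?_⟩
  have e : ‖hu.memL2.toLp u‖ ≤ C * ‖hu.memL2_weakGrad.toLp (weakGrad Ω T u)‖ :=
    h (mkPair hu.memL2 hu.memL2_weakGrad) (hu.mkPair_mem hT)
  rwa [normQ_eq_norm_of_ae hu.memL2.coeFn_toLp.symm,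
    normQ_eq_norm_of_ae hu.memL2_weakGrad.coeFn_toLp.symm]

theorem IsPeriodicDt.memH11ZeroPer (hT : 0 < T) {u g : Sp d × ℝ → ℝ} (h : IsPeriodicDt Ω T u g)
    (hu : MemH10Zero Ω T u) : MemH11ZeroPer Ω T u :=
  ⟨hu, ⟨g, h.isWeakDt hT⟩, h.periodicInTime hT⟩

variable [IsFiniteMeasure ((volume : Measure (Sp d)).restrict Ω)]

theorem IsFriedrichsConst.norm_le (hΩ : IsOpen Ω) {C : ℝ} (h : IsFriedrichsConst Ω T C)
    {x : PairSp Ω T} (hx : x ∈ energySpace Ω T) : ‖x.fst‖ ≤ C * ‖x.snd‖ := by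
  have e := h.2 _ (memH10Zero_of_mem_energySpace hΩ hx)
  rwa [normQ_eq_norm_of_ae (EventuallyEq.refl _ _),
    normQ_eq_norm_of_ae (weakGrad_of_mem_energySpace hΩ hx)] at e

theorem MemH11ZeroPer.isPeriodicDt (hΩ : IsOpen Ω) (hT : 0 < T) {u : Sp d × ℝ → ℝ}
    (h : MemH11ZeroPer Ω T u) : IsPeriodicDt Ω T u (weakDt Ω T u) :=
  (isWeakDt_weakDt h.2.1).isPeriodicDt hΩ hT h.1.memL2 h.2.2

/-- The minorant is a lower bound of the optimal value. -/
theorem minorant_le_cost (hΩ : IsOpen Ω) (hT : 0 < T) {σ ν : Sp d → ℝ} {C₁ lam ν₀ m C : ℝ}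
    (hσ : MemLp σ ∞ (volume.restrict Ω)) (hν : MemLp ν ∞ (volume.restrict Ω))
    (hC₁ : ∀ᵐ x ∂(volume.restrict Ω), |σ x| ≤ C₁) (hν₀ : 0 < ν₀) (hlam : 0 < lam) (hm : 0 < m)
    (hmν : Real.sqrt 2 * m ≤ ν₀) (hνl : ∀ᵐ x ∂(volume.restrict Ω), ν₀ ≤ ν x)
    {yd y p : Sp d × ℝ → ℝ} {B : Lp ℝ 2 (muQ Ω T)} (hyd : yd =ᵐ[muQ Ω T] B)
    {Y P : PairSp Ω T} (hY : Y ∈ energySpace Ω T) (hP : P ∈ energySpace Ω T)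
    (hy : y =ᵐ[muQ Ω T] Y.fst) (hp : p =ᵐ[muQ Ω T] P.fst)
    {gy : Lp ℝ 2 (muQ Ω T)} (hgy : IsPeriodicDt Ω T Y.fst gy)
    (h2 : ∀ Z ∈ energySpace Ω T, ⟪mulL _ (memLp_top_fst hν) Y.snd, Z.snd⟫
        + lam⁻¹ * ⟪P.fst, Z.fst⟫ + ⟪mulL _ (memLp_top_fst hσ) gy, Z.fst⟫ = 0)
    (hC : IsFriedrichsConst Ω T C) {η ζ : Sp d × ℝ → ℝ} {τ ρ : Sp d × ℝ → Sp d}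
    (hη : MemH11ZeroPer Ω T η) (hζ : MemH11ZeroPer Ω T ζ) (hτ : MemHdiv Ω T τ)
    (hρ : MemHdiv Ω T ρ) :
    minorant Ω T σ ν lam C m yd η ζ τ ρ ≤ cost Ω T lam yd y (fun z => - lam⁻¹ * p z) := by
  have hτ1 : MemLp τ 2 (muQ Ω T) := hτ.1
  have hρ1 : MemLp ρ 2 (muQ Ω T) := hρ.1
  have wτ := isWeakDiv_weakDiv hτ.2
  have wρ := isWeakDiv_weakDiv hρ.2
  have pη := hη.isPeriodicDt hΩ hT
  have pζ := hζ.isPeriodicDt hΩ hT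
  have gηm := pη.2.1
  have gζm := pζ.2.1
  have dτm : MemLp _ 2 (muQ Ω T) := wτ.1
  have dρm : MemLp _ 2 (muQ Ω T) := wρ.1
  rw [minorant_eq hσ hν hyd hη.1.memL2.coeFn_toLp.symm hζ.1.memL2.coeFn_toLp.symm
    hη.1.memL2_weakGrad.coeFn_toLp.symm hζ.1.memL2_weakGrad.coeFn_toLp.symm
    gηm.coeFn_toLp.symm gζm.coeFn_toLp.symm hτ1.coeFn_toLp.symm hρ1.coeFn_toLp.symm
    dτm.coeFn_toLp.symm dρm.coeFn_toLp.symm, cost_eq_norm hlam hyd hy hp]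
  let j : energySpace Ω T →L[ℝ] Lp ℝ 2 (muQ Ω T) :=
    (WithLp.fstL 2 ℝ _ _).comp (energySpace Ω T).subtypeL
  let gr : energySpace Ω T →L[ℝ] Lp (Sp d) 2 (muQ Ω T) :=
    (WithLp.sndL 2 ℝ _ _).comp (energySpace Ω T).subtypeL
  have key : ∀ u : Sp d × ℝ → ℝ, ∀ hu : MemLp u 2 (muQ Ω T), ∀ g : Sp d × ℝ → ℝ,
      ∀ hg : MemLp g 2 (muQ Ω T), IsPeriodicDt Ω T u g →
      IsPeriodicDt Ω T (hu.toLp u) (hg.toLp g) := fun u hu g hg h => by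
    have h1 := h.congr hT hu.coeFn_toLp.symm
    refine ⟨h1.1, Lp.memLp _, fun k => ?_⟩
    filter_upwards [h1.2.2 k, coefC_congr_ae hT hg.coeFn_toLp k, coefS_congr_ae hT hg.coeFn_toLp k]
      with x a b c
    rwa [b, c]
  have main := lagrangian_sub_residuals_le j gr (mulL _ (memLp_top_fst hν)) (mulL _ (memLp_top_fst hσ))
    (fun u g => IsPeriodicDt Ω T u.1.fst g) hν₀ hlam hm hmν (le_inner_mulL _ _ (ae_fst hνl))
    (fun x x' => by rw [inner_mulL_comm, real_inner_comm])
    -- Skewness of the time derivative between two periodic functions: both pairings equal the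
    -- half-derivative form, which is antisymmetric.
    (fun u g v h hu hv => by
      have e1 := hu.inner_mulL_eq_halfPerp hT hσ hC₁ (EventuallyEq.refl _ v.1.fst)
      have e2 := hv.inner_mulL_eq_halfPerp hT hσ hC₁ (EventuallyEq.refl _ u.1.fst)
      exact e1.trans ((halfPerp_antisymm σ _ _).trans (congrArg Neg.neg e2.symm)))
    hC.1 (fun v => hC.norm_le hΩ v.2) (y := ⟨Y, hY⟩) (p := ⟨P, hP⟩)
    (b := B) (gy := gy) (gη := gηm.toLp _) (gζ := gζm.toLp _) (dτ := dτm.toLp _)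
    (dρ := dρm.toLp _) (τ := hτ1.toLp τ) (ρ := hρ1.toLp ρ)
    (η := ⟨_, hη.1.mkPair_mem hT⟩) (ζ := ⟨_, hζ.1.mkPair_mem hT⟩) hgy
    (key η hη.1.memL2 _ gηm pη) (key ζ hζ.1.memL2 _ gζm pζ)
    (fun q => h2 q.1 q.2) (fun z => wτ.inner_energySpace hτ1 dτm z.2)
    (fun z => wρ.inner_energySpace hρ1 dρm z.2)
  exact main

/-- At the exact solution, the fluxes are in `H(div,Q)` and the minorant is the optimal value. -/
theorem minorant_solution (hΩ : IsOpen Ω) (hT : 0 < T) {σ ν : Sp d → ℝ} {lam : ℝ}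
    (hlam : 0 < lam) (hσ : MemLp σ ∞ (volume.restrict Ω)) (hν : MemLp ν ∞ (volume.restrict Ω))
    {yd y p : Sp d × ℝ → ℝ} {B : Lp ℝ 2 (muQ Ω T)} (hyd : yd =ᵐ[muQ Ω T] B)
    {Y P : PairSp Ω T} (hY : Y ∈ energySpace Ω T) (hP : P ∈ energySpace Ω T)
    (hy : y =ᵐ[muQ Ω T] Y.fst) (hp : p =ᵐ[muQ Ω T] P.fst)
    {gy gp : Lp ℝ 2 (muQ Ω T)} (hgy : IsPeriodicDt Ω T Y.fst gy) (hgp : IsPeriodicDt Ω T P.fst gp)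
    (h1 : ∀ Z ∈ energySpace Ω T, ⟪Y.fst, Z.fst⟫ - ⟪mulL _ (memLp_top_fst hν) P.snd, Z.snd⟫
        + ⟪mulL _ (memLp_top_fst hσ) gp, Z.fst⟫ = ⟪B, Z.fst⟫)
    (h2 : ∀ Z ∈ energySpace Ω T, ⟪mulL _ (memLp_top_fst hν) Y.snd, Z.snd⟫
        + lam⁻¹ * ⟪P.fst, Z.fst⟫ + ⟪mulL _ (memLp_top_fst hσ) gy, Z.fst⟫ = 0) :
    MemHdiv Ω T (fun z => ν z.1 • weakGrad Ω T y z) ∧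
    MemHdiv Ω T (fun z => ν z.1 • weakGrad Ω T p z) ∧
    ∀ C m, minorant Ω T σ ν lam C m yd y p (fun z => ν z.1 • weakGrad Ω T y z)
      (fun z => ν z.1 • weakGrad Ω T p z) = cost Ω T lam yd y (fun z => - lam⁻¹ * p z) := by
  have gY : weakGrad Ω T y =ᵐ[muQ Ω T] Y.snd := by
    rw [weakGrad_congr hy]; exact weakGrad_of_mem_energySpace hΩ hY
  have gP : weakGrad Ω T p =ᵐ[muQ Ω T] P.snd := by
    rw [weakGrad_congr hp]; exact weakGrad_of_mem_energySpace hΩ hP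
  have dY : weakDt Ω T y =ᵐ[muQ Ω T] gy := by
    rw [weakDt_congr hy]
    exact (isWeakDt_weakDt ⟨_, hgy.isWeakDt hT⟩).ae_eq hΩ (hgy.isWeakDt hT)
  have dP : weakDt Ω T p =ᵐ[muQ Ω T] gp := by
    rw [weakDt_congr hp]
    exact (isWeakDt_weakDt ⟨_, hgp.isWeakDt hT⟩).ae_eq hΩ (hgp.isWeakDt hT)
  have fl : ∀ {u : Sp d × ℝ → ℝ} {U : Lp (Sp d) 2 (muQ Ω T)}, weakGrad Ω T u =ᵐ[muQ Ω T] U →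
      (fun z => ν z.1 • weakGrad Ω T u z) =ᵐ[muQ Ω T] mulL _ (memLp_top_fst hν) U := by
    intro u U hu
    filter_upwards [hu, coeFn_mulL _ (memLp_top_fst hν) U] with z a b
    rw [a, b]
  -- The two equations give the divergences of ν∇y and ν∇p: σ∂ₜy + λ⁻¹p and yd - y - σ∂ₜp.
  have wY := isWeakDiv_of_energySpace
    (g := mulL _ (memLp_top_fst hσ) gy + lam⁻¹ • P.fst) (fl gY) fun Z hZ => by
      rw [inner_add_left, real_inner_smul_left]
      linarith [h2 Z hZ]
  have wP := isWeakDiv_of_energySpace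
    (g := B - Y.fst - mulL _ (memLp_top_fst hσ) gp) (fl gP) fun Z hZ => by
      rw [inner_sub_left, inner_sub_left]
      linarith [h1 Z hZ]
  have mem : ∀ {u : Sp d × ℝ → ℝ} {U : Lp (Sp d) 2 (muQ Ω T)}, weakGrad Ω T u =ᵐ[muQ Ω T] U →
      MemL2 Ω T (fun z => ν z.1 • weakGrad Ω T u z) := fun hu =>
    (memLp_congr_ae (fl hu)).2 (Lp.memLp _)
  refine ⟨⟨mem gY, _, wY⟩, ⟨mem gP, _, wP⟩, fun C m => ?_⟩
  rw [minorant_eq hσ hν hyd hy hp gY gP dY dP (fl gY) (fl gP)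
    ((isWeakDiv_weakDiv ⟨_, wY⟩).ae_eq hΩ wY) ((isWeakDiv_weakDiv ⟨_, wP⟩).ae_eq hΩ wP),
    cost_eq_norm hlam hyd hy hp]
  -- Tested with P, the state equation makes the bilinear part of the Lagrangian vanish.
  have e := h2 P hP
  rw [real_inner_self_eq_norm_sq] at e
  -- Both penalty terms contain the factor formed from R₃ and R₄, so it is enough that these two
  -- residuals vanish.
  have r3 : Y.fst - B + (B - Y.fst - mulL _ (memLp_top_fst hσ) gp)
      + mulL _ (memLp_top_fst hσ) gp = 0 := by abel
  rw [r3, sub_self, sub_self, norm_zero, norm_zero]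
  simp only [mul_zero, add_zero, ne_eq, OfNat.ofNat_ne_zero, not_false_eq_true, zero_pow, sub_zero]
  linarith

end Minorant

end TimePeriodic

end

/-! ### The main theorem -/

theorem mainTheorem3 {d : ℕ} (hd : 1 ≤ d)
    (Ω : Set (Sp d)) (hΩ : IsOpen Ω) (hΩb : Bornology.IsBounded Ω)
    (T : ℝ) (hT : 0 < T)
    (σ ν : Sp d → ℝ)
    (hσm : AEStronglyMeasurable σ (volume.restrict Ω))
    (hνm : AEStronglyMeasurable ν (volume.restrict Ω))
    (σ₀ σ₁ ν₀ ν₁ : ℝ) (hσ₀ : 0 < σ₀) (hν₀ : 0 < ν₀)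
    (hσ : ∀ x ∈ Ω, σ₀ ≤ σ x ∧ σ x ≤ σ₁)
    (hν : ∀ x ∈ Ω, ν₀ ≤ ν x ∧ ν x ≤ ν₁)
    (lam : ℝ) (hlam : 0 < lam)
    (yd : Sp d × ℝ → ℝ) (hyd : MemL2 Ω T yd) :
    -- Friedrichs constants exist
    (∃ CF, IsFriedrichsConst Ω T CF) ∧
    -- the optimal control problem is uniquely solvable
    (∃ y u, IsOptimal Ω T σ ν lam yd y u) ∧
    (∀ y u y' u', IsOptimal Ω T σ ν lam yd y u → IsOptimal Ω T σ ν lam yd y' u' →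
      y =ᵐ[muQ Ω T] y' ∧ u =ᵐ[muQ Ω T] u') ∧
    -- and it is equivalent to the optimality system
    (∀ y u, IsOptimal Ω T σ ν lam yd y u ↔
      ∃ p, SolvesKKT Ω T σ ν lam yd y p ∧ u =ᵐ[muQ Ω T] fun z => - lam⁻¹ * p z) ∧
    -- the supremum of the minorant is the optimal value, and it is attained at the exact solution
    (∀ y u p, IsOptimal Ω T σ ν lam yd y u → SolvesKKT Ω T σ ν lam yd y p →
      MemH11ZeroPer Ω T y ∧ MemH11ZeroPer Ω T p ∧
      MemHdiv Ω T (fun z => ν z.1 • weakGrad Ω T y z) ∧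
      MemHdiv Ω T (fun z => ν z.1 • weakGrad Ω T p z) ∧
      ∀ CF, IsFriedrichsConst Ω T CF →
        minorant Ω T σ ν lam CF (mu1 ν₀ σ₀) yd y p
          (fun z => ν z.1 • weakGrad Ω T y z) (fun z => ν z.1 • weakGrad Ω T p z)
            = cost Ω T lam yd y u ∧
        IsLUB {r : ℝ | ∃ η ζ τ ρ, MemH11ZeroPer Ω T η ∧ MemH11ZeroPer Ω T ζ ∧
            MemHdiv Ω T τ ∧ MemHdiv Ω T ρ ∧
            r = minorant Ω T σ ν lam CF (mu1 ν₀ σ₀) yd η ζ τ ρ}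
          (cost Ω T lam yd y u)) := by
  have hvol : volume Ω < ⊤ := hΩb.measure_lt_top
  have : IsFiniteMeasure ((volume : Measure (Sp d)).restrict Ω) :=
    ⟨by rwa [Measure.restrict_apply_univ]⟩
  have bd : ∀ {κ : Sp d → ℝ} {a b : ℝ}, 0 < a → (∀ x ∈ Ω, a ≤ κ x ∧ κ x ≤ b) →
      ∀ᵐ x ∂(volume.restrict Ω), |κ x| ≤ b := fun ha h => by
    filter_upwards [ae_restrict_mem hΩ.measurableSet] with x hx
    rw [abs_of_pos (ha.trans_le (h x hx).1)]
    exact (h x hx).2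
  have hσb := bd hσ₀ hσ
  have hσL : MemLp σ ⊤ (volume.restrict Ω) := memLp_top_of_bound hσm σ₁ hσb
  have hνL : MemLp ν ⊤ (volume.restrict Ω) := memLp_top_of_bound hνm ν₁ (bd hν₀ hν)
  have hσl : ∀ᵐ x ∂(volume.restrict Ω), σ₀ ≤ σ x := by
    filter_upwards [ae_restrict_mem hΩ.measurableSet] with x hx using (hσ x hx).1
  have hνl : ∀ᵐ x ∂(volume.restrict Ω), ν₀ ≤ ν x := by
    filter_upwards [ae_restrict_mem hΩ.measurableSet] with x hx using (hν x hx).1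
  have hydm : MemLp yd 2 (muQ Ω T) := hyd
  obtain ⟨Y, hY, P, hP, gy, gp, hgy, hgp, e1, e2⟩ := exists_regular_solution hd hΩ hΩb hT hσL hνL
    hσ₀ hν₀ hlam hσl hνl (hydm.toLp yd)
  have hK := solvesKKT_of_energySpace hΩ hT hσL hνL hσb hydm hY hP hgy hgp e1 e2
  have optimal : ∀ {y u p}, SolvesKKT Ω T σ ν lam yd y p →
      u =ᵐ[muQ Ω T] (fun z => - lam⁻¹ * p z) → IsOptimal Ω T σ ν lam yd y u := by
    intro y u p h hu
    have hum : MemLp (fun z => - lam⁻¹ * p z) 2 (muQ Ω T) := h.2.1.1.memL2.const_mul _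
    refine ⟨(memLp_congr_ae hu).2 hum,
      (h.isState hνL).congr hT (Filter.EventuallyEq.refl _ _) hu.symm, fun z v hv hz => ?_⟩
    rw [cost_congr (Filter.EventuallyEq.refl _ y) hu, h.cost_eq hlam hνL hydm hv hz]
    have : 0 ≤ lam / 2 * normQ Ω T (fun s => v s - - lam⁻¹ * p s) ^ 2 := by positivity
    nlinarith [sq_nonneg (normQ Ω T (fun s => z s - y s))]
  have unique : ∀ {y u}, IsOptimal Ω T σ ν lam yd y u →
      y =ᵐ[muQ Ω T] Y.fst ∧ u =ᵐ[muQ Ω T] fun z => - lam⁻¹ * P.fst z := by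
    intro y u h
    have hO := optimal hK (Filter.EventuallyEq.refl _ _)
    -- An optimal pair costs no more than the reference pair, whereas the expansion of its cost
    -- exceeds the reference cost by two squared distances; both must vanish.
    have c1 := h.2.2 _ _ hO.1 hO.2.1
    have hu : MemLp u 2 (muQ Ω T) := h.1
    have hU : MemLp (fun z => - lam⁻¹ * P.fst z) 2 (muQ Ω T) := hO.1
    have hym := h.2.1.1.1.memL2
    have hYm := hK.1.1.memL2
    rw [hK.cost_eq hlam hνL hydm hu h.2.1, normQ_sub_eq hym hYm, normQ_sub_eq hu hU] at c1
    have n1 := sq_nonneg ‖hym.toLp y - hYm.toLp Y.fst‖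
    have n2 := mul_nonneg (half_pos hlam).le (sq_nonneg ‖hu.toLp u - hU.toLp _‖)
    have z1 : ‖hym.toLp y - hYm.toLp Y.fst‖ ^ 2 = 0 := by linarith
    have z2 : lam / 2 * ‖hu.toLp u - hU.toLp _‖ ^ 2 = 0 := by linarith
    have z2' := (mul_eq_zero.1 z2).resolve_left (half_pos hlam).ne'
    exact ⟨(MemLp.toLp_eq_toLp_iff hym hYm).1
        (sub_eq_zero.1 (norm_eq_zero.1 (pow_eq_zero_iff two_ne_zero |>.1 z1))),
      (MemLp.toLp_eq_toLp_iff hu hU).1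
        (sub_eq_zero.1 (norm_eq_zero.1 (pow_eq_zero_iff two_ne_zero |>.1 z2')))⟩
  refine ⟨exists_isFriedrichsConst hd hΩ hΩb hT,
    ⟨_, _, optimal hK (Filter.EventuallyEq.refl _ _)⟩, fun y u y' u' h h' => ?_, fun y u => ?_,
    fun y u p h hkkt => ?_⟩
  · obtain ⟨a, b⟩ := unique h
    obtain ⟨a', b'⟩ := unique h'
    exact ⟨a.trans a'.symm, b.trans b'.symm⟩
  · constructor
    · intro h
      obtain ⟨a, b⟩ := unique h
      exact ⟨P.fst, hK.congr hT a.symm (Filter.EventuallyEq.refl _ _), b⟩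
    · rintro ⟨p, h, hu⟩
      exact optimal h hu
  · obtain ⟨hy, hu⟩ := unique h
    -- Any solution of the optimality system produces an optimal control -p/λ; by uniqueness p
    -- agrees with the regular adjoint state, whose time derivative it inherits.
    have hpu := (unique (optimal hkkt (Filter.EventuallyEq.refl _ _))).2
    have hp : p =ᵐ[muQ Ω T] P.fst := by
      filter_upwards [hpu] with z hz
      exact mul_left_cancel₀ (neg_ne_zero.2 (inv_ne_zero hlam.ne')) hz
    have hcost : cost Ω T lam yd y u = cost Ω T lam yd y (fun z => - lam⁻¹ * p z) :=
      cost_congr (Filter.EventuallyEq.refl _ y) (hu.trans hpu.symm)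
    have my := (hgy.congr hT hy.symm).memH11ZeroPer hT hkkt.1.1
    have mp := (hgp.congr hT hp.symm).memH11ZeroPer hT hkkt.2.1.1
    obtain ⟨d1, d2, hval⟩ := minorant_solution hΩ hT hlam hσL hνL hydm.coeFn_toLp.symm hY hP hy hp
      hgy hgp e1 e2
    refine ⟨my, mp, d1, d2, fun CF hCF => ?_⟩
    rw [hcost]
    -- The value is attained at the exact solution, so any upper bound is at least the cost; only
    -- the upper-bound property is left.
    refine ⟨hval _ _, ⟨?_, fun r hr => hr ⟨y, p, _, _, my, mp, d1, d2, (hval _ _).symm⟩⟩⟩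
    rintro _ ⟨η, ζ, τ, ρ, hη, hζ, hτ, hρ, rfl⟩
    exact minorant_le_cost hΩ hT hσL hνL hσb hν₀ hlam (mu1_pos hν₀ hσ₀) (sqrt_two_mul_mu1_le ν₀ σ₀)
      hνl hydm.coeFn_toLp.symm hY hP hy hp hgy e2 hCF hη hζ hτ hρ
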